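/- **Asymptotic quantitative isoperimetric inequality.** For a measurable set $E\subset\mathbb{R}^2$ let $|E|$ be its area, $P(E)=\sup\{\int_E \operatorname{div}\varphi : \varphi\in C_c^\infty(\mathbb{R}^2,\mathbb{R}^2),\ |\varphi|\le 1\}$ its perimeter, and, if $0<|E|<\infty$, let $\kappa_E=\sqrt{\pi/|E|}$ be the curvature of a circle enclosing area $|E|$. For every $\bar\kappa>0$ and every $A>0$ there is a constant $C\ge 0$, depending only on $\bar\kappa$ and $A$, with the following property. Let $E\subset\mathbb{R}^2$ be an open set of area $|E|=A$ and of finite perimeter, let $m\in\mathbb{N}$, and suppose that the boundary of $E$ contains $m$ arcs (circular arcs shorter than a full circle, or segments), of constant curvatures $\kappa_1,\dots,\kappa_m$ with $\kappa_i\le\bar\kappa$ and with chords of lengths $\ell_1,\dots,\ell_m$, which do not overlap (they have at most endpoints in common). Here $E$ is assumed to lie on one side of each arc, that is, near each interior point of the arc $E$ agrees, up to a null set, with one of the two sides of the circle or line carrying the arc; the curvature is signed, positive if the arc is curved outwards (as for the boundary of a disk) and negative if it is curved inwards. Then $$P(E)\ \ge\ \sqrt{4\pi|E|}+\frac1{24}\sum_{i=1}^m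 \ell_i^3(\kappa_i-\kappa_E)^2-C\sum_{i=1}^m\ell_i^5 .$$ -/

import Mathlib

open MeasureTheory Set
open scoped ContDiff

noncomputable section

/-- The Euclidean plane, with its Euclidean norm and Lebesgue measure. -/
abbrev Plane : Type := EuclideanSpace ℝ (Fin 2)

/-- The divergence of a planar vector field. -/
def planeDiv (φ : Plane → Plane) (x : Plane) : ℝ :=
  ∑ i : Fin 2, (fderiv ℝ φ x (EuclideanSpace.single i 1)) i

/-- The smooth compactly supported vector fields of length at most one. -/
def perimeterTestFields : Set (Plane → Plane) :=
  {φ | ContDiff ℝ ∞ φ ∧ HasCompactSupport φ ∧ ∀ x, ‖φ x‖ ≤ 1}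

/-- The (variational) perimeter of a planar set: the supremum of `∫_E div φ` over all smooth
compactly supported fields with `|φ| ≤ 1`. The zero field is allowed, so cutting the integrals off
at zero does not change the supremum. -/
def perimeter (E : Set Plane) : ENNReal :=
  ⨆ φ ∈ perimeterTestFields, ENNReal.ofReal (∫ x in E, planeDiv φ x)

/-- The area of a planar set (used for sets of finite area). -/
def area (E : Set Plane) : ℝ := (volume E).toReal

/-- The curvature `κ_E = 1 / r_E` of a circle that encloses the same area as `E`, where
`r_E = √(|E| / π)`. -/
def idealCurvature (E : Set Plane) : ℝ := 1 / √(area E / Real.pi)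

/-- An oriented arc of constant curvature in the plane (a circular arc, or a segment if the
curvature is zero), given by its starting point, the angle of its initial direction, its signed
curvature (positive if the arc turns to the left) and its length. The last condition says that the
arc is shorter than a full circle. -/
structure CircularArc where
  start : Plane
  angle : ℝ
  curvature : ℝ
  length : ℝ
  length_pos : 0 < length
  not_closed : |curvature| * length < 2 * Real.pi

namespace CircularArc

/-- The unit tangent vector at arc length `t`; it rotates with constant speed `curvature`. -/
def tangent (γ : CircularArc) (t : ℝ) : Plane :=
  !₂[Real.cos (γ.angle + γ.curvature * t), Real.sin (γ.angle + γ.curvature * t)]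

/-- The unit normal vector at arc length `t` that points to the left of the arc. -/
def leftNormal (γ : CircularArc) (t : ℝ) : Plane :=
  !₂[-Real.sin (γ.angle + γ.curvature * t), Real.cos (γ.angle + γ.curvature * t)]

/-- The arc-length parametrization of the arc. -/
def point (γ : CircularArc) (t : ℝ) : Plane :=
  γ.start + ∫ s in (0 : ℝ)..t, γ.tangent s

/-- The arc as a set, endpoints included. -/
def carrier (γ : CircularArc) : Set Plane := γ.point '' Icc 0 γ.length

/-- The arc as a set, without its endpoints. -/
def openCarrier (γ : CircularArc) : Set Plane := γ.point '' Ioo 0 γ.length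

/-- The length of the chord, the segment between the two endpoints. -/
def chord (γ : CircularArc) : ℝ := dist (γ.point 0) (γ.point γ.length)

/-- The open region to the left of the whole circle (or line) that carries the arc: an open disk of
radius `1 / κ` if `κ > 0`, an open half-plane if `κ = 0`, and the complement of a closed disk of
radius `1 / |κ|` if `κ < 0`. -/
def leftSide (γ : CircularArc) : Set Plane :=
  {x | γ.curvature * ‖x - γ.start‖ ^ 2 < 2 * inner ℝ (γ.leftNormal 0) (x - γ.start)}

/-- The arc is a portion of the boundary of `E`, with `E` on its left: it is contained in the
topological boundary, and near each of its points other than the endpoints `E` agrees, up to a null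
set, with the left side of the arc. With this orientation the curvature of the arc is positive if
the boundary of `E` is curved outwards along it (as for a disk), negative if it is curved inwards. -/
def IsBoundaryArc (γ : CircularArc) (E : Set Plane) : Prop :=
  γ.carrier ⊆ frontier E ∧
    ∀ x ∈ γ.openCarrier, ∃ δ > 0, E =ᵐ[volume.restrict (Metric.ball x δ)] γ.leftSide

end CircularArc

end

open MeasureTheory Set
open scoped ContDiff

noncomputable section

/-! The isoperimetric inequality is applied not to `E` but to competitors obtained by trading
boundary arcs for other arcs over the same chords. Let `|E| = πR²` and `k = κ_E = 1/R`. Replacing an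
arc of curvature `κ` and chord `ℓ` by one of curvature `k` changes the area by about `(k - κ)ℓ³/12`
and saves a length of about `(κ² - k²)ℓ³/24`. The isoperimetric bound has derivative `k` in the
area, so the total gain is `k(k - κ)ℓ³/12 + (κ² - k²)ℓ³/24 = ℓ³(κ - k)²/24`, up to errors of order
`ℓ⁵`.

The new curve may cross itself. The competitor is therefore the integer-valued function `1_E` plus
signed indicators of the caps between arcs and chords, and the inequality needed is
`isoperimetric_of_integer_valued`. It follows from the sharp Sobolev inequality `4π∫u² ≤ |Du|²`,
because `|u| ≤ u²` on the integers; the Sobolev inequality comes from a Knothe transport map to the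
disk. Two ingredients bound the total variation of the competitor: the divergence theorem on caps
(`flux_eq`), and `integral_add_sum_length_sub_flux_le`, which bends an arbitrary test field into the
outward normal along the arcs, so that `E` pays their full length. They combine in
`isoperimetric_recurve`.

The expansion must survive three difficulties. Curvatures are not bounded below; only `|κ|ℓ ≤ 2` is
available. The quadratic error in the area, estimated by Cauchy–Schwarz, contains `κ²ℓ⁵`, which is
absorbed by a term `κ⁴ℓ⁵/640` in the length gain. This needs a bound on the total chord length; if
the chords add up to at least `4πR`, the estimate `P(E) ≥ Σ length` already suffices. Large caps
over short chords are nearly full disks and cannot be flattened cheaply: they are either all kept or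
all detached, and `le_of_detach` shows that one of these choices works, the critical case being a
single cap of radius close to `R`, whose curvature deviation is then small. Finally, for chords
above a fixed threshold the deviation is itself at most `Cℓ⁵`, and these arcs stay untouched. -/

/-! ### Knothe transport and the sharp Sobolev inequality for smooth functions -/

lemma two_mul_add_sin_strictMono : StrictMono fun t : ℝ => 2 * t + Real.sin (2 * t) := by
  intro a b hab
  have h1 := Real.sin_sub_sin (2 * b) (2 * a)
  have h2 : (2 * b - 2 * a) / 2 = b - a := by ring
  rw [h2] at h1
  have h3 : |Real.sin (b - a)| < b - a := by
    have := Real.abs_sin_lt_abs (x := b - a) (by linarith)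
    rwa [abs_of_pos (by linarith : 0 < b - a)] at this
  have h4 := Real.abs_cos_le_one ((2 * b + 2 * a) / 2)
  have h5 : |Real.sin (b - a) * Real.cos ((2 * b + 2 * a) / 2)| < b - a := by
    rw [abs_mul]
    calc _ ≤ |Real.sin (b - a)| * 1 := by gcongr
      _ < b - a := by linarith
  have := (abs_lt.1 h5).1
  show 2 * a + Real.sin (2 * a) < 2 * b + Real.sin (2 * b)
  nlinarith

/-- The function `θ` inverts `t ↦ 2t + sin 2t`. The part of the unit disk to the left of the
abscissa `sin θ` has area `π/2 + θ + sin θ cos θ`, so `y = 2θ + sin 2θ` runs from `-π` to `π` as the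
abscissa crosses the disk: `sin ∘ θ` is the one-dimensional transport onto the first marginal of the
disk. -/
lemma exists_semicircle_angle : ∃ θ : ℝ → ℝ, Continuous θ ∧ ∀ y, -Real.pi < y → y < Real.pi →
    0 < Real.cos (θ y) ∧ HasDerivAt θ (4 * Real.cos (θ y) ^ 2)⁻¹ y := by
  set k : ℝ → ℝ := fun t => 2 * t + Real.sin (2 * t) with hk
  have hmono : StrictMono k := two_mul_add_sin_strictMono
  have hcont : Continuous k := by fun_prop
  have hsurj : Function.Surjective k := by
    apply hcont.surjective
    · apply Filter.tendsto_atTop_mono (f := fun t => 2 * t - 1)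
      · intro t; have := Real.neg_one_le_sin (2 * t); simp only [hk]; linarith
      · exact Filter.tendsto_atTop_add_const_right _ _
          (Filter.tendsto_id.const_mul_atTop (by norm_num))
    · apply Filter.tendsto_atBot_mono (g := k) (f := fun t => 2 * t + 1)
      · intro t; have := Real.sin_le_one (2 * t); simp only [hk]; linarith
      · exact Filter.tendsto_atBot_add_const_right _ _
          (Filter.tendsto_id.const_mul_atBot (by norm_num))
  set e := (hmono.orderIsoOfSurjective k hsurj) with he
  have hke : ∀ y, k (e.symm y) = y := fun y => e.apply_symm_apply y
  refine ⟨e.symm, e.symm.continuous, fun y h1 h2 => ?_⟩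
  have hlt : e.symm y < Real.pi / 2 := by
    rw [← hmono.lt_iff_lt, hke]
    simp only [hk]; rw [mul_div_cancel₀ _ (two_ne_zero), Real.sin_pi]; linarith
  have hgt : -(Real.pi / 2) < e.symm y := by
    rw [← hmono.lt_iff_lt, hke]
    simp only [hk]; rw [mul_neg, mul_div_cancel₀ _ (two_ne_zero), Real.sin_neg, Real.sin_pi]; linarith
  have hcos : 0 < Real.cos (e.symm y) := Real.cos_pos_of_mem_Ioo ⟨hgt, hlt⟩
  refine ⟨hcos, ?_⟩
  apply HasDerivAt.of_local_left_inverse (f := k) e.symm.continuous.continuousAt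
  · have h : HasDerivAt k (2 * 1 + Real.cos (2 * (e.symm y)) * (2 * 1)) (e.symm y) :=
      ((hasDerivAt_id _).const_mul 2).add (((hasDerivAt_id _).const_mul 2).sin)
    have h' : 2 * 1 + Real.cos (2 * (e.symm y)) * (2 * 1) = 4 * Real.cos (e.symm y) ^ 2 := by
      rw [Real.cos_two_mul]; ring
    rwa [h'] at h
  · positivity
  · exact Filter.Eventually.of_forall hke

lemma intervalIntegral_mem_of_support {g : ℝ → ℝ} (hg : Continuous g) (h0 : ∀ t, 0 ≤ g t) {B : ℝ}
    (hB : ∀ t, B ≤ |t| → g t = 0) (hB0 : 0 ≤ B) (x : ℝ) :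
    0 ≤ ∫ t in (-B)..x, g t ∧ ∫ t in (-B)..x, g t ≤ ∫ t in (-B)..B, g t := by
  have hi : ∀ a b, IntervalIntegrable g volume a b := fun a b => hg.intervalIntegrable a b
  have hz : ∀ a b, (∀ t ∈ uIcc a b, B ≤ |t|) → ∫ t in a..b, g t = 0 := by
    intro a b h
    rw [intervalIntegral.integral_congr (g := fun _ => 0) (fun t ht => hB t (h t ht))]; simp
  have hn : ∀ a b, a ≤ b → 0 ≤ ∫ t in a..b, g t := fun a b h =>
    intervalIntegral.integral_nonneg h (fun t _ => h0 t)
  have hadd := intervalIntegral.integral_add_adjacent_intervals (hi (-B) x) (hi x B)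
  rcases le_total x (-B) with h | h
  · rw [hz (-B) x]
    · exact ⟨le_rfl, hn _ _ (by linarith)⟩
    · intro t ht
      rw [uIcc_of_ge h] at ht
      rw [le_abs]; right; linarith [ht.2]
  · rcases le_total x B with h' | h'
    · exact ⟨hn _ _ h, by linarith [hn _ _ h']⟩
    · have : ∫ t in x..B, g t = 0 := by
        apply hz
        intro t ht
        rw [uIcc_of_ge h'] at ht
        rw [le_abs]; left; linarith [ht.1]
      exact ⟨hn _ _ h, by linarith⟩

lemma integral_eq_intervalIntegral_of_support {g : ℝ → ℝ} {B : ℝ}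
    (hB : ∀ t, B ≤ |t| → g t = 0) : ∫ t, g t = ∫ t in (-B)..B, g t := by
  rw [intervalIntegral.integral_eq_integral_of_support_subset]
  intro t ht
  by_contra h
  apply ht
  apply hB
  simp only [mem_Ioc, not_and_or, not_lt, not_le] at h
  rw [le_abs]
  rcases h with h | h
  · right; linarith
  · left; linarith

lemma integral_mul_lineDeriv_eq_neg {E : Type*} [NormedAddCommGroup E] [NormedSpace ℝ E]
    [FiniteDimensional ℝ E] [MeasurableSpace E] [BorelSpace E] {μ : Measure E} [μ.IsAddHaarMeasure]
    {v T T' : E → ℝ} {e : E} (hv : ContDiff ℝ 1 v) (hc : HasCompactSupport v)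
    (hT : Continuous T) (hT' : Continuous T') (h : ∀ x, HasLineDerivAt ℝ T (T' x) x e) :
    ∫ x, v x * T' x ∂μ = -∫ x, fderiv ℝ v x e * T x ∂μ := by
  have hd : Continuous fun x => fderiv ℝ v x e :=
    (hv.continuous_fderiv one_ne_zero).clm_apply continuous_const
  refine integral_bilinear_hasLineDerivAt_right_eq_neg_left_of_integrable
    (B := ContinuousLinearMap.mul ℝ ℝ) (f := v) (g := T) (v := e) ?_ ?_ ?_ ?_ ?_
  · exact (hd.mul hT).integrable_of_hasCompactSupport ((hc.fderiv_apply ℝ e).mul_right)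
  · exact (hv.continuous.mul hT').integrable_of_hasCompactSupport hc.mul_right
  · exact (hv.continuous.mul hT).integrable_of_hasCompactSupport hc.mul_right
  · intro x _
    exact (hv.differentiable one_ne_zero x).hasFDerivAt.hasLineDerivAt e
  · intro x _; exact h x

lemma two_mul_sqrt_mul_le_add {a b : ℝ} (ha : 0 ≤ a) (hb : 0 ≤ b) : 2 * √(a * b) ≤ a + b := by
  rw [Real.sqrt_mul ha]
  nlinarith [sq_nonneg (√a - √b), Real.sq_sqrt ha, Real.sq_sqrt hb]

lemma mul_add_mul_le_sqrt {a b s t : ℝ} (h : s ^ 2 + t ^ 2 ≤ 1) :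
    a * s + b * t ≤ √(a ^ 2 + b ^ 2) := by
  apply Real.le_sqrt_of_sq_le
  nlinarith [sq_nonneg (a * t - b * s), sq_nonneg a, sq_nonneg b]

/-- The Knothe map from the density `v ^ 2` to the uniform measure on the disk, regularized by
`ε`, tested against the gradient of `v`. -/
lemma regularized_knothe_bound {v : ℝ × ℝ → ℝ} (hv0 : ∀ z, 0 ≤ v z) (hv : ContDiff ℝ 1 v)
    (hc : HasCompactSupport v) {B : ℝ} (hB0 : 0 ≤ B) (hB : ∀ x y, B ≤ |x| ∨ B ≤ |y| → v (x, y) = 0)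
    (hN : 0 < ∫ z, v z ^ 2) {ε : ℝ} (hε : 0 < ε) (hε1 : ε < 1) :
    2 * √(Real.pi * (1 - ε) / ∫ z, v z ^ 2) *
        ∫ z, √((∫ t in (-B)..B, v (z.1, t) ^ 2) / ((∫ t in (-B)..B, v (z.1, t) ^ 2) + ε)) * v z ^ 2
      ≤ ∫ z, √((fderiv ℝ v z (1, 0)) ^ 2 + (fderiv ℝ v z (0, 1)) ^ 2) := by
  set N := ∫ z, v z ^ 2 with hNdef
  have hvc : Continuous v := hv.continuous
  set f₁ : ℝ → ℝ := fun x => ∫ t in (-B)..B, v (x, t) ^ 2 with hf₁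
  set Ψ : ℝ × ℝ → ℝ := fun z => ∫ t in (-B)..z.2, v (z.1, t) ^ 2 with hΨ
  set Φ : ℝ → ℝ := fun x => ∫ s in (-B)..x, f₁ s with hΦ
  have hf₁c : Continuous f₁ :=
    intervalIntegral.continuous_parametric_intervalIntegral_of_continuous' (by fun_prop) _ _
  have hΨc : Continuous Ψ := by
    apply intervalIntegral.continuous_parametric_intervalIntegral_of_continuous _ continuous_snd
    fun_prop
  have hΨb : ∀ z : ℝ × ℝ, 0 ≤ Ψ z ∧ Ψ z ≤ f₁ z.1 := fun z =>
    intervalIntegral_mem_of_support (g := fun t => v (z.1, t) ^ 2) (by fun_prop)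
      (fun t => sq_nonneg _) (fun t ht => by simp [hB _ _ (Or.inr ht)]) hB0 z.2
  have hf₁0 : ∀ x, 0 ≤ f₁ x := fun x => (hΨb (x, 0)).1.trans (hΨb (x, 0)).2
  have hf₁B : ∀ x, B ≤ |x| → f₁ x = 0 := by
    intro x hx
    simp only [hf₁]
    simp [fun t => hB x t (Or.inl hx)]
  have hΦN : Φ B = N := by
    have hi : Integrable (fun z : ℝ × ℝ => v z ^ 2) := by
      apply Continuous.integrable_of_hasCompactSupport (by fun_prop)
      have : HasCompactSupport fun z => v z * v z := hc.mul_right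
      simpa only [pow_two] using this
    rw [hNdef, Measure.volume_eq_prod, integral_prod _ hi]
    simp only [hΦ]
    rw [integral_eq_intervalIntegral_of_support (B := B)]
    · congr 1; ext x
      rw [integral_eq_intervalIntegral_of_support (B := B)]
      intro t ht; simp [hB _ _ (Or.inr ht)]
    · intro x hx; simp [fun t => hB x t (Or.inl hx)]
  have hΦb : ∀ x, 0 ≤ Φ x ∧ Φ x ≤ N := fun x => by
    rw [← hΦN]; exact intervalIntegral_mem_of_support hf₁c hf₁0 hf₁B hB0 x
  have hΦd : ∀ x, HasDerivAt Φ (f₁ x) x := fun x => hf₁c.integral_hasStrictDerivAt _ x |>.hasDerivAt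
  have hΨd : ∀ x y, HasDerivAt (fun y => Ψ (x, y)) (v (x, y) ^ 2) y := fun x y =>
    ((by fun_prop : Continuous fun t => v (x, t) ^ 2).integral_hasStrictDerivAt _ y).hasDerivAt
  obtain ⟨θ, hθc, hθ⟩ := exists_semicircle_angle
  -- The factor `1 - ε` keeps `Y` strictly inside `(-π, π)`, where the cosine is positive and `θ` is
  -- differentiable.
  set Y : ℝ → ℝ := fun x => Real.pi * (1 - ε) * (2 * (Φ x / N) - 1) with hY
  have hYb : ∀ x, -Real.pi < Y x ∧ Y x < Real.pi := by
    intro x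
    have h1 : 0 ≤ Φ x / N := div_nonneg (hΦb x).1 hN.le
    have h2 : Φ x / N ≤ 1 := (div_le_one hN).2 (hΦb x).2
    have hp := Real.pi_pos
    have h3 : 0 < Real.pi * ε := by positivity
    have h4 : 0 < Real.pi * (1 - ε) := mul_pos hp (by linarith)
    simp only [hY]
    constructor <;> nlinarith
  have hYd : ∀ x, HasDerivAt Y (Real.pi * (1 - ε) * (2 * (f₁ x / N))) x := fun x =>
    ((((hΦd x).div_const N).const_mul 2).sub_const 1).const_mul _
  have hYc : Continuous Y := continuous_iff_continuousAt.2 fun x => (hYd x).continuousAt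
  set c : ℝ → ℝ := fun x => Real.cos (θ (Y x)) with hcdef
  set s : ℝ → ℝ := fun x => Real.sin (θ (Y x)) with hsdef
  have hcc : Continuous c := by fun_prop
  have hsc : Continuous s := by fun_prop
  have hcpos : ∀ x, 0 < c x := fun x => (hθ _ (hYb x).1 (hYb x).2).1
  set s' : ℝ → ℝ := fun x => Real.pi * (1 - ε) * (f₁ x / N) / (2 * c x) with hs'
  have hs'c : Continuous s' := by
    simp only [hs']
    exact Continuous.div (by fun_prop) (by fun_prop) fun x => by have := hcpos x; positivity
  have hsd : ∀ x, HasDerivAt s (s' x) x := by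
    intro x
    have h := (((hθ _ (hYb x).1 (hYb x).2).2).comp x (hYd x)).sin
    have h0 := (hcpos x).ne'
    have heq : s' x = c x * ((4 * c x ^ 2)⁻¹ * (Real.pi * (1 - ε) * (2 * (f₁ x / N)))) := by
      simp only [hs']
      field_simp
      ring
    rw [heq]
    exact h
  have hden : ∀ x, 0 < f₁ x + ε := fun x => by linarith [hf₁0 x]
  -- The second Knothe component maps each vertical fibre to the chord of half-length `c` of the
  -- disk. The `ε` in the denominator replaces the division by `f₁`, which may vanish.
  set T₂ : ℝ × ℝ → ℝ := fun z => c z.1 * ((2 * Ψ z - f₁ z.1) / (f₁ z.1 + ε)) with hT₂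
  set T₂' : ℝ × ℝ → ℝ := fun z => c z.1 * (2 * v z ^ 2 / (f₁ z.1 + ε)) with hT₂'
  have hT₂c : Continuous T₂ := by
    apply Continuous.mul (by fun_prop)
    exact Continuous.div (by fun_prop) (by fun_prop) fun z => (hden _).ne'
  have hT₂'c : Continuous T₂' := by
    apply Continuous.mul (by fun_prop)
    exact Continuous.div (by fun_prop) (by fun_prop) fun z => (hden _).ne'
  have hT₂d : ∀ x y, HasDerivAt (fun y => T₂ (x, y)) (T₂' (x, y)) y := fun x y =>
    ((((hΨd x y).const_mul 2).sub_const (f₁ x)).div_const (f₁ x + ε)).const_mul (c x)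
  have hT : ∀ z : ℝ × ℝ, (-s z.1) ^ 2 + (-T₂ z) ^ 2 ≤ 1 := by
    intro z
    have h1 : s z.1 ^ 2 + c z.1 ^ 2 = 1 := Real.sin_sq_add_cos_sq _
    have h2 : ((2 * Ψ z - f₁ z.1) / (f₁ z.1 + ε)) ^ 2 ≤ 1 := by
      rw [sq_le_one_iff_abs_le_one, abs_div, abs_of_pos (hden z.1), div_le_one (hden z.1), abs_le]
      have := hΨb z
      constructor <;> linarith [this.1, this.2]
    have h3 : T₂ z ^ 2 ≤ c z.1 ^ 2 := by
      simp only [hT₂, mul_pow]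
      nlinarith [sq_nonneg (c z.1)]
    nlinarith
  have hd : ∀ e, Continuous fun x => fderiv ℝ v x e := fun e =>
    (hv.continuous_fderiv one_ne_zero).clm_apply continuous_const
  have hdc : ∀ e, HasCompactSupport fun x => fderiv ℝ v x e := fun e => hc.fderiv_apply ℝ e
  have ibp₁ : ∫ z : ℝ × ℝ, v z * s' z.1 = -∫ z : ℝ × ℝ, fderiv ℝ v z (1, 0) * s z.1 := by
    apply integral_mul_lineDeriv_eq_neg hv hc (T := fun z => s z.1) (by fun_prop) (by fun_prop)
    intro z
    have h : HasDerivAt (fun t : ℝ => z.1 + t) 1 0 := by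
      simpa using (hasDerivAt_id (0 : ℝ)).const_add z.1
    have h2 : HasDerivAt s (s' z.1) (z.1 + 0) := by simpa using hsd z.1
    simpa [HasLineDerivAt, Function.comp_def] using h2.comp (0 : ℝ) h
  have ibp₂ : ∫ z, v z * T₂' z = -∫ z, fderiv ℝ v z (0, 1) * T₂ z := by
    apply integral_mul_lineDeriv_eq_neg hv hc hT₂c hT₂'c
    intro z
    have h : HasDerivAt (fun t : ℝ => z.2 + t) 1 0 := by
      simpa using (hasDerivAt_id (0 : ℝ)).const_add z.2
    have h2 : HasDerivAt (fun y => T₂ (z.1, y)) (T₂' z) (z.2 + 0) := by simpa using hT₂d z.1 z.2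
    have h3 := h2.comp (0 : ℝ) h
    have h4 : (fun t : ℝ => T₂ (z + t • (0, 1))) = (fun y => T₂ (z.1, y)) ∘ fun t => z.2 + t := by
      ext t
      simp only [Function.comp]
      congr 1
      ext <;> simp
    rw [HasLineDerivAt, h4]
    simpa using h3
  have i1 : Integrable fun z : ℝ × ℝ => v z * s' z.1 :=
    (hvc.mul (by fun_prop)).integrable_of_hasCompactSupport hc.mul_right
  have i2 : Integrable fun z : ℝ × ℝ => v z * T₂' z :=
    (hvc.mul (by fun_prop)).integrable_of_hasCompactSupport hc.mul_right
  have i3 : Integrable fun z : ℝ × ℝ => fderiv ℝ v z (1, 0) * s z.1 :=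
    ((hd _).mul (by fun_prop)).integrable_of_hasCompactSupport (hdc _).mul_right
  have i4 : Integrable fun z : ℝ × ℝ => fderiv ℝ v z (0, 1) * T₂ z :=
    ((hd _).mul (by fun_prop)).integrable_of_hasCompactSupport (hdc _).mul_right
  have i5 : Integrable fun z : ℝ × ℝ =>
      √((fderiv ℝ v z (1, 0)) ^ 2 + (fderiv ℝ v z (0, 1)) ^ 2) := by
    have hd1 := hd (1, 0)
    have hd2 := hd (0, 1)
    apply Continuous.integrable_of_hasCompactSupport (by fun_prop)
    apply (hc.fderiv ℝ).mono
    intro z hz h0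
    apply hz
    simp [h0]
  have hw : Continuous fun z : ℝ × ℝ => √(f₁ z.1 / (f₁ z.1 + ε)) :=
    Real.continuous_sqrt.comp (Continuous.div (by fun_prop) (by fun_prop) fun z => (hden _).ne')
  have i6 : Integrable fun z : ℝ × ℝ => √(f₁ z.1 / (f₁ z.1 + ε)) * v z ^ 2 := by
    apply Continuous.integrable_of_hasCompactSupport (by fun_prop)
    have : HasCompactSupport fun z => v z * v z := hc.mul_right
    simp only [pow_two]
    exact this.mul_left
  calc 2 * √(Real.pi * (1 - ε) / N) * ∫ z, √(f₁ z.1 / (f₁ z.1 + ε)) * v z ^ 2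
      = ∫ z, 2 * √(Real.pi * (1 - ε) / N) * (√(f₁ z.1 / (f₁ z.1 + ε)) * v z ^ 2) :=
        (integral_const_mul _ _).symm
    -- The Jacobian of the Knothe map is triangular, so the arithmetic-geometric mean inequality for
    -- its two diagonal entries bounds the divergence below by twice the root of their product,
    -- which is a multiple of `v`.
    _ ≤ ∫ z, (v z * s' z.1 + v z * T₂' z) := by
        apply integral_mono (i6.const_mul _) (i1.add i2)
        intro z
        have hs'0 : 0 ≤ s' z.1 := by
          have := hcpos z.1
          have := hf₁0 z.1
          have : 0 ≤ 1 - ε := by linarith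
          have := Real.pi_pos
          positivity
        have hT0 : 0 ≤ T₂' z := by
          have := hcpos z.1
          have := hden z.1
          positivity
        have h := two_mul_sqrt_mul_le_add hs'0 hT0
        have heq : s' z.1 * T₂' z
            = Real.pi * (1 - ε) / N * (f₁ z.1 / (f₁ z.1 + ε)) * v z ^ 2 := by
          have h0 := (hcpos z.1).ne'
          have h1 := (hden z.1).ne'
          simp only [hs', hT₂']
          field_simp
        rw [heq, Real.sqrt_mul' _ (sq_nonneg _), Real.sqrt_sq (hv0 z), Real.sqrt_mul'] at h
        · simp only
          calc _ = v z * (2 * (√(Real.pi * (1 - ε) / N) * √(f₁ z.1 / (f₁ z.1 + ε)) * v z)) := by ring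
            _ ≤ v z * (s' z.1 + T₂' z) := mul_le_mul_of_nonneg_left h (hv0 z)
            _ = v z * s' z.1 + v z * T₂' z := by ring
        · exact div_nonneg (hf₁0 _) (hden _).le
    _ = -(∫ z : ℝ × ℝ, fderiv ℝ v z (1, 0) * s z.1) - ∫ z, fderiv ℝ v z (0, 1) * T₂ z := by
        rw [integral_add i1 i2, ibp₁, ibp₂]; ring
    _ = ∫ z : ℝ × ℝ, (fderiv ℝ v z (1, 0) * -s z.1 + fderiv ℝ v z (0, 1) * -T₂ z) := by
        have i3' : Integrable fun z : ℝ × ℝ => -(fderiv ℝ v z (1, 0) * s z.1) := i3.neg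
        have i4' : Integrable fun z : ℝ × ℝ => -(fderiv ℝ v z (0, 1) * T₂ z) := i4.neg
        simp only [mul_neg]
        rw [integral_add i3' i4', integral_neg, integral_neg]; ring
    _ ≤ _ := by
        apply integral_mono _ i5
        · intro z
          exact mul_add_mul_le_sqrt (hT z)
        · simp only [mul_neg]
          exact i3.neg.add i4.neg

lemma exists_square_of_hasCompactSupport {v : ℝ × ℝ → ℝ} (hc : HasCompactSupport v) :
    ∃ B : ℝ, 0 ≤ B ∧ ∀ x y, B ≤ |x| ∨ B ≤ |y| → v (x, y) = 0 := by
  obtain ⟨r, hr⟩ := hc.isBounded.subset_closedBall 0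
  refine ⟨|r| + 1, by positivity, fun x y h => ?_⟩
  by_contra h0
  have hz : (x, y) ∈ Metric.closedBall (0 : ℝ × ℝ) r := hr (subset_tsupport _ h0)
  rw [mem_closedBall_zero_iff, Prod.norm_def, max_le_iff] at hz
  simp only [Real.norm_eq_abs] at hz
  have := le_abs_self r
  rcases h with h | h <;> linarith [hz.1, hz.2]

/-- The sharp Sobolev inequality for nonnegative functions on the plane. -/
theorem sharp_sobolev_of_nonneg {v : ℝ × ℝ → ℝ} (hv0 : ∀ z, 0 ≤ v z) (hv : ContDiff ℝ 1 v)
    (hc : HasCompactSupport v) :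
    2 * √Real.pi * √(∫ z, v z ^ 2)
      ≤ ∫ z, √((fderiv ℝ v z (1, 0)) ^ 2 + (fderiv ℝ v z (0, 1)) ^ 2) := by
  obtain ⟨B, hB0, hB⟩ := exists_square_of_hasCompactSupport hc
  set N := ∫ z, v z ^ 2 with hNdef
  have hN0 : 0 ≤ N := integral_nonneg fun z => sq_nonneg _
  rcases hN0.eq_or_lt with hN | hN
  · rw [← hN]
    simp only [Real.sqrt_zero, mul_zero]
    exact integral_nonneg fun z => Real.sqrt_nonneg _
  set f₁ : ℝ → ℝ := fun x => ∫ t in (-B)..B, v (x, t) ^ 2 with hf₁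
  have hvc := hv.continuous
  have hf₁c : Continuous f₁ :=
    intervalIntegral.continuous_parametric_intervalIntegral_of_continuous' (by fun_prop) _ _
  have hf₁0 : ∀ x, 0 ≤ f₁ x := fun x =>
    intervalIntegral.integral_nonneg (by linarith) fun t _ => sq_nonneg _
  have hpos : ∀ z, v z ≠ 0 → 0 < f₁ z.1 := by
    intro z hz
    have hzB : |z.2| < B := by
      by_contra h
      exact hz (hB z.1 z.2 (Or.inr (not_lt.1 h)))
    rw [abs_lt] at hzB
    apply intervalIntegral.integral_pos (by linarith)
    · fun_prop
    · intro t _; positivity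
    · exact ⟨z.2, ⟨by linarith, by linarith⟩, by positivity⟩
  set ε : ℕ → ℝ := fun n => 1 / ((n : ℝ) + 2) with hεdef
  have hε : ∀ n, 0 < ε n := fun n => by positivity
  have hε1 : ∀ n, ε n < 1 := fun n => by
    have : (0 : ℝ) ≤ n := Nat.cast_nonneg n
    simp only [hεdef]; rw [div_lt_one (by positivity)]; linarith
  have hεt : Filter.Tendsto ε Filter.atTop (nhds 0) := by
    have h := (tendsto_one_div_atTop_nhds_zero_nat (𝕜 := ℝ)).comp (Filter.tendsto_add_atTop_nat 2)
    refine h.congr fun n => ?_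
    simp [hεdef]
  have hi : Integrable (fun z : ℝ × ℝ => v z ^ 2) := by
    apply Continuous.integrable_of_hasCompactSupport (by fun_prop)
    have : HasCompactSupport fun z => v z * v z := hc.mul_right
    simpa only [pow_two] using this
  -- The weight tends to `1` wherever `v ≠ 0`, since `f₁` is positive there; `v ^ 2` dominates.
  have hlim : Filter.Tendsto (fun n => ∫ z : ℝ × ℝ, √(f₁ z.1 / (f₁ z.1 + ε n)) * v z ^ 2)
      Filter.atTop (nhds N) := by
    apply tendsto_integral_of_dominated_convergence (fun z => v z ^ 2) _ hi
    · intro n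
      refine Filter.Eventually.of_forall fun z => ?_
      rw [norm_mul, Real.norm_of_nonneg (Real.sqrt_nonneg _), Real.norm_of_nonneg (sq_nonneg _)]
      apply mul_le_of_le_one_left (sq_nonneg _)
      rw [Real.sqrt_le_one]
      have := hf₁0 z.1
      have := hε n
      rw [div_le_one (by linarith)]; linarith
    · refine Filter.Eventually.of_forall fun z => ?_
      by_cases hz : v z = 0
      · simp [hz]
      · have h := hpos z hz
        have h1 : Filter.Tendsto (fun n => f₁ z.1 / (f₁ z.1 + ε n)) Filter.atTop
            (nhds (f₁ z.1 / (f₁ z.1 + 0))) :=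
          tendsto_const_nhds.div (tendsto_const_nhds.add hεt) (by simpa using h.ne')
        rw [add_zero, div_self h.ne'] at h1
        have h2 := ((Real.continuous_sqrt.tendsto _).comp h1).mul_const (v z ^ 2)
        simpa using h2
    · intro n
      apply Continuous.aestronglyMeasurable
      apply Continuous.mul _ (by fun_prop)
      apply Real.continuous_sqrt.comp
      exact Continuous.div (by fun_prop) (by fun_prop) fun z => by
        have := hf₁0 z.1; have := hε n; linarith
  have hlim2 : Filter.Tendsto (fun n => 2 * √(Real.pi * (1 - ε n) / N)) Filter.atTop
      (nhds (2 * √(Real.pi * (1 - 0) / N))) := by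
    apply Filter.Tendsto.const_mul
    apply (Real.continuous_sqrt.tendsto _).comp
    exact ((tendsto_const_nhds.sub hεt).const_mul _).div_const _
  have h := le_of_tendsto (hlim2.mul hlim) (Filter.Eventually.of_forall fun n =>
    regularized_knothe_bound hv0 hv hc hB0 hB hN (hε n) (hε1 n))
  refine le_trans (le_of_eq ?_) h
  rw [sub_zero, mul_one, Real.sqrt_div Real.pi_pos.le]
  have h3 : √N * √N = N := Real.mul_self_sqrt hN0
  have h4 : √N ≠ 0 := (Real.sqrt_pos.2 hN).ne'
  field_simp
  rw [pow_two, h3]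

/-! ### Transfer to the Euclidean plane -/

/-- The identification of `ℝ × ℝ` with the Euclidean plane. -/
def toPlane (z : ℝ × ℝ) : Plane := !₂[z.1, z.2]

@[simp] lemma toPlane_zero (z : ℝ × ℝ) : toPlane z 0 = z.1 := rfl
@[simp] lemma toPlane_one (z : ℝ × ℝ) : toPlane z 1 = z.2 := rfl

lemma toPlane_eta (x : Plane) : toPlane (x 0, x 1) = x := by
  ext i; fin_cases i <;> rfl

/-- `toPlane` as a measurable equivalence. -/
def toPlaneEquiv : ℝ × ℝ ≃ᵐ Plane :=
  MeasurableEquiv.finTwoArrow.symm.trans (MeasurableEquiv.toLp 2 (Fin 2 → ℝ))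

lemma toPlaneEquiv_apply (z : ℝ × ℝ) : toPlaneEquiv z = toPlane z := by
  ext i; fin_cases i <;> rfl

lemma coe_toPlaneEquiv : ⇑toPlaneEquiv = toPlane := funext toPlaneEquiv_apply

lemma measurePreserving_toPlane : MeasurePreserving toPlane := by
  rw [← coe_toPlaneEquiv]
  exact (PiLp.volume_preserving_toLp (Fin 2)).comp (volume_preserving_finTwoArrow ℝ).symm

lemma integral_toPlane {F : Type*} [NormedAddCommGroup F] [NormedSpace ℝ F] (f : Plane → F) :
    ∫ z, f (toPlane z) = ∫ x, f x := by
  rw [← measurePreserving_toPlane.integral_comp]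
  rw [← coe_toPlaneEquiv]; exact toPlaneEquiv.measurableEmbedding

/-- `toPlane` as a continuous linear map. -/
def toPlaneL : ℝ × ℝ →L[ℝ] Plane :=
  LinearMap.toContinuousLinearMap
    { toFun := toPlane
      map_add' := fun a b => by ext i; fin_cases i <;> rfl
      map_smul' := fun a b => by ext i; fin_cases i <;> rfl }

lemma toPlaneL_apply (z : ℝ × ℝ) : toPlaneL z = toPlane z := rfl

lemma contDiff_toPlane {n : WithTop ℕ∞} : ContDiff ℝ n toPlane := toPlaneL.contDiff

@[fun_prop] lemma continuous_toPlane : Continuous toPlane := toPlaneL.continuous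

/-- The `i`-th partial derivative of a function on the plane. -/
def pd (i : Fin 2) (f : Plane → ℝ) (x : Plane) : ℝ := fderiv ℝ f x (EuclideanSpace.single i 1)

lemma toPlane_one_zero : toPlane (1, 0) = EuclideanSpace.single 0 1 := by
  ext i; fin_cases i <;> simp [toPlane]

lemma toPlane_zero_one : toPlane (0, 1) = EuclideanSpace.single 1 1 := by
  ext i; fin_cases i <;> simp [toPlane]

/-- The length of the gradient of a function on the plane. -/
def gradNorm (f : Plane → ℝ) (x : Plane) : ℝ := √(pd 0 f x ^ 2 + pd 1 f x ^ 2)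

lemma gradNorm_nonneg (f : Plane → ℝ) (x : Plane) : 0 ≤ gradNorm f x := Real.sqrt_nonneg _

lemma continuous_pd {f : Plane → ℝ} (hf : ContDiff ℝ 1 f) (i : Fin 2) : Continuous (pd i f) :=
  (hf.continuous_fderiv one_ne_zero).clm_apply continuous_const

lemma continuous_gradNorm {f : Plane → ℝ} (hf : ContDiff ℝ 1 f) : Continuous (gradNorm f) := by
  have := continuous_pd hf 0
  have := continuous_pd hf 1
  unfold gradNorm
  fun_prop

lemma hasCompactSupport_pd {f : Plane → ℝ} (hf : HasCompactSupport f) (i : Fin 2) :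
    HasCompactSupport (pd i f) := hf.fderiv_apply ℝ _

lemma hasCompactSupport_gradNorm {f : Plane → ℝ} (hf : HasCompactSupport f) :
    HasCompactSupport (gradNorm f) := by
  apply (hf.fderiv ℝ).mono
  intro z hz h0
  apply hz
  simp [gradNorm, pd, h0]

lemma sharp_sobolev_plane {v : Plane → ℝ} (hv0 : ∀ z, 0 ≤ v z) (hv : ContDiff ℝ 1 v)
    (hc : HasCompactSupport v) :
    4 * Real.pi * ∫ x, v x ^ 2 ≤ (∫ x, gradNorm v x) ^ 2 := by
  have hcomp : HasCompactSupport (v ∘ toPlane) := by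
    have hcl : Topology.IsClosedEmbedding toPlane := by
      refine Topology.IsClosedEmbedding.of_continuous_injective_isClosedMap continuous_toPlane ?_ ?_
      · rw [← coe_toPlaneEquiv]; exact toPlaneEquiv.injective
      · intro s hs
        have : toPlane '' s = (fun x : Plane => (x 0, x 1)) ⁻¹' s := by
          ext x
          constructor
          · rintro ⟨z, hz, rfl⟩; exact hz
          · intro hx; exact ⟨_, hx, toPlane_eta x⟩
        rw [this]
        exact hs.preimage (by fun_prop)
    exact hc.comp_isClosedEmbedding hcl
  have h := sharp_sobolev_of_nonneg (v := v ∘ toPlane) (fun z => hv0 _) (hv.comp contDiff_toPlane)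
    hcomp
  have h1 : ∫ z, (v ∘ toPlane) z ^ 2 = ∫ x, v x ^ 2 := integral_toPlane (fun x => v x ^ 2)
  have hfd : ∀ z, fderiv ℝ (v ∘ toPlane) z = (fderiv ℝ v (toPlane z)).comp toPlaneL := by
    intro z
    have h1 := (hv.differentiable one_ne_zero (toPlane z)).hasFDerivAt
    exact (h1.comp z toPlaneL.hasFDerivAt).fderiv
  have h2 : ∫ z, √((fderiv ℝ (v ∘ toPlane) z (1, 0)) ^ 2 + (fderiv ℝ (v ∘ toPlane) z (0, 1)) ^ 2)
      = ∫ x, gradNorm v x := by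
    rw [← integral_toPlane]
    congr 1
    ext z
    rw [hfd]
    simp only [ContinuousLinearMap.comp_apply, toPlaneL_apply, toPlane_one_zero, toPlane_zero_one]
    rfl
  rw [h1, h2] at h
  have h3 : 0 ≤ ∫ x, v x ^ 2 := integral_nonneg fun z => sq_nonneg _
  calc 4 * Real.pi * ∫ x, v x ^ 2 = (2 * √Real.pi * √(∫ x, v x ^ 2)) ^ 2 := by
        rw [mul_pow, mul_pow, Real.sq_sqrt Real.pi_pos.le, Real.sq_sqrt h3]; ring
    _ ≤ _ := by gcongr

/-- The function `√(u² + δ²) - δ` is a smooth, nonnegative, compactly supported substitute for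
`|u|`, with a gradient no longer than that of `u`. It removes the sign condition. -/
lemma sharp_sobolev_regularized {u : Plane → ℝ} (hu : ContDiff ℝ 1 u) (hc : HasCompactSupport u)
    {δ : ℝ} (hδ : 0 < δ) :
    4 * Real.pi * ∫ x, (√(u x ^ 2 + δ ^ 2) - δ) ^ 2 ≤ (∫ x, gradNorm u x) ^ 2 := by
  set v : Plane → ℝ := fun x => √(u x ^ 2 + δ ^ 2) - δ with hvdef
  have hpos : ∀ x, u x ^ 2 + δ ^ 2 ≠ 0 := fun x => by positivity
  have hv : ContDiff ℝ 1 v := ContDiff.sub (ContDiff.sqrt (by fun_prop) hpos) contDiff_const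
  have hvc : HasCompactSupport v := by
    apply hc.mono
    intro x hx h0
    apply hx
    simp [hvdef, h0, Real.sqrt_sq hδ.le]
  have hle : ∀ x, gradNorm v x ≤ gradNorm u x := by
    intro x
    have hd : ∀ i, pd i v x = u x / √(u x ^ 2 + δ ^ 2) * pd i u x := by
      intro i
      have h1 := (hu.differentiable one_ne_zero x).hasFDerivAt
      have h2 := ((h1.pow 2).add_const (δ ^ 2)).sqrt (hpos x) |>.sub_const δ
      unfold pd
      rw [h2.fderiv]
      simp only [smul_apply, smul_eq_mul, nsmul_eq_mul]
      field_simp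
      norm_num
    have hq : (u x / √(u x ^ 2 + δ ^ 2)) ^ 2 ≤ 1 := by
      rw [div_pow, Real.sq_sqrt (by positivity), div_le_one (by positivity)]
      nlinarith
    unfold gradNorm
    apply Real.sqrt_le_sqrt
    rw [hd, hd, mul_pow, mul_pow, ← mul_add]
    exact mul_le_of_le_one_left (by positivity) hq
  calc _ ≤ (∫ x, gradNorm v x) ^ 2 := sharp_sobolev_plane (fun x => by
          simp only [hvdef, sub_nonneg]
          apply Real.le_sqrt_of_sq_le; nlinarith [sq_nonneg (u x)]) hv hvc
    _ ≤ _ := by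
      apply pow_le_pow_left₀ (integral_nonneg fun x => gradNorm_nonneg _ _)
      apply integral_mono _ _ hle
      · exact (continuous_gradNorm hv).integrable_of_hasCompactSupport
          (hasCompactSupport_gradNorm hvc)
      · exact (continuous_gradNorm hu).integrable_of_hasCompactSupport
          (hasCompactSupport_gradNorm hc)

/-! ### Test fields and the Sobolev inequality for functions of bounded variation -/

lemma toPlane_norm_sq (z : ℝ × ℝ) : ‖toPlane z‖ ^ 2 = z.1 ^ 2 + z.2 ^ 2 := by
  simp [EuclideanSpace.norm_sq_eq, toPlane]

lemma planeDiv_eq {X : Plane → Plane} {x : Plane} (hX : DifferentiableAt ℝ X x) :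
    planeDiv X x = pd 0 (fun y => X y 0) x + pd 1 (fun y => X y 1) x := by
  have h : ∀ i : Fin 2, fderiv ℝ (fun y => X y i) x
      = (EuclideanSpace.proj i : Plane →L[ℝ] ℝ).comp (fderiv ℝ X x) := fun i =>
    ((EuclideanSpace.proj i : Plane →L[ℝ] ℝ).hasFDerivAt.comp x hX.hasFDerivAt).fderiv
  simp [planeDiv, pd, Fin.sum_univ_two, h]

lemma toPlane_mem_perimeterTestFields {a b : Plane → ℝ} (ha : ContDiff ℝ ∞ a) (hb : ContDiff ℝ ∞ b)
    (hac : HasCompactSupport a) (hbc : HasCompactSupport b) (h : ∀ x, a x ^ 2 + b x ^ 2 ≤ 1) :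
    (fun x => toPlane (a x, b x)) ∈ perimeterTestFields := by
  refine ⟨contDiff_toPlane.comp (ha.prodMk hb), ?_, fun x => ?_⟩
  · refine (hac.isCompact.union hbc.isCompact).of_isClosed_subset isClosed_closure ?_
    apply closure_minimal _ (hac.isCompact.union hbc.isCompact).isClosed
    intro x hx
    by_contra h0
    rw [mem_union, not_or] at h0
    apply hx
    have h1 : a x = 0 := image_eq_zero_of_notMem_tsupport h0.1
    have h2 : b x = 0 := image_eq_zero_of_notMem_tsupport h0.2
    ext i; fin_cases i <;> simp [h1, h2]
  · rw [← sq_le_one_iff₀ (norm_nonneg _), toPlane_norm_sq]; exact h x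

lemma zero_mem_perimeterTestFields : (fun _ => 0) ∈ perimeterTestFields :=
  ⟨contDiff_const, HasCompactSupport.zero, fun _ => by simp⟩

lemma planeDiv_zero (x : Plane) : planeDiv (fun _ => 0) x = 0 := by simp [planeDiv]

lemma continuous_planeDiv {X : Plane → Plane} (hX : ContDiff ℝ 1 X) : Continuous (planeDiv X) := by
  have h := hX.continuous_fderiv one_ne_zero
  unfold planeDiv
  fun_prop

lemma hasCompactSupport_planeDiv {X : Plane → Plane} (hX : HasCompactSupport X) :
    HasCompactSupport (planeDiv X) := by
  apply (hX.fderiv ℝ).mono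
  intro z hz h0
  apply hz
  simp [planeDiv, h0]

lemma perimeterTestFields_comp_add {φ : Plane → Plane} (hφ : φ ∈ perimeterTestFields) (t : Plane) :
    (fun x => φ (x + t)) ∈ perimeterTestFields :=
  ⟨hφ.1.comp (contDiff_id.add contDiff_const),
    hφ.2.1.comp_homeomorph (Homeomorph.addRight t), fun _ => hφ.2.2 _⟩

lemma planeDiv_comp_add (φ : Plane → Plane) (t x : Plane) :
    planeDiv (fun x => φ (x + t)) x = planeDiv φ (x + t) := by
  simp [planeDiv, fderiv_comp_add_right]

/-- Mollification does not increase the bound on the divergence pairing. -/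
lemma convolution_divergence_bound {u : Plane → ℝ} (hu : Integrable u) {M : ℝ}
    (hM : ∀ φ ∈ perimeterTestFields, ∫ x, u x * planeDiv φ x ≤ M) (ρ : ContDiffBump (0 : Plane))
    {φ : Plane → Plane} (hφ : φ ∈ perimeterTestFields) :
    ∫ x, MeasureTheory.convolution (ρ.normed volume) u (ContinuousLinearMap.lsmul ℝ ℝ) volume x
      * planeDiv φ x ≤ M := by
  set r := ρ.normed volume with hr
  have hD : Continuous (planeDiv φ) := continuous_planeDiv (hφ.1.of_le (by norm_num))
  obtain ⟨C, hC⟩ := hD.bounded_above_of_compact_support (hasCompactSupport_planeDiv hφ.2.1)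
  have hint : Integrable (fun p : Plane × Plane => r p.2 * u (p.1 - p.2) * planeDiv φ p.1)
      (volume.prod volume) := by
    have h1 := (ρ.integrable_normed (μ := volume)).convolution_integrand
      (ContinuousLinearMap.lsmul ℝ ℝ) hu
    refine h1.mul_bdd (c := C) ?_ ?_
    · exact (hD.comp continuous_fst).aestronglyMeasurable
    · exact Filter.Eventually.of_forall fun p => hC _
  have h1 : ∫ x, MeasureTheory.convolution r u (ContinuousLinearMap.lsmul ℝ ℝ) volume x
      * planeDiv φ x = ∫ t, r t * ∫ x, u (x - t) * planeDiv φ x := by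
    simp only [MeasureTheory.convolution, ContinuousLinearMap.lsmul_apply, smul_eq_mul,
      ← integral_mul_const, ← integral_const_mul, ← mul_assoc]
    exact integral_integral_swap hint
  rw [h1]
  have h2 : ∀ t, ∫ x, u (x - t) * planeDiv φ x ≤ M := by
    intro t
    rw [← integral_add_right_eq_self _ t]
    simpa [planeDiv_comp_add] using hM _ (perimeterTestFields_comp_add hφ t)
  calc _ ≤ ∫ t, r t * M := by
        apply integral_mono
        · have := hint.integral_prod_right
          simp only [mul_assoc, integral_const_mul] at this
          exact this
        · exact ρ.integrable_normed.mul_const M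
        · exact fun t => mul_le_mul_of_nonneg_left (h2 t) (ρ.nonneg_normed t)
    _ = M := by rw [integral_mul_const, hr, ρ.integral_normed, one_mul]

lemma pd_mul {f g : Plane → ℝ} {x : Plane} (hf : DifferentiableAt ℝ f x)
    (hg : DifferentiableAt ℝ g x) (i : Fin 2) :
    pd i (fun y => f y * g y) x = f x * pd i g x + g x * pd i f x := by
  unfold pd
  rw [fderiv_fun_mul hf hg]
  simp

lemma contDiff_pd {f : Plane → ℝ} (hf : ContDiff ℝ ∞ f) (i : Fin 2) : ContDiff ℝ ∞ (pd i f) :=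
  (hf.fderiv_right (m := ∞) (by simp)).clm_apply contDiff_const

/-- With `v = χw`, the field `χT` for `T ≈ -∇v/|∇v|` is an admissible test field, and `w div(χT) = v
div T + w ∇χ·T`. The first term integrates to about `∫|∇v|`; the second costs at most `c∫|w|`. -/
lemma gradNorm_cutoff_bound {w χ : Plane → ℝ} (hw : ContDiff ℝ ∞ w) (hwi : Integrable w) {M : ℝ}
    (hM : ∀ φ ∈ perimeterTestFields, ∫ x, w x * planeDiv φ x ≤ M) (hχ : ContDiff ℝ ∞ χ)
    (hχc : HasCompactSupport χ) (hχ0 : ∀ x, 0 ≤ χ x) (hχ1 : ∀ x, χ x ≤ 1) {c : ℝ}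
    (hc : ∀ x, gradNorm χ x ≤ c) :
    ∫ x, gradNorm (fun x => χ x * w x) x ≤ M + c * ∫ x, |w x| := by
  set v : Plane → ℝ := fun x => χ x * w x with hv
  have hvs : ContDiff ℝ ∞ v := hχ.mul hw
  have hvc : HasCompactSupport v := hχc.mul_right
  have hone : (1 : WithTop ℕ∞) ≤ ∞ := by norm_num
  have hgc : Continuous (gradNorm v) := continuous_gradNorm (hvs.of_le hone)
  have hgi : Integrable (gradNorm v) :=
    hgc.integrable_of_hasCompactSupport (hasCompactSupport_gradNorm hvc)
  set K := tsupport v with hK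
  have hKc : IsCompact K := hvc
  refine le_of_forall_pos_le_add fun ε hε => ?_
  set V := (volume K).toReal with hV
  -- Normalizing by `√(|∇v|² + δ²)` keeps the field smooth at zeros of `∇v` and loses at most `δ` at
  -- each point of the support `K`, hence at most `ε` in total.
  set δ := ε / (V + 1) with hδ
  have hV0 : 0 ≤ V := ENNReal.toReal_nonneg
  have hδ0 : 0 < δ := by positivity
  have hδV : δ * V ≤ ε := by
    rw [hδ, div_mul_eq_mul_div, div_le_iff₀ (by positivity)]; nlinarith
  set d : Plane → ℝ := fun x => √((pd 0 v x ^ 2 + pd 1 v x ^ 2) + δ ^ 2) with hd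
  have hdpos : ∀ x, 0 < d x := fun x => Real.sqrt_pos.2 (by positivity)
  have hds : ContDiff ℝ ∞ d := by
    apply ContDiff.sqrt
    · exact (((contDiff_pd hvs 0).pow 2).add ((contDiff_pd hvs 1).pow 2)).add contDiff_const
    · intro x; positivity
  set T : Fin 2 → Plane → ℝ := fun i x => -(pd i v x / d x) with hT
  have hTs : ∀ i, ContDiff ℝ ∞ (T i) := fun i =>
    ((contDiff_pd hvs i).div hds fun x => (hdpos x).ne').neg
  have hdsq : ∀ x, d x ^ 2 = pd 0 v x ^ 2 + pd 1 v x ^ 2 + δ ^ 2 := fun x =>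
    Real.sq_sqrt (by positivity)
  have hT1 : ∀ x, T 0 x ^ 2 + T 1 x ^ 2 ≤ 1 := by
    intro x
    have := hdpos x
    simp only [hT, neg_sq, div_pow]
    rw [← add_div, div_le_one (by positivity), hdsq]
    nlinarith [sq_nonneg δ]
  have hTc : ∀ i, HasCompactSupport (T i) := by
    intro i
    apply (hasCompactSupport_pd hvc i).mono
    intro x hx h0
    apply hx
    simp [hT, h0]
  have htest : (fun x => toPlane (χ x * T 0 x, χ x * T 1 x)) ∈ perimeterTestFields := by
    apply toPlane_mem_perimeterTestFields (hχ.mul (hTs 0)) (hχ.mul (hTs 1)) hχc.mul_right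
      hχc.mul_right
    intro x
    rw [mul_pow, mul_pow, ← mul_add]
    have h1 : χ x ^ 2 ≤ 1 := pow_le_one₀ (hχ0 x) (hχ1 x)
    nlinarith [hT1 x, sq_nonneg (χ x), sq_nonneg (T 0 x), sq_nonneg (T 1 x)]
  have hle := hM _ htest
  have hone' : (∞ : WithTop ℕ∞) ≠ 0 := by norm_num
  have hdiv : ∀ x, w x * planeDiv (fun x => toPlane (χ x * T 0 x, χ x * T 1 x)) x
      = v x * pd 0 (T 0) x + v x * pd 1 (T 1) x
        + w x * (pd 0 χ x * T 0 x + pd 1 χ x * T 1 x) := by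
    intro x
    rw [planeDiv_eq (htest.1.differentiable hone' x)]
    simp only [toPlane_zero, toPlane_one]
    rw [pd_mul (hχ.differentiable hone' x) ((hTs 0).differentiable hone' x),
      pd_mul (hχ.differentiable hone' x) ((hTs 1).differentiable hone' x)]
    simp only [hv]; ring
  have hTc1 : ∀ i, Continuous (T i) := fun i => (hTs i).continuous
  have hpdT : ∀ i, Continuous (pd i (T i)) := fun i => continuous_pd ((hTs i).of_le hone) i
  have hpdχ : ∀ i, Continuous (pd i χ) := fun i => continuous_pd (hχ.of_le hone) i
  have hpdv : ∀ i, Continuous (pd i v) := fun i => continuous_pd (hvs.of_le hone) i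
  have hibp : ∀ i, ∫ x, v x * pd i (T i) x = -∫ x, pd i v x * T i x := by
    intro i
    apply integral_mul_lineDeriv_eq_neg (hvs.of_le hone) hvc (hTc1 i) (hpdT i)
    intro x
    exact ((hTs i).differentiable hone' x).hasFDerivAt.hasLineDerivAt _
  have i1 : ∀ i, Integrable fun x => v x * pd i (T i) x := fun i =>
    (hvs.continuous.mul (hpdT i)).integrable_of_hasCompactSupport hvc.mul_right
  have i2 : Integrable fun x => w x * (pd 0 χ x * T 0 x + pd 1 χ x * T 1 x) := by
    have hwc := hw.continuous
    have h0 := hpdχ 0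
    have h1 := hpdχ 1
    have h2 := hTc1 0
    have h3 := hTc1 1
    apply Continuous.integrable_of_hasCompactSupport (by fun_prop)
    apply HasCompactSupport.mul_left
    exact (hTc 0).mul_left.add (hTc 1).mul_left
  have i3 : ∀ i, Integrable fun x => pd i v x * T i x := fun i =>
    ((hpdv i).mul (hTc1 i)).integrable_of_hasCompactSupport (hTc i).mul_left
  have i4 : Integrable fun x => -(pd 0 v x * T 0 x + pd 1 v x * T 1 x) := ((i3 0).add (i3 1)).neg
  have hsplit : ∫ x, w x * planeDiv (fun x => toPlane (χ x * T 0 x, χ x * T 1 x)) x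
      = (∫ x, -(pd 0 v x * T 0 x + pd 1 v x * T 1 x))
        + ∫ x, w x * (pd 0 χ x * T 0 x + pd 1 χ x * T 1 x) := by
    simp only [hdiv]
    have i12 : Integrable fun x => v x * pd 0 (T 0) x + v x * pd 1 (T 1) x := (i1 0).add (i1 1)
    rw [integral_add i12 i2, integral_add (i1 0) (i1 1), hibp, hibp,
      integral_neg, integral_add (i3 0) (i3 1)]
    ring
  have hlow : -(c * ∫ x, |w x|) ≤ ∫ x, w x * (pd 0 χ x * T 0 x + pd 1 χ x * T 1 x) := by
    rw [← integral_const_mul, ← integral_neg]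
    apply integral_mono (hwi.abs.const_mul c).neg i2
    intro x
    have h1 : |pd 0 χ x * T 0 x + pd 1 χ x * T 1 x| ≤ c := by
      refine (abs_le.2 ⟨?_, ?_⟩).trans (hc x)
      · have := mul_add_mul_le_sqrt (a := pd 0 χ x) (b := pd 1 χ x) (s := -T 0 x) (t := -T 1 x)
          (by simpa using hT1 x)
        unfold gradNorm; linarith
      · exact mul_add_mul_le_sqrt (hT1 x)
    have h2 : |w x * (pd 0 χ x * T 0 x + pd 1 χ x * T 1 x)| ≤ c * |w x| := by
      rw [abs_mul, mul_comm]; gcongr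
    exact (abs_le.1 h2).1
  have hgrad : (∫ x, gradNorm v x) - ε ≤ ∫ x, -(pd 0 v x * T 0 x + pd 1 v x * T 1 x) := by
    have hset : ∫ x in K, gradNorm v x = ∫ x, gradNorm v x := by
      apply setIntegral_eq_integral_of_forall_compl_eq_zero
      intro x hx
      have h0 : fderiv ℝ v x = 0 := image_eq_zero_of_notMem_tsupport fun h =>
        hx (tsupport_fderiv_subset ℝ h)
      simp [gradNorm, pd, h0]
    have hnn : ∀ x, 0 ≤ -(pd 0 v x * T 0 x + pd 1 v x * T 1 x) := by
      intro x
      have := hdpos x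
      have : -(pd 0 v x * T 0 x + pd 1 v x * T 1 x) = (pd 0 v x ^ 2 + pd 1 v x ^ 2) / d x := by
        simp only [hT]; ring
      rw [this]; positivity
    have hpt : ∀ x, gradNorm v x ≤ -(pd 0 v x * T 0 x + pd 1 v x * T 1 x) + δ := by
      intro x
      have h0 := hdpos x
      have : -(pd 0 v x * T 0 x + pd 1 v x * T 1 x) = (pd 0 v x ^ 2 + pd 1 v x ^ 2) / d x := by
        simp only [hT]; ring
      have hg0 := gradNorm_nonneg v x
      have hg2 : gradNorm v x ^ 2 = pd 0 v x ^ 2 + pd 1 v x ^ 2 := Real.sq_sqrt (by positivity)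
      have hd2 := hdsq x
      rw [← hg2] at hd2
      rw [this, ← hg2, ← sub_le_iff_le_add, le_div_iff₀ h0]
      have hdg : d x ≤ gradNorm v x + δ := by
        apply Real.sqrt_le_iff.2 ⟨by positivity, ?_⟩
        rw [← hg2]; nlinarith
      have hgd : gradNorm v x ≤ d x := by nlinarith
      have hdd : δ ≤ d x := by nlinarith
      rcases le_total (gradNorm v x) δ with h | h <;> nlinarith
    have hfin : volume K < ⊤ := hKc.measure_lt_top
    have : ∫ x in K, gradNorm v x
        ≤ ∫ x in K, (-(pd 0 v x * T 0 x + pd 1 v x * T 1 x) + δ) := by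
      apply setIntegral_mono hgi.integrableOn _ hpt
      exact i4.integrableOn.add (integrableOn_const hfin.ne)
    rw [integral_add i4.integrableOn (integrableOn_const hfin.ne), setIntegral_const,
      hset, smul_eq_mul] at this
    have h5 : ∫ x in K, -(pd 0 v x * T 0 x + pd 1 v x * T 1 x)
        ≤ ∫ x, -(pd 0 v x * T 0 x + pd 1 v x * T 1 x) :=
      setIntegral_le_integral i4 (Filter.Eventually.of_forall hnn)
    have h6 : volume.real K * δ = δ * V := by rw [mul_comm]; rfl
    linarith
  rw [hsplit] at hle
  linarith

/-- Dilating a fixed bump function by `R` divides its gradient by `R`. -/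
lemma exists_cutoff {η : ℝ} (hη : 0 < η) (r : ℝ) : ∃ χ : Plane → ℝ, ContDiff ℝ ∞ χ ∧
    HasCompactSupport χ ∧ (∀ x, 0 ≤ χ x) ∧ (∀ x, χ x ≤ 1) ∧ (∀ x, gradNorm χ x ≤ η) ∧
    ∀ x, ‖x‖ ≤ r → χ x = 1 := by
  let f : ContDiffBump (0 : Plane) := ⟨1, 2, one_pos, one_lt_two⟩
  have hf : ContDiff ℝ ∞ f := f.contDiff
  have hone : (1 : WithTop ℕ∞) ≤ ∞ := by norm_num
  obtain ⟨C, hC⟩ := (continuous_gradNorm (hf.of_le hone)).bounded_above_of_compact_support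
    (hasCompactSupport_gradNorm f.hasCompactSupport)
  have hC0 : 0 ≤ C := (norm_nonneg _).trans (hC 0)
  set R := max (max r 1) (C / η) with hR
  have hRpos : 0 < R := by
    have : (1 : ℝ) ≤ R := (le_max_right r 1).trans (le_max_left _ _)
    linarith
  refine ⟨fun x => f (R⁻¹ • x), hf.comp (contDiff_const_smul R⁻¹), ?_, fun _ => f.nonneg,
    fun _ => f.le_one, fun x => ?_, fun x hx => ?_⟩
  · exact f.hasCompactSupport.comp_homeomorph (Homeomorph.smulOfNeZero R⁻¹ (by positivity))
  · have hpd : ∀ i, pd i (fun x => f (R⁻¹ • x)) x = R⁻¹ * pd i f (R⁻¹ • x) := by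
      intro i
      unfold pd
      rw [fderiv_comp_smul]
      simp
    have : gradNorm (fun x => f (R⁻¹ • x)) x = R⁻¹ * gradNorm f (R⁻¹ • x) := by
      unfold gradNorm
      rw [hpd, hpd, mul_pow, mul_pow, ← mul_add, Real.sqrt_mul (by positivity),
        Real.sqrt_sq (by positivity)]
    rw [this]
    have h1 := (le_abs_self _).trans (hC (R⁻¹ • x))
    have h2 : C / η ≤ R := le_max_right _ _
    rw [div_le_iff₀ hη] at h2
    calc R⁻¹ * gradNorm f (R⁻¹ • x) ≤ R⁻¹ * C := by gcongr
      _ ≤ R⁻¹ * (R * η) := by gcongr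
      _ = η := by field_simp
  · apply f.one_of_mem_closedBall
    rw [mem_closedBall_zero_iff, norm_smul, norm_inv, Real.norm_of_nonneg hRpos.le]
    show R⁻¹ * ‖x‖ ≤ 1
    rw [inv_mul_le_iff₀ hRpos]
    have : r ≤ R := (le_max_left r 1).trans (le_max_left _ _)
    linarith

/-- The sharp Sobolev inequality for functions of bounded variation in the plane. -/
theorem sharp_sobolev_of_divergence_bound {u : Plane → ℝ} (hu : Integrable u) {M : ℝ}
    (hM : ∀ φ ∈ perimeterTestFields, ∫ x, u x * planeDiv φ x ≤ M) :
    ∫⁻ x, ENNReal.ofReal (u x ^ 2) ≤ ENNReal.ofReal (M ^ 2 / (4 * Real.pi)) := by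
  have hM0 : 0 ≤ M := by simpa [planeDiv_zero] using hM _ zero_mem_perimeterTestFields
  set e : ℕ → ℝ := fun n => 1 / ((n : ℝ) + 1) with he
  have hepos : ∀ n, 0 < e n := fun n => by positivity
  have het : Filter.Tendsto e Filter.atTop (nhds 0) := tendsto_one_div_add_atTop_nhds_zero_nat
  -- The ratio of outer to inner radius stays equal to `2`; almost everywhere convergence of the
  -- mollifications needs it bounded.
  let ρ : ℕ → ContDiffBump (0 : Plane) := fun n => ⟨e n, 2 * e n, hepos n, by linarith [hepos n]⟩
  set w : ℕ → Plane → ℝ := fun n =>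
    MeasureTheory.convolution ((ρ n).normed volume) u (ContinuousLinearMap.lsmul ℝ ℝ) volume with hw
  have hws : ∀ n, ContDiff ℝ ∞ (w n) := fun n =>
    (ρ n).hasCompactSupport_normed.contDiff_convolution_left _ (ρ n).contDiff_normed
      hu.locallyIntegrable
  have hwi : ∀ n, Integrable (w n) := fun n =>
    (ρ n).integrable_normed.integrable_convolution _ hu
  have hlim : ∀ᵐ x, Filter.Tendsto (fun n => w n x) Filter.atTop (nhds (u x)) := by
    apply ContDiffBump.ae_convolution_tendsto_right_of_locallyIntegrable (K := 2)
    · simpa using het.const_mul 2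
    · exact Filter.Eventually.of_forall fun n => le_rfl
    · exact hu.locallyIntegrable
  -- The gradient of the cutoff is small relative to `∫|w n|`, so cutting off adds at most `e n` to
  -- the total variation.
  have hχ := fun n => exists_cutoff (η := e n / (1 + ∫ x, |w n x|))
    (div_pos (hepos n) (by
      have : 0 ≤ ∫ x, |w n x| := integral_nonneg fun x => abs_nonneg _
      linarith)) (n : ℝ)
  choose χ hχs hχc hχ0 hχ1 hχg hχr using hχ
  set v : ℕ → Plane → ℝ := fun n x => χ n x * w n x with hv
  have hone : (1 : WithTop ℕ∞) ≤ ∞ := by norm_num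
  have hvs : ∀ n, ContDiff ℝ 1 (v n) := fun n => ((hχs n).mul (hws n)).of_le hone
  have hgrad : ∀ n, ∫ x, gradNorm (v n) x ≤ M + e n := by
    intro n
    have h1 := gradNorm_cutoff_bound (hws n) (hwi n)
      (fun φ hφ => convolution_divergence_bound hu hM (ρ n) hφ) (hχs n) (hχc n) (hχ0 n) (hχ1 n)
      (hχg n)
    have h2 : 0 ≤ ∫ x, |w n x| := integral_nonneg fun x => abs_nonneg _
    have h3 : e n / (1 + ∫ x, |w n x|) * ∫ x, |w n x| ≤ e n := by
      rw [div_mul_eq_mul_div, div_le_iff₀ (by linarith)]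
      have := hepos n
      nlinarith
    linarith
  set g : ℕ → Plane → ℝ := fun n x => (√(v n x ^ 2 + e n ^ 2) - e n) ^ 2 with hg
  have hgc : ∀ n, Continuous (g n) := fun n => by
    have := (hvs n).continuous
    fun_prop
  have hgbound : ∀ n, ∫⁻ x, ENNReal.ofReal (g n x)
      ≤ ENNReal.ofReal ((M + e n) ^ 2 / (4 * Real.pi)) := by
    intro n
    have hvc : HasCompactSupport (v n) := (hχc n).mul_right
    have h1 := sharp_sobolev_regularized (hvs n) hvc (hepos n)
    have hgi : Integrable (g n) := by
      apply (hgc n).integrable_of_hasCompactSupport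
      apply hvc.mono
      intro x hx h0
      apply hx
      simp [hg, h0, Real.sqrt_sq (hepos n).le]
    rw [← ofReal_integral_eq_lintegral_ofReal hgi
      (Filter.Eventually.of_forall fun x => sq_nonneg _)]
    apply ENNReal.ofReal_le_ofReal
    rw [le_div_iff₀ (by positivity)]
    have h2 : (∫ x, gradNorm (v n) x) ^ 2 ≤ (M + e n) ^ 2 :=
      pow_le_pow_left₀ (integral_nonneg fun x => gradNorm_nonneg _ _) (hgrad n) 2
    calc _ = 4 * Real.pi * ∫ x, g n x := by ring
      _ ≤ _ := h1.trans h2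
  have hglim : ∀ᵐ x, Filter.Tendsto (fun n => ENNReal.ofReal (g n x)) Filter.atTop
      (nhds (ENNReal.ofReal (u x ^ 2))) := by
    filter_upwards [hlim] with x hx
    apply ENNReal.tendsto_ofReal
    have hvx : Filter.Tendsto (fun n => v n x) Filter.atTop (nhds (u x)) := by
      apply hx.congr'
      filter_upwards [Filter.eventually_ge_atTop ⌈‖x‖⌉₊] with n hn
      have : ‖x‖ ≤ n := (Nat.le_ceil _).trans (by exact_mod_cast hn)
      simp [hv, hχr n x this]
    have h1 : Filter.Tendsto (fun n => √(v n x ^ 2 + e n ^ 2)) Filter.atTop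
        (nhds (√(u x ^ 2 + 0 ^ 2))) :=
      (Real.continuous_sqrt.tendsto _).comp ((hvx.pow 2).add (het.pow 2))
    have h2 := (h1.sub het).pow 2
    have h3 : (√(u x ^ 2 + 0 ^ 2) - 0) ^ 2 = u x ^ 2 := by
      rw [sub_zero, Real.sq_sqrt (by positivity)]; ring
    rwa [h3] at h2
  -- Fatou's lemma yields the bound without knowing beforehand that `u` is square integrable.
  calc ∫⁻ x, ENNReal.ofReal (u x ^ 2)
      = ∫⁻ x, Filter.liminf (fun n => ENNReal.ofReal (g n x)) Filter.atTop := by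
        apply lintegral_congr_ae
        filter_upwards [hglim] with x hx
        exact hx.liminf_eq.symm
    _ ≤ Filter.liminf (fun n => ∫⁻ x, ENNReal.ofReal (g n x)) Filter.atTop :=
        lintegral_liminf_le fun n => (hgc n).measurable.ennreal_ofReal
    _ ≤ Filter.liminf (fun n => ENNReal.ofReal ((M + e n) ^ 2 / (4 * Real.pi))) Filter.atTop :=
        Filter.liminf_le_liminf (Filter.Eventually.of_forall hgbound)
    _ = ENNReal.ofReal (M ^ 2 / (4 * Real.pi)) := by
        apply Filter.Tendsto.liminf_eq
        apply ENNReal.tendsto_ofReal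
        have h := ((het.const_add M).pow 2).div_const (4 * Real.pi)
        rwa [add_zero] at h

/-- The isoperimetric inequality for integer-valued functions of bounded variation. -/
theorem isoperimetric_of_integer_valued {u : Plane → ℝ} (hu : Integrable u)
    (hint : ∀ x, ∃ k : ℤ, u x = k) {M : ℝ}
    (hM : ∀ φ ∈ perimeterTestFields, ∫ x, u x * planeDiv φ x ≤ M) :
    √(4 * Real.pi * |∫ x, u x|) ≤ M := by
  have hM0 : 0 ≤ M := by simpa [planeDiv_zero] using hM _ zero_mem_perimeterTestFields
  have h := sharp_sobolev_of_divergence_bound hu hM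
  -- The only use of integrality: a nonzero integer has absolute value at least one.
  have habs : ∀ x, |u x| ≤ u x ^ 2 := by
    intro x
    obtain ⟨k, hk⟩ := hint x
    rw [hk]
    rcases eq_or_ne k 0 with h0 | h0
    · simp [h0]
    · have : (1 : ℝ) ≤ |(k : ℝ)| := by exact_mod_cast Int.one_le_abs h0
      rw [← sq_abs]; nlinarith
  have h1 : ENNReal.ofReal (∫ x, |u x|) ≤ ENNReal.ofReal (M ^ 2 / (4 * Real.pi)) := by
    rw [ofReal_integral_eq_lintegral_ofReal hu.abs
      (Filter.Eventually.of_forall fun x => abs_nonneg _)]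
    exact (lintegral_mono fun x => ENNReal.ofReal_le_ofReal (habs x)).trans h
  rw [ENNReal.ofReal_le_ofReal_iff (by positivity), le_div_iff₀ (by positivity)] at h1
  apply Real.sqrt_le_iff.2 ⟨hM0, ?_⟩
  have h2 := abs_integral_le_integral_abs (f := u) (μ := volume)
  have hp := Real.pi_pos
  nlinarith

/-! ### The divergence theorem for cones and change of variables -/

/-- The outward flux of a field through the segment from `p` to `q`, which has the region on its
left. -/
def chordFlux (p q : Plane) (φ : Plane → Plane) : ℝ :=
  ∫ s in (0 : ℝ)..1, (φ (p + s • (q - p)) 0 * (q - p) 1 - φ (p + s • (q - p)) 1 * (q - p) 0)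

lemma fderiv_apply_eq (f : Plane → ℝ) (x v : Plane) :
    fderiv ℝ f x v = pd 0 f x * v 0 + pd 1 f x * v 1 := by
  have h : v = v 0 • EuclideanSpace.single 0 1 + v 1 • EuclideanSpace.single 1 1 := by
    ext i; fin_cases i <;> simp
  conv_lhs => rw [h]
  rw [map_add, map_smul, map_smul]
  simp only [pd, smul_eq_mul]; ring

lemma hasDerivAt_comp_plane {f : Plane → ℝ} (hf : ContDiff ℝ 1 f) {c : ℝ → Plane} {c' : Plane}
    {t : ℝ} (hc : HasDerivAt c c' t) :
    HasDerivAt (fun t => f (c t)) (pd 0 f (c t) * c' 0 + pd 1 f (c t) * c' 1) t := by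
  rw [← fderiv_apply_eq]
  exact (hf.differentiable one_ne_zero (c t)).hasFDerivAt.comp_hasDerivAt t hc

lemma hasDerivAt_coord {c : ℝ → Plane} {c' : Plane} {t : ℝ} (hc : HasDerivAt c c' t) (i : Fin 2) :
    HasDerivAt (fun t => c t i) (c' i) t :=
  (EuclideanSpace.proj i : Plane →L[ℝ] ℝ).hasFDerivAt.comp_hasDerivAt t hc

lemma integral_integral_swap_of_continuous {f : ℝ → ℝ → ℝ}
    (hf : Continuous (Function.uncurry f)) (a b c d : ℝ) :
    ∫ x in a..b, ∫ y in c..d, f x y = ∫ y in c..d, ∫ x in a..b, f x y :=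
  intervalIntegral_intervalIntegral_swap <|
    ((hf.continuousOn (s := uIcc a b ×ˢ uIcc c d)).integrableOn_compact
      (isCompact_uIcc.prod isCompact_uIcc)).mono_set (prod_mono uIoc_subset_uIcc uIoc_subset_uIcc)

/-- The divergence theorem for the cone over a curve, with the starting point as apex. -/
theorem flux_eq_chordFlux_add {φ : Plane → Plane} (hφ : ContDiff ℝ 1 φ) {g g' : ℝ → Plane}
    (hg : ∀ t, HasDerivAt g (g' t) t) (hg' : Continuous g') (L : ℝ) :
    ∫ t in (0 : ℝ)..L, (φ (g t) 0 * g' t 1 - φ (g t) 1 * g' t 0)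
      = chordFlux (g 0) (g L) φ + ∫ t in (0 : ℝ)..L, ∫ s in (0 : ℝ)..1,
        s * ((g t - g 0) 0 * g' t 1 - (g t - g 0) 1 * g' t 0)
          * planeDiv φ (g 0 + s • (g t - g 0)) := by
  set p := g 0 with hp
  have hgc : Continuous g := continuous_iff_continuousAt.2 fun t => (hg t).continuousAt
  have hφc : Continuous φ := hφ.continuous
  set a : Plane → ℝ := fun x => φ x 0 with ha
  set b : Plane → ℝ := fun x => φ x 1 with hb
  have has : ContDiff ℝ 1 a := (EuclideanSpace.proj 0 : Plane →L[ℝ] ℝ).contDiff.comp hφ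
  have hbs : ContDiff ℝ 1 b := (EuclideanSpace.proj 1 : Plane →L[ℝ] ℝ).contDiff.comp hφ
  have hac := has.continuous
  have hbc := hbs.continuous
  have hpa := fun i => continuous_pd has i
  have hpb := fun i => continuous_pd hbs i
  have hpa0 := hpa 0
  have hpa1 := hpa 1
  have hpb0 := hpb 0
  have hpb1 := hpb 1
  have hdivc : Continuous (planeDiv φ) := continuous_planeDiv hφ
  set G : ℝ → ℝ → Plane := fun s t => p + s • (g t - p) with hG
  have hGs : ∀ s t, HasDerivAt (fun s => G s t) (g t - p) s := fun s t => by
    have h : HasDerivAt (fun s : ℝ => p + s • (g t - p)) ((1 : ℝ) • (g t - p)) s :=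
      ((hasDerivAt_id s).smul_const (g t - p)).const_add p
    simpa only [one_smul] using h
  have hGt : ∀ s t, HasDerivAt (fun t => G s t) (s • g' t) t := fun s t =>
    (((hg t).sub_const p).const_smul s).const_add p
  -- For the cone map `G`, `Ds` is the `s`-derivative of the flux density across `∂G/∂t`, and `Dt`
  -- the `t`-derivative of the flux density across `∂G/∂s`. The mixed second derivatives of `G`
  -- cancel in their difference, which leaves the divergence times the Jacobian. No injectivity of
  -- `G` is involved.
  set Ds : ℝ → ℝ → ℝ := fun s t =>
    (a (G s t) * g' t 1 - b (G s t) * g' t 0)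
      + s * ((pd 0 a (G s t) * (g t - p) 0 + pd 1 a (G s t) * (g t - p) 1) * g' t 1
        - (pd 0 b (G s t) * (g t - p) 0 + pd 1 b (G s t) * (g t - p) 1) * g' t 0) with hDs
  set Dt : ℝ → ℝ → ℝ := fun s t =>
    ((pd 0 a (G s t) * (s • g' t) 0 + pd 1 a (G s t) * (s • g' t) 1) * (g t - p) 1
      + a (G s t) * g' t 1)
    - ((pd 0 b (G s t) * (s • g' t) 0 + pd 1 b (G s t) * (s • g' t) 1) * (g t - p) 0
      + b (G s t) * g' t 0) with hDt
  set K : ℝ → ℝ → ℝ := fun s t =>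
    s * ((g t - p) 0 * g' t 1 - (g t - p) 1 * g' t 0) * planeDiv φ (G s t) with hK
  have hident : ∀ s t, Ds s t = Dt s t + K s t := by
    intro s t
    simp only [hDs, hDt, hK]
    rw [planeDiv_eq (hφ.differentiable one_ne_zero _)]
    simp only [PiLp.smul_apply, smul_eq_mul]
    ring
  have hcDs : ∀ t, Continuous fun s => Ds s t := fun t => by simp only [hDs, hG]; fun_prop
  have hcDt : Continuous (Function.uncurry fun t s => Dt s t) := by
    simp only [Function.uncurry_def, hDt, hG]; fun_prop
  have hcK : Continuous (Function.uncurry fun t s => K s t) := by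
    simp only [Function.uncurry_def, hK, hG]; fun_prop
  have hcDt1 : ∀ t, Continuous fun s => Dt s t := fun t => by simp only [hDt, hG]; fun_prop
  have hcDt2 : ∀ s, Continuous fun t => Dt s t := fun s => by simp only [hDt, hG]; fun_prop
  have hcK1 : ∀ t, Continuous fun s => K s t := fun t => by simp only [hK, hG]; fun_prop
  have h1 : ∀ t, ∫ s in (0 : ℝ)..1, Ds s t = a (g t) * g' t 1 - b (g t) * g' t 0 := by
    intro t
    have hder : ∀ s ∈ uIcc (0 : ℝ) 1,
        HasDerivAt (fun s => s * (a (G s t) * g' t 1 - b (G s t) * g' t 0)) (Ds s t) s := by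
      intro s _
      have ha' := hasDerivAt_comp_plane has (hGs s t)
      have hb' := hasDerivAt_comp_plane hbs (hGs s t)
      have h := (hasDerivAt_id s).mul ((ha'.mul_const (g' t 1)).sub (hb'.mul_const (g' t 0)))
      simpa [hDs] using! h
    rw [intervalIntegral.integral_eq_sub_of_hasDerivAt hder ((hcDs t).intervalIntegrable _ _)]
    simp [hG]
  have h2 : ∀ s, ∫ t in (0 : ℝ)..L, Dt s t
      = a (G s L) * (g L - p) 1 - b (G s L) * (g L - p) 0 := by
    intro s
    have hder : ∀ t ∈ uIcc (0 : ℝ) L,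
        HasDerivAt (fun t => a (G s t) * (g t - p) 1 - b (G s t) * (g t - p) 0) (Dt s t) t := by
      intro t _
      have ha' := hasDerivAt_comp_plane has (hGt s t)
      have hb' := hasDerivAt_comp_plane hbs (hGt s t)
      have hc := fun i => hasDerivAt_coord ((hg t).sub_const p) i
      exact (ha'.mul (hc 1)).sub (hb'.mul (hc 0))
    rw [intervalIntegral.integral_eq_sub_of_hasDerivAt hder ((hcDt2 s).intervalIntegrable _ _)]
    simp [hp]
  calc ∫ t in (0 : ℝ)..L, (a (g t) * g' t 1 - b (g t) * g' t 0)
      = ∫ t in (0 : ℝ)..L, ((∫ s in (0 : ℝ)..1, Dt s t) + ∫ s in (0 : ℝ)..1, K s t) := by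
        congr 1
        ext t
        rw [← h1, ← intervalIntegral.integral_add ((hcDt1 t).intervalIntegrable _ _)
          ((hcK1 t).intervalIntegrable _ _)]
        simp only [hident]
    _ = (∫ t in (0 : ℝ)..L, ∫ s in (0 : ℝ)..1, Dt s t)
        + ∫ t in (0 : ℝ)..L, ∫ s in (0 : ℝ)..1, K s t := by
        apply intervalIntegral.integral_add <;> apply Continuous.intervalIntegrable
        · exact intervalIntegral.continuous_parametric_intervalIntegral_of_continuous' hcDt 0 1
        · exact intervalIntegral.continuous_parametric_intervalIntegral_of_continuous' hcK 0 1
    _ = chordFlux p (g L) φ + ∫ t in (0 : ℝ)..L, ∫ s in (0 : ℝ)..1, K s t := by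
        congr 1
        rw [integral_integral_swap_of_continuous hcDt]
        simp only [h2]; rfl

lemma det_prod_smul (a b c d : ℝ) :
    ((a • ContinuousLinearMap.fst ℝ ℝ ℝ + b • ContinuousLinearMap.snd ℝ ℝ ℝ).prod
      (c • ContinuousLinearMap.fst ℝ ℝ ℝ + d • ContinuousLinearMap.snd ℝ ℝ ℝ)).det
      = a * d - b * c := by
  have : (((a • ContinuousLinearMap.fst ℝ ℝ ℝ + b • ContinuousLinearMap.snd ℝ ℝ ℝ).prod
      (c • ContinuousLinearMap.fst ℝ ℝ ℝ + d • ContinuousLinearMap.snd ℝ ℝ ℝ) :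
        ℝ × ℝ →L[ℝ] ℝ × ℝ) : ℝ × ℝ →ₗ[ℝ] ℝ × ℝ)
      = Matrix.toLin (Module.Basis.finTwoProd ℝ) (Module.Basis.finTwoProd ℝ) !![a, b; c, d] := by
    rw [Matrix.toLin_finTwoProd]
    ext <;> simp
  rw [ContinuousLinearMap.det, this, LinearMap.det_toLin, Matrix.det_fin_two_of]

/-- The change of variables formula for a parametrized region of the plane. -/
lemma setIntegral_image_plane {G : ℝ × ℝ → Plane} {S : Set (ℝ × ℝ)} (hS : MeasurableSet S)
    {a b : Fin 2 → ℝ × ℝ → ℝ}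
    (hG : ∀ i z, HasFDerivAt (fun z => G z i)
      (a i z • ContinuousLinearMap.fst ℝ ℝ ℝ + b i z • ContinuousLinearMap.snd ℝ ℝ ℝ) z)
    (hinj : InjOn G S) (f : Plane → ℝ) :
    MeasurableSet (G '' S) ∧
      ∫ x in G '' S, f x = ∫ z in S, |a 0 z * b 1 z - b 0 z * a 1 z| * f (G z) := by
  set Q : ℝ × ℝ → ℝ × ℝ := fun z => (G z 0, G z 1) with hQ
  have hGQ : ∀ z, G z = toPlane (Q z) := fun z => (toPlane_eta _).symm
  have hd : ∀ z ∈ S, HasFDerivWithinAt Q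
      ((a 0 z • ContinuousLinearMap.fst ℝ ℝ ℝ + b 0 z • ContinuousLinearMap.snd ℝ ℝ ℝ).prod
      (a 1 z • ContinuousLinearMap.fst ℝ ℝ ℝ + b 1 z • ContinuousLinearMap.snd ℝ ℝ ℝ)) S z :=
    fun z _ => ((hG 0 z).prodMk (hG 1 z)).hasFDerivWithinAt
  have hQinj : InjOn Q S := by
    intro z hz w hw h
    apply hinj hz hw
    rw [hGQ, hGQ, h]
  have himg : G '' S = toPlane '' (Q '' S) := by
    rw [image_image]; simp only [← hGQ]
  have hQm : MeasurableSet (Q '' S) := measurable_image_of_fderivWithin hS hd hQinj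
  have hemb : MeasurableEmbedding toPlane := by
    rw [← coe_toPlaneEquiv]; exact toPlaneEquiv.measurableEmbedding
  refine ⟨by rw [himg]; exact hemb.measurableSet_image.2 hQm, ?_⟩
  have h1 := measurePreserving_toPlane.setIntegral_image_emb hemb f (Q '' S)
  rw [himg, h1, integral_image_eq_integral_abs_det_fderiv_smul volume hS hd hQinj]
  simp only [det_prod_smul, smul_eq_mul, hGQ]

/-! ### Geometry of an arc and of the cap over its chord -/

/-- The unit vector with a given polar angle. -/
def unitVec (θ : ℝ) : Plane := toPlane (Real.cos θ, Real.sin θ)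

namespace CircularArc

variable (γ : CircularArc)

lemma tangent_eq (t : ℝ) : γ.tangent t = unitVec (γ.angle + γ.curvature * t) := rfl

lemma leftNormal_eq (t : ℝ) : γ.leftNormal t
    = toPlane (-Real.sin (γ.angle + γ.curvature * t), Real.cos (γ.angle + γ.curvature * t)) := rfl

lemma continuous_tangent : Continuous γ.tangent := by
  show Continuous fun t => toPlane (_, _)
  fun_prop

lemma continuous_leftNormal : Continuous γ.leftNormal := by
  show Continuous fun t => toPlane (_, _)
  fun_prop

lemma hasDerivAt_point (t : ℝ) : HasDerivAt γ.point (γ.tangent t) t :=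
  (γ.continuous_tangent.integral_hasStrictDerivAt 0 t).hasDerivAt.const_add γ.start

lemma continuous_point : Continuous γ.point :=
  continuous_iff_continuousAt.2 fun t => (γ.hasDerivAt_point t).continuousAt

lemma point_zero : γ.point 0 = γ.start := by simp [point]

/-- The signed distance from the starting point to the point at arc length `t`. -/
def reach (t : ℝ) : ℝ :=
  if γ.curvature = 0 then t else 2 / γ.curvature * Real.sin (γ.curvature * t / 2)

lemma reach_zero_curvature (h : γ.curvature = 0) (t : ℝ) : γ.reach t = t := if_pos h

lemma reach_of_ne (h : γ.curvature ≠ 0) (t : ℝ) :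
    γ.reach t = 2 / γ.curvature * Real.sin (γ.curvature * t / 2) := if_neg h

lemma point_eq (t : ℝ) :
    γ.point t = γ.start + γ.reach t • unitVec (γ.angle + γ.curvature * t / 2) := by
  rw [point]
  congr 1
  by_cases h : γ.curvature = 0
  · simp [reach, h, tangent_eq]
  · have hd : ∀ s ∈ uIcc 0 t, HasDerivAt
        (fun s => toPlaneL (Real.sin (γ.angle + γ.curvature * s) / γ.curvature,
          -Real.cos (γ.angle + γ.curvature * s) / γ.curvature)) (γ.tangent s) s := by
      intro s _
      have h0 : HasDerivAt (fun s => γ.angle + γ.curvature * s) γ.curvature s := by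
        simpa using ((hasDerivAt_id s).const_mul γ.curvature).const_add γ.angle
      have h1 := (h0.sin.div_const γ.curvature).prodMk (h0.cos.neg.div_const γ.curvature)
      have h2 := toPlaneL.hasFDerivAt.comp_hasDerivAt s h1
      have h3 : γ.tangent s = toPlaneL
          (Real.cos (γ.angle + γ.curvature * s) * γ.curvature / γ.curvature,
          -(-Real.sin (γ.angle + γ.curvature * s) * γ.curvature) / γ.curvature) := by
        rw [tangent_eq, toPlaneL_apply, unitVec]
        field_simp
      rw [h3]
      exact h2
    rw [intervalIntegral.integral_eq_sub_of_hasDerivAt hd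
      (γ.continuous_tangent.intervalIntegrable _ _), reach_of_ne _ h, ← map_sub]
    have hs := Real.sin_sub_sin (γ.angle + γ.curvature * t) γ.angle
    have hc := Real.cos_sub_cos (γ.angle + γ.curvature * t) γ.angle
    have e1 : (γ.angle + γ.curvature * t - γ.angle) / 2 = γ.curvature * t / 2 := by ring
    have e2 : (γ.angle + γ.curvature * t + γ.angle) / 2 = γ.angle + γ.curvature * t / 2 := by ring
    rw [e1, e2] at hs hc
    ext i; fin_cases i
    · simp only [toPlaneL_apply, unitVec, Fin.zero_eta, toPlane_zero, PiLp.smul_apply,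
        smul_eq_mul, Prod.fst_sub, mul_zero, add_zero]
      rw [← sub_div, hs]; ring
    · simp only [toPlaneL_apply, unitVec, Fin.mk_one, toPlane_one, PiLp.smul_apply,
        smul_eq_mul, Prod.snd_sub, mul_zero, add_zero]
      rw [← sub_div, neg_sub_neg, ← neg_sub, hc]; ring

lemma reach_pos {t : ℝ} (ht : 0 < t) (h : |γ.curvature| * t < 2 * Real.pi) : 0 < γ.reach t := by
  by_cases h0 : γ.curvature = 0
  · rwa [reach_zero_curvature _ h0]
  · rw [reach_of_ne _ h0]
    rcases lt_or_gt_of_ne h0 with hn | hp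
    · rw [abs_of_neg hn] at h
      have : 0 < Real.sin (-(γ.curvature * t / 2)) :=
        Real.sin_pos_of_pos_of_lt_pi (by nlinarith) (by linarith)
      rw [Real.sin_neg] at this
      rw [div_mul_eq_mul_div]
      exact div_pos_of_neg_of_neg (by linarith) hn
    · rw [abs_of_pos hp] at h
      have : 0 < Real.sin (γ.curvature * t / 2) :=
        Real.sin_pos_of_pos_of_lt_pi (by positivity) (by linarith)
      positivity

lemma norm_unitVec (θ : ℝ) : ‖unitVec θ‖ = 1 := by
  have h := toPlane_norm_sq (Real.cos θ, Real.sin θ)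
  have h2 : ‖unitVec θ‖ ^ 2 = 1 := by
    rw [unitVec, h]; exact Real.cos_sq_add_sin_sq θ
  exact (pow_eq_one_iff_of_nonneg (norm_nonneg _) two_ne_zero).1 h2

lemma chord_eq : γ.chord = γ.reach γ.length := by
  rw [chord, point_zero, point_eq γ γ.length, dist_self_add_right, norm_smul, norm_unitVec, mul_one,
    Real.norm_of_nonneg (γ.reach_pos γ.length_pos γ.not_closed).le]

lemma chord_pos : 0 < γ.chord := by
  rw [chord_eq]; exact γ.reach_pos γ.length_pos γ.not_closed

/-- The cone with apex at the starting point over the portion of length `L` of the curve. -/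
def cap (L : ℝ) : Set Plane :=
  (fun z : ℝ × ℝ => γ.start + z.1 • (γ.point z.2 - γ.start)) '' (Ioo 0 1 ×ˢ Ioo 0 L)

lemma unitVec_injective_of_lt {θ η : ℝ} (h : unitVec θ = unitVec η) (hlt : |θ - η| < 2 * Real.pi) :
    θ = η := by
  have hc : Real.cos θ = Real.cos η := congrArg (fun x : Plane => x 0) h
  have hs : Real.sin θ = Real.sin η := congrArg (fun x : Plane => x 1) h
  have h1 : Real.cos (θ - η) = 1 := by
    rw [Real.cos_sub, hc, hs, ← pow_two, ← pow_two, Real.cos_sq_add_sin_sq]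
  rw [abs_lt] at hlt
  have := (Real.cos_eq_one_iff_of_lt_of_lt (by linarith) hlt.2).1 h1
  linarith

/-- Seen from the starting point, the point at arc length `t` lies in the direction `angle + κt/2`.
These directions sweep at most a half turn without repetition, so each ray meets the arc at most
once. -/
lemma injOn_cone {L : ℝ} (h0 : γ.curvature ≠ 0) (hL : |γ.curvature| * L ≤ 2 * Real.pi) :
    InjOn (fun z : ℝ × ℝ => γ.start + z.1 • (γ.point z.2 - γ.start)) (Ioo 0 1 ×ˢ Ioo 0 L) := by
  rintro ⟨s, t⟩ ⟨⟨hs0, hs1⟩, ht0, htL⟩ ⟨s', t'⟩ ⟨⟨hs0', hs1'⟩, ht0', htL'⟩ h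
  have hpos : 0 < |γ.curvature| := abs_pos.2 h0
  have hr := γ.reach_pos ht0 (by nlinarith)
  have hr' := γ.reach_pos ht0' (by nlinarith)
  simp only at hs0 hs1 ht0 htL hs0' hs1' ht0' htL'
  simp only [add_right_inj, point_eq, add_sub_cancel_left, smul_smul] at h
  have hn := congrArg norm h
  rw [norm_smul, norm_smul, norm_unitVec, norm_unitVec, mul_one, mul_one,
    Real.norm_of_nonneg (by positivity), Real.norm_of_nonneg (by positivity)] at hn
  rw [← hn] at h
  have hu := smul_right_injective Plane (by positivity : s * γ.reach t ≠ 0) h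
  have hang := unitVec_injective_of_lt hu (by
    have : γ.angle + γ.curvature * t / 2 - (γ.angle + γ.curvature * t' / 2)
        = γ.curvature * ((t - t') / 2) := by ring
    rw [this, abs_mul]
    have h2 : |(t - t') / 2| < L := by rw [abs_lt]; constructor <;> linarith
    nlinarith)
  have htt : t = t' := by
    have : γ.curvature * (t - t') = 0 := by linarith
    rcases mul_eq_zero.1 this with h1 | h1
    · exact absurd h1 h0
    · linarith
  subst htt
  simp only [Prod.mk.injEq, and_true]
  exact mul_right_cancel₀ hr.ne' hn

lemma cone_det (h0 : γ.curvature ≠ 0) (t : ℝ) :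
    (γ.point t - γ.start) 0 * γ.tangent t 1 - (γ.point t - γ.start) 1 * γ.tangent t 0
      = 2 / γ.curvature * Real.sin (γ.curvature * t / 2) ^ 2 := by
  rw [point_eq, add_sub_cancel_left, tangent_eq, reach_of_ne _ h0]
  simp only [unitVec, toPlane_zero, toPlane_one, PiLp.smul_apply, smul_eq_mul]
  have h : Real.sin (γ.curvature * t / 2) = Real.sin (γ.angle + γ.curvature * t)
      * Real.cos (γ.angle + γ.curvature * t / 2)
      - Real.cos (γ.angle + γ.curvature * t) * Real.sin (γ.angle + γ.curvature * t / 2) := by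
    rw [← Real.sin_sub]; congr 1; ring
  rw [pow_two]
  nth_rw 4 [h]
  ring

lemma setIntegral_cap {L : ℝ} (hL0 : 0 ≤ L) (h0 : γ.curvature ≠ 0)
    (hL : |γ.curvature| * L ≤ 2 * Real.pi) {f : Plane → ℝ} (hf : Continuous f) :
    MeasurableSet (γ.cap L) ∧ ∫ x in γ.cap L, f x = ∫ t in (0 : ℝ)..L, ∫ s in (0 : ℝ)..1,
      s * |2 / γ.curvature * Real.sin (γ.curvature * t / 2) ^ 2|
        * f (γ.start + s • (γ.point t - γ.start)) := by
  have hcoord : ∀ (i : Fin 2) (z : ℝ × ℝ), HasFDerivAt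
      (fun z : ℝ × ℝ => (γ.start + z.1 • (γ.point z.2 - γ.start)) i)
      ((γ.point z.2 - γ.start) i • ContinuousLinearMap.fst ℝ ℝ ℝ
        + (z.1 * γ.tangent z.2 i) • ContinuousLinearMap.snd ℝ ℝ ℝ) z := by
    intro i z
    have h1 : HasFDerivAt (fun z : ℝ × ℝ => z.1) (ContinuousLinearMap.fst ℝ ℝ ℝ) z :=
      hasFDerivAt_fst
    have h2 : HasFDerivAt (fun z : ℝ × ℝ => (γ.point z.2 - γ.start) i)
        (γ.tangent z.2 i • ContinuousLinearMap.snd ℝ ℝ ℝ) z :=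
      (hasDerivAt_coord ((γ.hasDerivAt_point z.2).sub_const γ.start) i).comp_hasFDerivAt z
        hasFDerivAt_snd
    have h3 := (h1.mul h2).const_add (γ.start i)
    rw [smul_smul, add_comm (_ • ContinuousLinearMap.snd ℝ ℝ ℝ)] at h3
    exact h3
  obtain ⟨hm, hi⟩ := setIntegral_image_plane (measurableSet_Ioo.prod measurableSet_Ioo) hcoord
    (γ.injOn_cone h0 hL) f
  refine ⟨hm, ?_⟩
  have hpc := γ.continuous_point
  have htc := γ.continuous_tangent
  rw [cap, hi]
  have hdet : ∀ z ∈ Ioo (0 : ℝ) 1 ×ˢ Ioo (0 : ℝ) L,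
      |(γ.point z.2 - γ.start) 0 * (z.1 * γ.tangent z.2 1)
        - z.1 * γ.tangent z.2 0 * (γ.point z.2 - γ.start) 1|
        * f (γ.start + z.1 • (γ.point z.2 - γ.start))
      = z.1 * |2 / γ.curvature * Real.sin (γ.curvature * z.2 / 2) ^ 2|
        * f (γ.start + z.1 • (γ.point z.2 - γ.start)) := by
    rintro ⟨s, t⟩ ⟨⟨hs, _⟩, _⟩
    simp only at hs ⊢
    rw [← cone_det γ h0, ← abs_of_pos hs, ← abs_mul, abs_of_pos hs]
    congr 2; ring
  rw [setIntegral_congr_fun (measurableSet_Ioo.prod measurableSet_Ioo) hdet,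
    Measure.volume_eq_prod, ← Measure.prod_restrict]
  have hc : Continuous fun z : ℝ × ℝ =>
      z.1 * |2 / γ.curvature * Real.sin (γ.curvature * z.2 / 2) ^ 2|
        * f (γ.start + z.1 • (γ.point z.2 - γ.start)) := by fun_prop
  rw [integral_prod_symm]
  · rw [intervalIntegral.integral_of_le hL0, integral_Ioc_eq_integral_Ioo]
    simp only [intervalIntegral.integral_of_le zero_le_one, integral_Ioc_eq_integral_Ioo]
  · rw [Measure.prod_restrict]
    exact (hc.continuousOn.integrableOn_compact (isCompact_Icc.prod isCompact_Icc)).mono_set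
      (prod_mono Ioo_subset_Icc_self Ioo_subset_Icc_self)

/-- The flux of a field out of the left side of the first portion of length `L`. -/
def flux (L : ℝ) (φ : Plane → Plane) : ℝ :=
  ∫ t in (0 : ℝ)..L, -inner ℝ (γ.leftNormal t) (φ (γ.point t))

lemma neg_inner_leftNormal (t : ℝ) (y : Plane) :
    -inner ℝ (γ.leftNormal t) y = y 0 * γ.tangent t 1 - y 1 * γ.tangent t 0 := by
  rw [leftNormal_eq, tangent_eq]
  simp [PiLp.inner_apply, Fin.sum_univ_two, unitVec]
  ring

/-- The signed indicator of the region between an arc and its chord. -/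
def capFun (L : ℝ) : Plane → ℝ := (γ.cap L).indicator fun _ => (SignType.sign γ.curvature : ℝ)

/-- The Jacobian of the cone has the sign of the curvature, so the cone formula becomes an integral
over the cap. The chord term depends only on the endpoints and will cancel when two arcs over the
same chord are compared. -/
lemma flux_eq {L : ℝ} (hL0 : 0 ≤ L) (hL : |γ.curvature| * L ≤ 2 * Real.pi) {φ : Plane → Plane}
    (hφ : ContDiff ℝ 1 φ) :
    γ.flux L φ = chordFlux γ.start (γ.point L) φ
      + SignType.sign γ.curvature * ∫ x in γ.cap L, planeDiv φ x := by
  have h := flux_eq_chordFlux_add hφ γ.hasDerivAt_point γ.continuous_tangent L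
  simp only [point_zero] at h
  rw [flux]
  simp only [neg_inner_leftNormal]
  rw [h]
  congr 1
  by_cases h0 : γ.curvature = 0
  · have : ∀ t, (γ.point t - γ.start) 0 * γ.tangent t 1 - (γ.point t - γ.start) 1 * γ.tangent t 0
        = 0 := by
      intro t
      rw [point_eq, tangent_eq, h0]
      simp [unitVec]; ring
    simp only [this, h0, sign_zero]
    simp
  · rw [(γ.setIntegral_cap hL0 h0 hL (continuous_planeDiv hφ)).2,
      ← intervalIntegral.integral_const_mul]
    congr 1; ext t
    rw [← intervalIntegral.integral_const_mul]
    congr 1; ext s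
    rw [cone_det γ h0]
    rcases lt_or_gt_of_ne h0 with hn | hp
    · rw [abs_of_nonpos (mul_nonpos_of_nonpos_of_nonneg
        (div_nonpos_of_nonneg_of_nonpos zero_le_two hn.le) (sq_nonneg _)), sign_neg hn]
      simp
    · rw [abs_of_nonneg (by positivity), sign_pos hp]
      simp

/-- The signed area of the region between an arc of curvature `κ` and length `L` and its chord. -/
def segmentArea (κ L : ℝ) : ℝ := (κ * L - Real.sin (κ * L)) / (2 * κ ^ 2)

lemma measurableSet_cap {L : ℝ} (hL0 : 0 ≤ L) (h0 : γ.curvature ≠ 0)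
    (hL : |γ.curvature| * L ≤ 2 * Real.pi) : MeasurableSet (γ.cap L) :=
  (γ.setIntegral_cap hL0 h0 hL (f := fun _ => 0) continuous_const).1

lemma volume_cap_lt_top (L : ℝ) : volume (γ.cap L) < ⊤ := by
  have hpc := γ.continuous_point
  have hc : Continuous fun z : ℝ × ℝ => γ.start + z.1 • (γ.point z.2 - γ.start) := by fun_prop
  have hK := ((isCompact_Icc (a := (0 : ℝ)) (b := 1)).prod (isCompact_Icc (a := 0) (b := L))).image hc
  exact (measure_mono (image_mono (prod_mono Ioo_subset_Icc_self Ioo_subset_Icc_self))).trans_lt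
    hK.measure_lt_top

lemma integrable_capFun {L : ℝ} (hL0 : 0 ≤ L) (hL : |γ.curvature| * L ≤ 2 * Real.pi) :
    Integrable (γ.capFun L) := by
  by_cases h0 : γ.curvature = 0
  · simp [capFun, h0]
  · exact (integrable_indicator_iff (γ.measurableSet_cap hL0 h0 hL)).2
      (integrableOn_const (γ.volume_cap_lt_top L).ne)

lemma capFun_integer (L : ℝ) (x : Plane) : ∃ k : ℤ, γ.capFun L x = k := by
  by_cases hx : x ∈ γ.cap L
  · exact ⟨SignType.sign γ.curvature, by simp [capFun, hx]⟩
  · exact ⟨0, by simp [capFun, hx]⟩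

lemma integral_capFun_mul {L : ℝ} (hL0 : 0 ≤ L) (hL : |γ.curvature| * L ≤ 2 * Real.pi)
    (f : Plane → ℝ) :
    ∫ x, γ.capFun L x * f x = SignType.sign γ.curvature * ∫ x in γ.cap L, f x := by
  by_cases h0 : γ.curvature = 0
  · simp [capFun, h0]
  · rw [← integral_indicator (γ.measurableSet_cap hL0 h0 hL), ← integral_const_mul]
    congr 1; ext x
    by_cases hx : x ∈ γ.cap L <;> simp [capFun, hx]

lemma integral_capFun {L : ℝ} (hL0 : 0 ≤ L) (hL : |γ.curvature| * L ≤ 2 * Real.pi) :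
    ∫ x, γ.capFun L x = segmentArea γ.curvature L := by
  have h := γ.integral_capFun_mul hL0 hL (fun _ => 1)
  simp only [mul_one] at h
  rw [h]
  by_cases h0 : γ.curvature = 0
  · simp [segmentArea, h0]
  · rw [(γ.setIntegral_cap hL0 h0 hL (f := fun _ => 1) continuous_const).2,
      ← intervalIntegral.integral_const_mul]
    have h1 : ∀ t, (SignType.sign γ.curvature : ℝ) * ∫ s in (0 : ℝ)..1,
        s * |2 / γ.curvature * Real.sin (γ.curvature * t / 2) ^ 2| * 1
        = (1 - Real.cos (γ.curvature * t)) / (2 * γ.curvature) := by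
      intro t
      simp only [mul_one]
      rw [intervalIntegral.integral_mul_const, integral_id]
      have h2 : Real.cos (γ.curvature * t) = 1 - 2 * Real.sin (γ.curvature * t / 2) ^ 2 := by
        rw [← Real.cos_two_mul_eq_one_sub]; congr 1; ring
      have h3 : (SignType.sign γ.curvature : ℝ)
          * |2 / γ.curvature * Real.sin (γ.curvature * t / 2) ^ 2|
          = 2 / γ.curvature * Real.sin (γ.curvature * t / 2) ^ 2 := by
        rcases lt_or_gt_of_ne h0 with hn | hp
        · rw [abs_of_nonpos (mul_nonpos_of_nonpos_of_nonneg
            (div_nonpos_of_nonneg_of_nonpos zero_le_two hn.le) (sq_nonneg _)), sign_neg hn]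
          simp
        · rw [abs_of_nonneg (by positivity), sign_pos hp]
          simp
      rw [mul_left_comm, h3, h2]
      field_simp
      ring
    simp only [h1]
    have hd : ∀ t ∈ uIcc 0 L, HasDerivAt
        (fun t => (t - Real.sin (γ.curvature * t) / γ.curvature) / (2 * γ.curvature))
        ((1 - Real.cos (γ.curvature * t)) / (2 * γ.curvature)) t := by
      intro t _
      have e0 : HasDerivAt (fun s => γ.curvature * s) γ.curvature t := by
        simpa using (hasDerivAt_id t).const_mul γ.curvature
      have e1 := ((hasDerivAt_id t).sub (e0.sin.div_const γ.curvature)).div_const (2 * γ.curvature)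
      rw [mul_div_cancel_right₀ _ h0] at e1
      exact e1
    rw [intervalIntegral.integral_eq_sub_of_hasDerivAt hd
      (Continuous.intervalIntegrable (by fun_prop) _ _), segmentArea]
    simp only [mul_zero, Real.sin_zero, zero_div, sub_zero]
    field_simp

end CircularArc

/-! ### The divergence theorem on disks, complements of disks and half-planes -/

lemma integral_planeDiv_eq_zero {X : Plane → Plane} (hX : ContDiff ℝ 1 X)
    (hc : HasCompactSupport X) : ∫ x, planeDiv X x = 0 := by
  have hcoord : ∀ i : Fin 2, ContDiff ℝ 1 fun x => X x i := fun i =>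
    (EuclideanSpace.proj i : Plane →L[ℝ] ℝ).contDiff.comp hX
  have hsupp : ∀ i : Fin 2, HasCompactSupport fun x => X x i := fun i =>
    hc.comp_left (g := fun y : Plane => y i) rfl
  have h : ∀ i : Fin 2, ∫ x, pd i (fun x => X x i) x = 0 := by
    intro i
    have h := integral_mul_lineDeriv_eq_neg (μ := volume) (e := EuclideanSpace.single i 1)
      (T := fun _ => 1) (T' := fun _ => 0) (hcoord i) (hsupp i) continuous_const continuous_const
      (fun x => by simpa [HasLineDerivAt] using hasDerivAt_const (0 : ℝ) (1 : ℝ))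
    simp only [mul_zero, integral_zero, mul_one, zero_eq_neg] at h
    exact h
  have hi : ∀ i : Fin 2, Integrable fun x => pd i (fun x => X x i) x := fun i =>
    (continuous_pd (hcoord i) i).integrable_of_hasCompactSupport (hasCompactSupport_pd (hsupp i) i)
  simp only [fun x => planeDiv_eq (hX.differentiable one_ne_zero x)]
  rw [integral_add (hi 0) (hi 1), h, h, add_zero]

lemma setIntegral_Ioo_prod_Ioo {f : ℝ → ℝ → ℝ} (hf : Continuous (Function.uncurry f))
    {a b c d : ℝ} (hab : a ≤ b) (hcd : c ≤ d) :
    ∫ z in Ioo a b ×ˢ Ioo c d, f z.1 z.2 = ∫ t in a..b, ∫ n in c..d, f t n := by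
  rw [intervalIntegral.integral_of_le hab, integral_Ioc_eq_integral_Ioo]
  simp only [intervalIntegral.integral_of_le hcd, integral_Ioc_eq_integral_Ioo]
  exact setIntegral_prod (fun z : ℝ × ℝ => f z.1 z.2)
    ((hf.continuousOn.integrableOn_compact (isCompact_Icc.prod isCompact_Icc)).mono_set
      (prod_mono Ioo_subset_Icc_self Ioo_subset_Icc_self))

namespace CircularArc

variable (γ : CircularArc)

lemma inner_leftNormal_zero (y : Plane) :
    inner ℝ (γ.leftNormal 0) y = -Real.sin γ.angle * y 0 + Real.cos γ.angle * y 1 := by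
  rw [leftNormal_eq]
  simp [PiLp.inner_apply, Fin.sum_univ_two]
  ring

lemma inner_leftNormal_zero_unitVec (β : ℝ) :
    inner ℝ (γ.leftNormal 0) (unitVec (γ.angle + β)) = Real.sin β := by
  rw [inner_leftNormal_zero]
  have h : Real.sin β = Real.sin (γ.angle + β - γ.angle) := by congr 1; ring
  rw [h, Real.sin_sub]
  simp [unitVec]
  ring

lemma eq_one_or_neg_one_of_sq {σ : ℝ} (hσ : σ ^ 2 = 1) : σ = 1 ∨ σ = -1 := by
  have : (σ - 1) * (σ + 1) = 0 := by linear_combination hσ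
  rcases mul_eq_zero.1 this with h | h
  · left; linarith
  · right; linarith

lemma exists_polar {σ : ℝ} (hσ : σ ^ 2 = 1) {y : Plane}
    (hy : 0 < σ * inner ℝ (γ.leftNormal 0) y) :
    ∃ r β : ℝ, 0 < r ∧ 0 < β ∧ β < Real.pi ∧ y = r • unitVec (γ.angle + σ * β) := by
  set a := Real.cos γ.angle * y 0 + Real.sin γ.angle * y 1 with ha
  set b := -Real.sin γ.angle * y 0 + Real.cos γ.angle * y 1 with hb
  rw [inner_leftNormal_zero, ← hb] at hy
  have hb0 : b ≠ 0 := by rintro h; rw [h] at hy; simp at hy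
  have hsum : 0 < a ^ 2 + b ^ 2 := by positivity
  set r := √(a ^ 2 + b ^ 2) with hr
  have hr0 : 0 < r := Real.sqrt_pos.2 hsum
  have hr2 : r ^ 2 = a ^ 2 + b ^ 2 := Real.sq_sqrt hsum.le
  have habs : |a / r| ≤ 1 := by
    rw [abs_div, abs_of_pos hr0, div_le_one hr0]
    exact Real.abs_le_sqrt (by nlinarith)
  rw [abs_le] at habs
  set β := Real.arccos (a / r) with hβ
  have hcos : Real.cos β = a / r := Real.cos_arccos habs.1 habs.2
  have hsin : Real.sin β = σ * b / r := by
    rw [hβ, Real.sin_arccos]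
    rw [Real.sqrt_eq_iff_eq_sq]
    · rw [div_pow, div_pow, mul_pow, hσ]
      field_simp
      linarith
    · rw [div_pow, sub_nonneg, div_le_one (by positivity)]; nlinarith
    · positivity
  have hspos : 0 < Real.sin β := by rw [hsin]; positivity
  have hβ0 : 0 ≤ β := Real.arccos_nonneg _
  have hβπ : β ≤ Real.pi := Real.arccos_le_pi _
  refine ⟨r, β, hr0, hβ0.lt_of_ne ?_, hβπ.lt_of_ne ?_, ?_⟩
  · intro h; rw [← h] at hspos; simp at hspos
  · intro h; rw [h] at hspos; simp at hspos
  · have hσ1 : σ = 1 ∨ σ = -1 := eq_one_or_neg_one_of_sq hσ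
    have hcσ : Real.cos (σ * β) = a / r := by
      rcases hσ1 with h | h <;> simp [h, hcos]
    have hsσ : Real.sin (σ * β) = b / r := by
      rcases hσ1 with h | h <;> rw [h] at hsin ⊢ <;> simp [hsin, neg_div]
    have hp := Real.sin_sq_add_cos_sq γ.angle
    ext i; fin_cases i
    · simp only [unitVec, Fin.zero_eta, toPlane_zero, PiLp.smul_apply, smul_eq_mul]
      rw [Real.cos_add, hcσ, hsσ]
      field_simp
      rw [ha, hb]
      linear_combination -(y 0) * hp
    · simp only [unitVec, Fin.mk_one, toPlane_one, PiLp.smul_apply, smul_eq_mul]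
      rw [Real.sin_add, hcσ, hsσ]
      field_simp
      rw [ha, hb]
      linear_combination -(y 1) * hp

lemma sign_mul_abs_curvature :
    (SignType.sign γ.curvature : ℝ) * |γ.curvature| = γ.curvature := by
  rcases lt_trichotomy γ.curvature 0 with h | h | h <;> simp [h, abs_of_neg, abs_of_pos]

/-- The cone over the full circle is the open disk. -/
lemma cap_full_circle (h0 : γ.curvature ≠ 0) :
    γ.cap (2 * Real.pi / |γ.curvature|) = {x | |γ.curvature| * ‖x - γ.start‖ ^ 2
      < 2 * (SignType.sign γ.curvature * inner ℝ (γ.leftNormal 0) (x - γ.start))} := by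
  set σ : ℝ := (SignType.sign γ.curvature : ℝ) with hσdef
  have hκ : 0 < |γ.curvature| := abs_pos.2 h0
  have hσκ : σ * |γ.curvature| = γ.curvature := γ.sign_mul_abs_curvature
  have hσ : σ ^ 2 = 1 := by
    rcases lt_or_gt_of_ne h0 with h | h
    · simp [hσdef, sign_neg h]
    · simp [hσdef, sign_pos h]
  have hσ1 : σ = 1 ∨ σ = -1 := eq_one_or_neg_one_of_sq hσ
  have hσsin : ∀ β, σ * Real.sin (σ * β) = Real.sin β := by
    intro β; rcases hσ1 with h | h <;> simp [h]
  have hreach : ∀ β, γ.reach (2 * β / |γ.curvature|) = 2 / |γ.curvature| * Real.sin β := by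
    intro β
    have e1 : γ.curvature * (2 * β / |γ.curvature|) / 2 = σ * β := by
      calc _ = σ * |γ.curvature| * (2 * β / |γ.curvature|) / 2 := by rw [hσκ]
        _ = σ * β := by field_simp
    have e2 : 2 / γ.curvature = 2 * σ / |γ.curvature| := by
      rw [div_eq_div_iff h0 hκ.ne']
      linear_combination 2 * σ * hσκ - 2 * |γ.curvature| * hσ
    rw [reach_of_ne _ h0, e1, e2, ← hσsin β]
    ring
  have hpt : ∀ β, γ.point (2 * β / |γ.curvature|)
      = γ.start + (2 / |γ.curvature| * Real.sin β) • unitVec (γ.angle + σ * β) := by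
    intro β
    rw [point_eq, hreach]
    congr 3
    have : γ.curvature * (2 * β / |γ.curvature|) / 2
        = σ * |γ.curvature| * (2 * β / |γ.curvature|) / 2 := by rw [hσκ]
    rw [this]; field_simp
  ext x
  constructor
  · rintro ⟨⟨s, t⟩, ⟨⟨hs0, hs1⟩, ht0, htL⟩, rfl⟩
    simp only at hs0 hs1 ht0 htL
    obtain ⟨β, rfl⟩ : ∃ β, t = 2 * β / |γ.curvature| :=
      ⟨|γ.curvature| * t / 2, by field_simp⟩
    have hβ0 : 0 < β := by
      have := (div_pos_iff_of_pos_right hκ).1 ht0; linarith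
    have hβπ : β < Real.pi := by
      have := (div_lt_div_iff_of_pos_right hκ).1 htL; linarith
    have hsin := Real.sin_pos_of_pos_of_lt_pi hβ0 hβπ
    simp only [mem_ofPred_eq, add_sub_cancel_left, hpt, smul_smul]
    rw [norm_smul, norm_unitVec, inner_smul_right, inner_leftNormal_zero_unitVec,
      Real.norm_of_nonneg (by positivity)]
    have : 2 * (σ * (s * (2 / |γ.curvature| * Real.sin β) * Real.sin (σ * β)))
        = 2 * (s * (2 / |γ.curvature| * Real.sin β) * (σ * Real.sin (σ * β))) := by ring
    rw [this, hσsin]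
    field_simp
    nlinarith [mul_pos hs0 (mul_pos hsin hsin)]
  · intro hx
    simp only [mem_ofPred_eq] at hx
    have hy : 0 < σ * inner ℝ (γ.leftNormal 0) (x - γ.start) := by
      have : 0 ≤ |γ.curvature| * ‖x - γ.start‖ ^ 2 := by positivity
      linarith
    obtain ⟨r, β, hr, hβ0, hβπ, hxr⟩ := γ.exists_polar hσ hy
    have hsin := Real.sin_pos_of_pos_of_lt_pi hβ0 hβπ
    rw [hxr, norm_smul, norm_unitVec, inner_smul_right, inner_leftNormal_zero_unitVec,
      Real.norm_of_nonneg hr.le] at hx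
    have e : 2 * (σ * (r * Real.sin (σ * β))) = 2 * (r * (σ * Real.sin (σ * β))) := by ring
    rw [e, hσsin] at hx
    refine ⟨(r / (2 / |γ.curvature| * Real.sin β), 2 * β / |γ.curvature|),
      ⟨⟨by positivity, ?_⟩, by positivity, ?_⟩, ?_⟩
    · rw [div_lt_one (by positivity), div_mul_eq_mul_div, lt_div_iff₀ hκ]
      nlinarith
    · simp only; gcongr
    · simp only [hpt, add_sub_cancel_left, smul_smul]
      rw [div_mul_cancel₀ _ (by positivity), ← hxr]
      simp

lemma chordFlux_self (p : Plane) (φ : Plane → Plane) : chordFlux p p φ = 0 := by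
  simp [chordFlux]

lemma point_full_circle (h0 : γ.curvature ≠ 0) :
    γ.point (2 * Real.pi / |γ.curvature|) = γ.start := by
  have hκ : 0 < |γ.curvature| := abs_pos.2 h0
  have : γ.reach (2 * Real.pi / |γ.curvature|) = 0 := by
    rw [reach_of_ne _ h0]
    rcases lt_or_gt_of_ne h0 with h | h
    · rw [abs_of_neg h]
      have : γ.curvature * (2 * Real.pi / -γ.curvature) / 2 = -Real.pi := by field_simp
      rw [this]; simp
    · rw [abs_of_pos h]
      have : γ.curvature * (2 * Real.pi / γ.curvature) / 2 = Real.pi := by field_simp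
      rw [this]; simp
  rw [point_eq, this, zero_smul, add_zero]

lemma volume_circle_eq_zero (h0 : γ.curvature ≠ 0) :
    volume {x | γ.curvature * ‖x - γ.start‖ ^ 2
      = 2 * inner ℝ (γ.leftNormal 0) (x - γ.start)} = 0 := by
  set n := γ.leftNormal 0 with hn
  refine measure_mono_null (t := Metric.sphere (γ.start + γ.curvature⁻¹ • n)
    (‖γ.curvature⁻¹ • n‖)) ?_ ?_
  · intro x hx
    simp only [mem_ofPred_eq] at hx
    rw [mem_sphere_iff_norm]
    have e : x - (γ.start + γ.curvature⁻¹ • n) = (x - γ.start) - γ.curvature⁻¹ • n := by abel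
    rw [e, ← sq_eq_sq₀ (norm_nonneg _) (norm_nonneg _), norm_sub_sq_real, inner_smul_right,
      real_inner_comm]
    have : ‖x - γ.start‖ ^ 2 = γ.curvature⁻¹ * (2 * inner ℝ n (x - γ.start)) := by
      rw [← hx]; field_simp
    rw [this]; ring
  · exact Measure.addHaar_sphere _ _ _

lemma measurableSet_leftSide : MeasurableSet γ.leftSide :=
  (isOpen_lt (by fun_prop) (by fun_prop)).measurableSet

/-- The divergence theorem on the left side of a full circle. -/
lemma integral_leftSide_of_ne_zero (h0 : γ.curvature ≠ 0) {X : Plane → Plane}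
    (hX : ContDiff ℝ 1 X) (hc : HasCompactSupport X) :
    ∫ x in γ.leftSide, planeDiv X x = γ.flux (2 * Real.pi / |γ.curvature|) X := by
  have hκ : 0 < |γ.curvature| := abs_pos.2 h0
  rw [flux_eq γ (by positivity) (by rw [mul_div_cancel₀ _ hκ.ne']) hX, point_full_circle γ h0,
    chordFlux_self, zero_add, cap_full_circle γ h0]
  rcases lt_or_gt_of_ne h0 with h | h
  · have hi : Integrable (planeDiv X) :=
      (continuous_planeDiv hX).integrable_of_hasCompactSupport (hasCompactSupport_planeDiv hc)
    -- For negative curvature the left side is the complement of the disk up to a null circle, and a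
    -- compactly supported field has total divergence zero.
    have h1 : (∫ x in γ.leftSide, planeDiv X x) + ∫ x in γ.leftSideᶜ, planeDiv X x = 0 := by
      rw [← integral_planeDiv_eq_zero hX hc]
      exact integral_add_compl γ.measurableSet_leftSide hi
    have h2 : {x | |γ.curvature| * ‖x - γ.start‖ ^ 2
      < 2 * (SignType.sign γ.curvature * inner ℝ (γ.leftNormal 0) (x - γ.start))}
        =ᵐ[volume] γ.leftSideᶜ := by
      have hae : ∀ᵐ x : Plane, ¬ (γ.curvature * ‖x - γ.start‖ ^ 2
        = 2 * inner ℝ (γ.leftNormal 0) (x - γ.start)) := by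
        rw [ae_iff]; simpa using γ.volume_circle_eq_zero h0
      filter_upwards [hae] with x hx
      apply propext
      show (_ < _) ↔ ¬ (_ < _)
      rw [abs_of_neg h, sign_neg h, not_lt]
      simp only [SignType.coe_neg, SignType.coe_one, neg_mul, one_mul]
      constructor
      · intro h; linarith
      · intro h'; have := lt_of_le_of_ne h' (Ne.symm hx); linarith
    rw [setIntegral_congr_set h2, sign_neg h]
    simp only [SignType.coe_neg, SignType.coe_one, neg_mul, one_mul]
    rw [eq_neg_iff_add_eq_zero]
    exact h1
  · rw [abs_of_pos h, sign_pos h]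
    simp [leftSide]

lemma exists_bound_of_hasCompactSupport {X : Plane → Plane} (hc : HasCompactSupport X)
    (p : Plane) : ∃ M : ℝ, ∀ m ≥ M, ∀ x, m ≤ ‖x - p‖ → x ∉ tsupport X := by
  obtain ⟨r, hr⟩ := hc.isBounded.subset_closedBall p
  refine ⟨r + 1, fun m hm x hx h => ?_⟩
  have := hr h
  rw [mem_closedBall_iff_norm] at this
  linarith

/-- The orthonormal coordinates with origin `p` and first axis in the direction `(c, s)`. -/
def frame (p : Plane) (c s : ℝ) (z : ℝ × ℝ) : Plane :=
  p + toPlane (c * z.1 + -s * z.2, s * z.1 + c * z.2)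

section frame

variable {p : Plane} {c s : ℝ}

lemma frame_zero (z : ℝ × ℝ) : frame p c s z 0 = p 0 + (c * z.1 + -s * z.2) := by simp [frame]

lemma frame_one (z : ℝ × ℝ) : frame p c s z 1 = p 1 + (s * z.1 + c * z.2) := by simp [frame]

lemma continuous_frame : Continuous (frame p c s) := by unfold frame; fun_prop

lemma norm_frame_sub (hcs : s ^ 2 + c ^ 2 = 1) (z : ℝ × ℝ) :
    ‖frame p c s z - p‖ ^ 2 = z.1 ^ 2 + z.2 ^ 2 := by
  simp only [frame, add_sub_cancel_left, toPlane_norm_sq]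
  linear_combination (z.1 ^ 2 + z.2 ^ 2) * hcs

lemma frame_injective (hcs : s ^ 2 + c ^ 2 = 1) : Function.Injective (frame p c s) := by
  intro z w h
  have h0 : c * z.1 + -s * z.2 = c * w.1 + -s * w.2 := by
    have := congrArg (fun x : Plane => x 0) h; simp only [frame_zero] at this; linarith
  have h1 : s * z.1 + c * z.2 = s * w.1 + c * w.2 := by
    have := congrArg (fun x : Plane => x 1) h; simp only [frame_one] at this; linarith
  ext
  · linear_combination c * h0 + s * h1 - (z.1 - w.1) * hcs
  · linear_combination c * h1 - s * h0 - (z.2 - w.2) * hcs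

lemma frame_surjective (hcs : s ^ 2 + c ^ 2 = 1) : Function.Surjective (frame p c s) := by
  intro x
  refine ⟨(c * (x 0 - p 0) + s * (x 1 - p 1), -s * (x 0 - p 0) + c * (x 1 - p 1)), ?_⟩
  ext i; fin_cases i
  · simp only [Fin.zero_eta, frame_zero]; linear_combination (x 0 - p 0) * hcs
  · simp only [Fin.mk_one, frame_one]; linear_combination (x 1 - p 1) * hcs

lemma hasFDerivAt_frame (i : Fin 2) (z : ℝ × ℝ) : HasFDerivAt (fun z => frame p c s z i)
    ((![c, s] : Fin 2 → ℝ) i • ContinuousLinearMap.fst ℝ ℝ ℝ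
      + (![-s, c] : Fin 2 → ℝ) i • ContinuousLinearMap.snd ℝ ℝ ℝ) z := by
  have h1 : HasFDerivAt (fun z : ℝ × ℝ => z.1) (ContinuousLinearMap.fst ℝ ℝ ℝ) z := hasFDerivAt_fst
  have h2 : HasFDerivAt (fun z : ℝ × ℝ => z.2) (ContinuousLinearMap.snd ℝ ℝ ℝ) z := hasFDerivAt_snd
  fin_cases i
  · simp only [Fin.zero_eta, Matrix.cons_val_zero, frame_zero]
    exact ((h1.const_mul c).add (h2.const_mul (-s))).const_add (p 0)
  · simp only [Fin.mk_one, Matrix.cons_val_one, frame_one]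
    exact ((h1.const_mul s).add (h2.const_mul c)).const_add (p 1)

lemma hasDerivAt_frame_fst (t n : ℝ) :
    HasDerivAt (fun t => frame p c s (t, n)) (toPlane (c, s)) t := by
  have h1 := (((hasDerivAt_id t).const_mul c).add_const (-s * n)).prodMk
    (((hasDerivAt_id t).const_mul s).add_const (c * n))
  have h2 := (toPlaneL.hasFDerivAt.comp_hasDerivAt t h1).const_add p
  rw [mul_one, mul_one] at h2
  exact h2

lemma hasDerivAt_frame_snd (t n : ℝ) :
    HasDerivAt (fun n => frame p c s (t, n)) (toPlane (-s, c)) n := by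
  have h1 := (((hasDerivAt_id n).const_mul (-s)).const_add (c * t)).prodMk
    (((hasDerivAt_id n).const_mul c).const_add (s * t))
  have h2 := (toPlaneL.hasFDerivAt.comp_hasDerivAt n h1).const_add p
  rw [mul_one, mul_one] at h2
  exact h2

/-- The field vanishes on three sides of the rectangle, so only the flux through the side on the
first axis survives. -/
lemma integral_frame_rectangle (hcs : s ^ 2 + c ^ 2 = 1) {X : Plane → Plane}
    (hX : ContDiff ℝ 1 X) {m : ℝ} (hm0 : 0 ≤ m)
    (hX0 : ∀ z : ℝ × ℝ, m ≤ |z.1| ∨ m ≤ |z.2| → X (frame p c s z) = 0) :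
    ∫ x in frame p c s '' (Ioo (-m) m ×ˢ Ioo 0 m), planeDiv X x
      = ∫ t in (-m)..m, (s * X (frame p c s (t, 0)) 0 - c * X (frame p c s (t, 0)) 1) := by
  have himg := (setIntegral_image_plane (S := Ioo (-m) m ×ˢ Ioo 0 m)
    (measurableSet_Ioo.prod measurableSet_Ioo) hasFDerivAt_frame
    (frame_injective (p := p) hcs).injOn (planeDiv X)).2
  have has : ContDiff ℝ 1 fun x => X x 0 :=
    (EuclideanSpace.proj 0 : Plane →L[ℝ] ℝ).contDiff.comp hX
  have hbs : ContDiff ℝ 1 fun x => X x 1 :=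
    (EuclideanSpace.proj 1 : Plane →L[ℝ] ℝ).contDiff.comp hX
  obtain ⟨a, hadef⟩ : ∃ a : Plane → ℝ, a = fun x => X x 0 := ⟨_, rfl⟩
  obtain ⟨b, hbdef⟩ : ∃ b : Plane → ℝ, b = fun x => X x 1 := ⟨_, rfl⟩
  rw [← hadef] at has
  rw [← hbdef] at hbs
  have ha : ∀ x, X x 0 = a x := fun x => by rw [hadef]
  have hb : ∀ x, X x 1 = b x := fun x => by rw [hbdef]
  have hpa0 := continuous_pd has 0
  have hpa1 := continuous_pd has 1
  have hpb0 := continuous_pd hbs 0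
  have hpb1 := continuous_pd hbs 1
  have hGc : Continuous (frame p c s) := continuous_frame
  obtain ⟨At, hAt⟩ : ∃ At : ℝ → ℝ → ℝ, At = fun t n =>
    c * (pd 0 a (frame p c s (t, n)) * c + pd 1 a (frame p c s (t, n)) * s)
      + s * (pd 0 b (frame p c s (t, n)) * c + pd 1 b (frame p c s (t, n)) * s) := ⟨_, rfl⟩
  obtain ⟨Bn, hBn⟩ : ∃ Bn : ℝ → ℝ → ℝ, Bn = fun t n =>
    -s * (pd 0 a (frame p c s (t, n)) * (-s) + pd 1 a (frame p c s (t, n)) * c)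
      + c * (pd 0 b (frame p c s (t, n)) * (-s) + pd 1 b (frame p c s (t, n)) * c) := ⟨_, rfl⟩
  have hcA : Continuous (Function.uncurry At) := by
    simp only [Function.uncurry_def, hAt]; fun_prop
  have hcB : Continuous (Function.uncurry Bn) := by
    simp only [Function.uncurry_def, hBn]; fun_prop
  have hintA : ∀ n, ∫ t in (-m)..m, At t n = 0 := by
    intro n
    have hder : ∀ t ∈ uIcc (-m) m, HasDerivAt
        (fun t => c * a (frame p c s (t, n)) + s * b (frame p c s (t, n))) (At t n) t := by
      intro t _
      rw [hAt]
      exact ((hasDerivAt_comp_plane has (hasDerivAt_frame_fst t n)).const_mul c).add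
        ((hasDerivAt_comp_plane hbs (hasDerivAt_frame_fst t n)).const_mul s)
    rw [intervalIntegral.integral_eq_sub_of_hasDerivAt hder
      ((hcA.comp (continuous_id.prodMk continuous_const)).intervalIntegrable _ _)]
    simp only [← ha, ← hb]
    rw [hX0 (m, n) (Or.inl (le_abs_self _)),
      hX0 (-m, n) (Or.inl (by rw [abs_neg]; exact le_abs_self _))]
    simp
  have hintB : ∀ t, ∫ n in (0 : ℝ)..m, Bn t n
      = s * a (frame p c s (t, 0)) - c * b (frame p c s (t, 0)) := by
    intro t
    have hder : ∀ n ∈ uIcc (0 : ℝ) m, HasDerivAt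
        (fun n => -s * a (frame p c s (t, n)) + c * b (frame p c s (t, n))) (Bn t n) n := by
      intro n _
      rw [hBn]
      exact ((hasDerivAt_comp_plane has (hasDerivAt_frame_snd t n)).const_mul (-s)).add
        ((hasDerivAt_comp_plane hbs (hasDerivAt_frame_snd t n)).const_mul c)
    rw [intervalIntegral.integral_eq_sub_of_hasDerivAt hder
      ((hcB.comp (continuous_const.prodMk continuous_id)).intervalIntegrable _ _)]
    simp only [← ha, ← hb]
    rw [hX0 (t, m) (Or.inr (le_abs_self _))]
    simp only [PiLp.zero_apply]
    ring
  have hdet : ∀ z : ℝ × ℝ, |(![c, s] : Fin 2 → ℝ) 0 * (![-s, c] : Fin 2 → ℝ) 1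
      - (![-s, c] : Fin 2 → ℝ) 0 * (![c, s] : Fin 2 → ℝ) 1| * planeDiv X (frame p c s z)
      = At z.1 z.2 + Bn z.1 z.2 := by
    intro z
    have : c * c - -s * s = 1 := by linear_combination hcs
    simp only [Matrix.cons_val_zero, Matrix.cons_val_one]
    rw [this, abs_one, one_mul, planeDiv_eq (hX.differentiable one_ne_zero _), ← hadef, ← hbdef,
      hAt, hBn]
    linear_combination -(pd 0 a (frame p c s z) + pd 1 b (frame p c s z)) * hcs
  rw [himg]
  simp only [hdet, ha, hb]
  have hAB : Continuous (Function.uncurry fun t n => At t n + Bn t n) := hcA.add hcB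
  rw [setIntegral_Ioo_prod_Ioo (f := fun t n => At t n + Bn t n) hAB (by linarith) hm0]
  have hA1 : ∀ t, Continuous fun n => At t n := fun t =>
    hcA.comp (continuous_const.prodMk continuous_id)
  have hB1 : ∀ t, Continuous fun n => Bn t n := fun t =>
    hcB.comp (continuous_const.prodMk continuous_id)
  have e1 : ∀ t, ∫ n in (0 : ℝ)..m, (At t n + Bn t n)
      = (∫ n in (0 : ℝ)..m, At t n) + ∫ n in (0 : ℝ)..m, Bn t n := fun t =>
    intervalIntegral.integral_add ((hA1 t).intervalIntegrable _ _)
      ((hB1 t).intervalIntegrable _ _)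
  simp only [e1]
  rw [intervalIntegral.integral_add, integral_integral_swap_of_continuous hcA]
  · simp only [hintA, hintB, intervalIntegral.integral_zero, zero_add]
  · exact (intervalIntegral.continuous_parametric_intervalIntegral_of_continuous'
      hcA 0 m).intervalIntegrable _ _
  · exact (intervalIntegral.continuous_parametric_intervalIntegral_of_continuous'
      hcB 0 m).intervalIntegrable _ _

end frame

lemma frame_mem_leftSide (h0 : γ.curvature = 0) (z : ℝ × ℝ) :
    frame γ.start (Real.cos γ.angle) (Real.sin γ.angle) z ∈ γ.leftSide ↔ 0 < z.2 := by
  have hcs := Real.sin_sq_add_cos_sq γ.angle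
  simp only [leftSide, mem_ofPred_eq, h0, zero_mul, inner_leftNormal_zero]
  simp only [frame, add_sub_cancel_left, toPlane_zero, toPlane_one]
  generalize Real.cos γ.angle = c at *
  generalize Real.sin γ.angle = s at *
  have : 2 * (-s * (c * z.1 + -s * z.2) + c * (s * z.1 + c * z.2)) = 2 * z.2 := by
    linear_combination 2 * z.2 * hcs
  rw [this]
  constructor <;> intro h <;> linarith

lemma point_eq_frame (h0 : γ.curvature = 0) (t : ℝ) :
    γ.point t = frame γ.start (Real.cos γ.angle) (Real.sin γ.angle) (t, 0) := by
  rw [point_eq, reach_zero_curvature _ h0, h0]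
  ext i; fin_cases i
  · simp [unitVec, frame, mul_comm]
  · simp [unitVec, frame, mul_comm]

/-- The divergence theorem on a half-plane. -/
lemma integral_leftSide_of_eq_zero (h0 : γ.curvature = 0) {X : Plane → Plane}
    (hX : ContDiff ℝ 1 X) (hc : HasCompactSupport X) :
    ∃ M : ℝ, ∀ m ≥ M, ∫ x in γ.leftSide, planeDiv X x
      = ∫ t in (-m)..m, -inner ℝ (γ.leftNormal t) (X (γ.point t)) := by
  obtain ⟨M, hM⟩ := exists_bound_of_hasCompactSupport hc γ.start
  refine ⟨max M 0, fun m hm => ?_⟩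
  have hm0 : 0 ≤ m := (le_max_right _ _).trans hm
  have hmM := hM m ((le_max_left _ _).trans hm)
  have hcs : Real.sin γ.angle ^ 2 + Real.cos γ.angle ^ 2 = 1 := Real.sin_sq_add_cos_sq _
  have hside := γ.frame_mem_leftSide h0
  have hpt := γ.point_eq_frame h0
  have hflux : ∀ t, -inner ℝ (γ.leftNormal t) (X (γ.point t))
      = Real.sin γ.angle * X (γ.point t) 0 - Real.cos γ.angle * X (γ.point t) 1 := by
    intro t
    rw [neg_inner_leftNormal, tangent_eq, h0, zero_mul, add_zero]
    simp only [unitVec, toPlane_zero, toPlane_one]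
    ring
  simp only [hflux]
  simp only [hpt]
  obtain ⟨G, hG⟩ : ∃ G, G = frame γ.start (Real.cos γ.angle) (Real.sin γ.angle) := ⟨_, rfl⟩
  have hout : ∀ z : ℝ × ℝ, m ≤ |z.1| ∨ m ≤ |z.2| → G z ∉ tsupport X := by
    intro z hz
    apply hmM
    apply le_of_sq_le_sq _ (norm_nonneg _)
    rw [hG, norm_frame_sub hcs]
    rcases hz with hz | hz
    · have := pow_le_pow_left₀ hm0 hz 2
      rw [sq_abs] at this; nlinarith
    · have := pow_le_pow_left₀ hm0 hz 2
      rw [sq_abs] at this; nlinarith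
  rw [← hG] at hside
  have hrect := integral_frame_rectangle (p := γ.start) hcs hX hm0 (by
    rw [← hG]; exact fun z hz => image_eq_zero_of_notMem_tsupport (hout z hz))
  rw [← hG] at hrect ⊢
  rw [← hrect]
  apply setIntegral_eq_of_subset_of_forall_sdiff_eq_zero γ.measurableSet_leftSide
  · rintro _ ⟨z, ⟨_, hz⟩, rfl⟩
    exact (hside z).2 hz.1
  · rintro x ⟨hx, hx'⟩
    obtain ⟨z, rfl⟩ : ∃ z, G z = x := by rw [hG]; exact frame_surjective hcs x
    rw [hside] at hx
    have : m ≤ |z.1| ∨ m ≤ |z.2| := by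
      by_contra! hcon
      apply hx'
      rw [abs_lt, abs_lt] at hcon
      exact ⟨z, ⟨hcon.1, hx, hcon.2.2⟩, rfl⟩
    have h2 : fderiv ℝ X (G z) = 0 := image_eq_zero_of_notMem_tsupport fun h =>
      hout z this (tsupport_fderiv_subset ℝ h)
    simp [planeDiv, h2]

end CircularArc

/-! ### Localizing the divergence theorem to an arc; extending its normal -/

namespace CircularArc

variable (γ : CircularArc)

/-- The extension of the left normal to an affine field on the plane. -/
def normalField (x : Plane) : Plane := γ.leftNormal 0 - γ.curvature • (x - γ.start)

/-- Along the arc the left normal has derivative `-κ` times the tangent, so the normal plus `κ`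
times the position is constant. -/
lemma leftNormal_eq_normalField (t : ℝ) : γ.leftNormal t = γ.normalField (γ.point t) := by
  rw [normalField, point_eq, add_sub_cancel_left, leftNormal_eq, leftNormal_eq]
  by_cases h0 : γ.curvature = 0
  · simp [h0]
  · have hs := Real.sin_sub_sin (γ.angle + γ.curvature * t) γ.angle
    have hc := Real.cos_sub_cos (γ.angle + γ.curvature * t) γ.angle
    have e1 : (γ.angle + γ.curvature * t - γ.angle) / 2 = γ.curvature * t / 2 := by ring
    have e2 : (γ.angle + γ.curvature * t + γ.angle) / 2 = γ.angle + γ.curvature * t / 2 := by ring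
    rw [e1, e2] at hs hc
    rw [reach_of_ne _ h0, smul_smul, ← mul_assoc, mul_div_cancel₀ _ h0]
    ext i; fin_cases i
    · simp only [unitVec, Fin.zero_eta, toPlane_zero, PiLp.sub_apply, PiLp.smul_apply,
        smul_eq_mul, mul_zero, add_zero]
      linarith
    · simp only [unitVec, Fin.mk_one, toPlane_one, PiLp.sub_apply, PiLp.smul_apply,
        smul_eq_mul, mul_zero, add_zero]
      linarith

lemma norm_leftNormal (t : ℝ) : ‖γ.leftNormal t‖ = 1 := by
  have h := toPlane_norm_sq
    (-Real.sin (γ.angle + γ.curvature * t), Real.cos (γ.angle + γ.curvature * t))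
  rw [← leftNormal_eq, neg_sq, Real.sin_sq_add_cos_sq] at h
  exact (pow_eq_one_iff_of_nonneg (norm_nonneg _) two_ne_zero).1 h

lemma point_ne_point {t t' : ℝ} (h0 : γ.curvature ≠ 0) (hne : t ≠ t')
    (h : |γ.curvature| * |t - t'| < 2 * Real.pi) : γ.point t ≠ γ.point t' := by
  intro heq
  have hN : γ.leftNormal t = γ.leftNormal t' := by
    rw [leftNormal_eq_normalField, leftNormal_eq_normalField, heq]
  have hu : unitVec (γ.angle + γ.curvature * t) = unitVec (γ.angle + γ.curvature * t') := by
    have h1 := congrArg (fun x : Plane => x 0) hN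
    have h2 := congrArg (fun x : Plane => x 1) hN
    simp only [leftNormal_eq, toPlane_zero, toPlane_one, neg_inj] at h1 h2
    rw [unitVec, unitVec, h1, h2]
  have := unitVec_injective_of_lt hu (by
    have e : γ.angle + γ.curvature * t - (γ.angle + γ.curvature * t') = γ.curvature * (t - t') := by
      ring
    rwa [e, abs_mul])
  have h2 : γ.curvature * (t - t') = 0 := by linarith
  rcases mul_eq_zero.1 h2 with h3 | h3
  · exact h0 h3
  · exact hne (by linarith)

lemma isometry_point (h0 : γ.curvature = 0) : Isometry γ.point := by
  apply Isometry.of_dist_eq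
  intro t t'
  rw [point_eq, point_eq, reach_zero_curvature _ h0, reach_zero_curvature _ h0, h0, dist_add_left]
  simp only [zero_mul, zero_div, add_zero]
  rw [dist_eq_norm, ← sub_smul, norm_smul, norm_unitVec, mul_one, Real.dist_eq, Real.norm_eq_abs]

/-- The divergence theorem for fields that vanish on the rest of the carrying circle or line. -/
lemma exists_isClosed_integral_leftSide : ∃ Z : Set Plane, IsClosed Z ∧ Disjoint γ.openCarrier Z ∧
    ∀ X : Plane → Plane, ContDiff ℝ 1 X → HasCompactSupport X → (∀ x ∈ Z, X x = 0) →
      ∫ x in γ.leftSide, planeDiv X x = γ.flux γ.length X := by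
  have hL := γ.length_pos
  have hlt := γ.not_closed
  have hNc := γ.continuous_leftNormal
  have hpc := γ.continuous_point
  have hi : ∀ X : Plane → Plane, Continuous X → ∀ a b : ℝ, IntervalIntegrable
      (fun t => -inner ℝ (γ.leftNormal t) (X (γ.point t))) volume a b := fun X hX a b =>
    Continuous.intervalIntegrable (by fun_prop) a b
  by_cases h0 : γ.curvature = 0
  · refine ⟨γ.point '' (Iic 0 ∪ Ici γ.length),
      (γ.isometry_point h0).isClosedEmbedding.isClosedMap _ (isClosed_Iic.union isClosed_Ici), ?_, ?_⟩
    · rw [openCarrier, disjoint_image_iff (γ.isometry_point h0).injective, disjoint_left]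
      rintro t ⟨h1, h2⟩ (h3 | h3)
      · exact absurd h3 (not_le.2 h1)
      · exact absurd h3 (not_le.2 h2)
    · intro X hX hc hZ
      obtain ⟨M, hM⟩ := γ.integral_leftSide_of_eq_zero h0 hX hc
      set m := max (max M γ.length) 0 with hm
      have hmL : γ.length ≤ m := (le_max_right _ _).trans (le_max_left _ _)
      rw [hM m ((le_max_left _ _).trans (le_max_left _ _)), flux]
      have hz : ∀ a b : ℝ, (∀ t ∈ uIcc a b, t ∈ Iic 0 ∪ Ici γ.length) →
          ∫ t in a..b, -inner ℝ (γ.leftNormal t) (X (γ.point t)) = 0 := by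
        intro a b hab
        rw [intervalIntegral.integral_congr (g := fun _ => 0)]
        · simp
        · intro t ht
          simp [hZ _ (mem_image_of_mem _ (hab t ht))]
      rw [← intervalIntegral.integral_add_adjacent_intervals (hi X hX.continuous (-m) 0)
        (hi X hX.continuous 0 m), ← intervalIntegral.integral_add_adjacent_intervals
        (hi X hX.continuous 0 γ.length) (hi X hX.continuous γ.length m), hz (-m) 0, hz γ.length m]
      · simp
      · intro t ht
        rw [uIcc_of_le hmL] at ht
        exact Or.inr ht.1
      · intro t ht
        rw [uIcc_of_le (by linarith)] at ht
        exact Or.inl ht.2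
  · have hκ : 0 < |γ.curvature| := abs_pos.2 h0
    set T := 2 * Real.pi / |γ.curvature| with hT
    have hκT : |γ.curvature| * T = 2 * Real.pi := mul_div_cancel₀ _ hκ.ne'
    have hLT : γ.length ≤ T := by
      rw [hT, le_div_iff₀ hκ]; linarith
    -- At `T` the circle has closed up, so this closed set contains both endpoints of the arc
    -- together with the rest of the circle.
    refine ⟨γ.point '' Icc γ.length T, (isCompact_Icc.image hpc).isClosed, ?_, ?_⟩
    · rw [openCarrier, disjoint_left]
      rintro _ ⟨t, ⟨ht0, htL⟩, rfl⟩ ⟨t', ⟨htL', htT'⟩, h⟩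
      refine γ.point_ne_point h0 (t := t) (t' := t') (by linarith) ?_ h.symm
      rw [← hκT]
      gcongr
      rw [abs_lt]; constructor <;> linarith
    · intro X hX hc hZ
      rw [γ.integral_leftSide_of_ne_zero h0 hX hc, flux, flux,
        ← intervalIntegral.integral_add_adjacent_intervals
        (hi X hX.continuous 0 γ.length) (hi X hX.continuous γ.length T)]
      rw [intervalIntegral.integral_congr (a := γ.length) (g := fun _ => 0)]
      · simp
      · intro t ht
        rw [uIcc_of_le hLT] at ht
        simp [hZ _ (mem_image_of_mem _ ht)]

/-- A smooth field of length at most one that is the outward normal on the arc. -/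
def outerField (x : Plane) : Plane := -((2 / (1 + ‖γ.normalField x‖ ^ 2)) • γ.normalField x)

lemma contDiff_outerField : ContDiff ℝ ∞ γ.outerField := by
  have h1 : ContDiff ℝ ∞ γ.normalField :=
    contDiff_const.sub ((contDiff_id.sub contDiff_const).const_smul γ.curvature)
  have h2 : ContDiff ℝ ∞ fun x => ‖γ.normalField x‖ ^ 2 := h1.norm_sq ℝ
  exact ((contDiff_const.div (contDiff_const.add h2) fun x => by positivity).smul h1).neg

lemma norm_outerField_le (x : Plane) : ‖γ.outerField x‖ ≤ 1 := by
  rw [outerField, norm_neg, norm_smul, Real.norm_of_nonneg (by positivity), div_mul_eq_mul_div,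
    div_le_one (by positivity)]
  nlinarith [sq_nonneg (‖γ.normalField x‖ - 1)]

lemma outerField_point (t : ℝ) : γ.outerField (γ.point t) = -γ.leftNormal t := by
  rw [outerField, ← leftNormal_eq_normalField, norm_leftNormal]
  norm_num

end CircularArc

/-! ### A set pays the full length of its boundary arcs -/

lemma exists_smooth_cutoff {K O : Set Plane} (hK : IsCompact K) (hO : IsOpen O) (hKO : K ⊆ O) :
    ∃ χ : Plane → ℝ, ContDiff ℝ ∞ χ ∧ HasCompactSupport χ ∧ tsupport χ ⊆ O ∧
      (∀ x ∈ K, χ x = 1) ∧ ∀ x, 0 ≤ χ x ∧ χ x ≤ 1 := by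
  obtain ⟨K', hK', hKK', hK'O⟩ := exists_compact_between hK hO hKO
  obtain ⟨f, hf0, hf1, hf⟩ := exists_contMDiffMap_zero_one_of_isClosed (modelWithCornersSelf ℝ Plane)
    (n := ⊤) (isOpen_interior (s := K')).isClosed_compl hK.isClosed
    (disjoint_left.2 fun x hx hxK => hx (hKK' hxK))
  have hsupp : tsupport f ⊆ K' := by
    apply closure_minimal _ hK'.isClosed
    intro x hx
    by_contra h
    exact hx (hf0 fun h' => h (interior_subset h'))
  exact ⟨f, f.contMDiff.contDiff, hK'.of_isClosed_subset (isClosed_tsupport _) hsupp,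
    hsupp.trans hK'O, fun x hx => hf1 hx, fun x => ⟨(hf x).1, (hf x).2⟩⟩

lemma planeDiv_add_sum {ι : Type*} (s : Finset ι) {φ : Plane → Plane} {X : ι → Plane → Plane}
    (hφ : ContDiff ℝ 1 φ) (hX : ∀ i, ContDiff ℝ 1 (X i)) (x : Plane) :
    planeDiv (fun x => φ x + ∑ i ∈ s, X i x) x = planeDiv φ x + ∑ i ∈ s, planeDiv (X i) x := by
  have hd : ∀ i, DifferentiableAt ℝ (X i) x := fun i => (hX i).differentiable one_ne_zero x
  have h : fderiv ℝ (fun x => φ x + ∑ i ∈ s, X i x) x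
      = fderiv ℝ φ x + ∑ i ∈ s, fderiv ℝ (X i) x :=
    ((hφ.differentiable one_ne_zero x).hasFDerivAt.add
      (HasFDerivAt.fun_sum fun i _ => (hd i).hasFDerivAt)).fderiv
  simp only [planeDiv, h, Fin.sum_univ_two, _root_.add_apply, PiLp.add_apply]
  simp only [_root_.sum_apply, WithLp.ofLp_sum, Finset.sum_apply, Finset.sum_add_distrib]
  ring

lemma integral_le_perimeter {E : Set Plane} (hP : perimeter E < ⊤) {φ : Plane → Plane}
    (hφ : φ ∈ perimeterTestFields) : ∫ x in E, planeDiv φ x ≤ (perimeter E).toReal := by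
  rw [← ENNReal.ofReal_le_iff_le_toReal hP.ne]
  exact le_iSup₂ (f := fun φ (_ : φ ∈ perimeterTestFields) =>
    ENNReal.ofReal (∫ x in E, planeDiv φ x)) φ hφ

lemma setIntegral_eq_of_ae_eq_on {E F V : Set Plane} (hE : MeasurableSet E) (hF : MeasurableSet F)
    (hV : MeasurableSet V) (h : E =ᵐ[volume.restrict V] F) {f : Plane → ℝ}
    (hf : ∀ x ∉ V, f x = 0) : ∫ x in E, f x = ∫ x in F, f x := by
  rw [← integral_indicator hE, ← integral_indicator hF]
  apply integral_congr_ae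
  have h' := (ae_restrict_iff' hV).1 h
  filter_upwards [h'] with x hx
  by_cases hxV : x ∈ V
  · have : x ∈ E ↔ x ∈ F := iff_of_eq (hx hxV)
    by_cases hxE : x ∈ E
    · rw [indicator_of_mem hxE, indicator_of_mem (this.1 hxE)]
    · rw [indicator_of_notMem hxE, indicator_of_notMem (fun h => hxE (this.2 h))]
  · simp [indicator, hf x hxV]

lemma exists_open_ae_eq_leftSide {γ : CircularArc} {E K : Set Plane} (hγ : γ.IsBoundaryArc E)
    (hK : IsCompact K) (hKγ : K ⊆ γ.openCarrier) :
    ∃ V, IsOpen V ∧ K ⊆ V ∧ E =ᵐ[volume.restrict V] γ.leftSide := by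
  choose! δ hδ0 hδ using hγ.2
  obtain ⟨t, ht, hKt⟩ := hK.elim_nhds_subcover (fun x => Metric.ball x (δ x))
    fun x hx => Metric.ball_mem_nhds x (hδ0 x (hKγ hx))
  refine ⟨⋃ x ∈ t, Metric.ball x (δ x), isOpen_biUnion fun _ _ => Metric.isOpen_ball, hKt, ?_⟩
  exact (ae_restrict_biUnion_finset_iff _ t _).2 fun x hx => hδ x (hKγ (ht x hx))

namespace CircularArc

lemma image_Icc_subset_openCarrier (γ : CircularArc) {δ : ℝ} (hδ : 0 < δ) :
    γ.point '' Icc δ (γ.length - δ) ⊆ γ.openCarrier :=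
  image_mono fun t ht => ⟨by linarith [ht.1], by linarith [ht.2]⟩

variable {γ : CircularArc}

/-- Replacing a test field by the outward normal near a compact portion of a boundary arc. -/
lemma exists_cutoff_flux {E W : Set Plane} {δ : ℝ} {φ : Plane → Plane} (hE : MeasurableSet E)
    (hγ : γ.IsBoundaryArc E) (hδ : 0 < δ) (hδL : 2 * δ < γ.length) (hW : IsOpen W)
    (hKW : γ.point '' Icc δ (γ.length - δ) ⊆ W) (hφ : φ ∈ perimeterTestFields) :
    ∃ χ : Plane → ℝ, ContDiff ℝ ∞ χ ∧ HasCompactSupport χ ∧ Function.support χ ⊆ W ∧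
      (∀ x, 0 ≤ χ x ∧ χ x ≤ 1) ∧
      γ.length - γ.flux γ.length φ - 4 * δ
        ≤ ∫ x in E, planeDiv (fun x => χ x • (γ.outerField x - φ x)) x := by
  have hL := γ.length_pos
  have hK : IsCompact (γ.point '' Icc δ (γ.length - δ)) := isCompact_Icc.image γ.continuous_point
  have hKγ : γ.point '' Icc δ (γ.length - δ) ⊆ γ.openCarrier :=
    γ.image_Icc_subset_openCarrier hδ
  obtain ⟨V, hV, hKV, hVE⟩ := exists_open_ae_eq_leftSide hγ hK hKγ
  obtain ⟨Z, hZ, hZγ, hZX⟩ := γ.exists_isClosed_integral_leftSide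
  -- The support lies in `V`, where `E` is the left side of the arc, in `W`, which keeps different
  -- arcs apart, and off `Z`, where the carrying curve continues beyond the arc.
  obtain ⟨χ, hχ, hχc, hχO, hχ1, hχ01⟩ := exists_smooth_cutoff hK
    ((hV.inter hW).inter hZ.isOpen_compl) (subset_inter (subset_inter hKV hKW)
      fun x hx => disjoint_left.1 hZγ (hKγ hx))
  have hsub : tsupport (fun x => χ x • (γ.outerField x - φ x)) ⊆ tsupport χ :=
    tsupport_smul_subset_left χ fun x => γ.outerField x - φ x
  have hX : ContDiff ℝ 1 fun x => χ x • (γ.outerField x - φ x) :=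
    (hχ.smul (γ.contDiff_outerField.sub hφ.1)).of_le (by simp)
  refine ⟨χ, hχ, hχc, fun x hx => (hχO (subset_tsupport _ hx)).1.2, hχ01, ?_⟩
  rw [setIntegral_eq_of_ae_eq_on hE γ.measurableSet_leftSide hV.measurableSet hVE fun x hx => ?_,
    hZX _ hX (hχc.of_isClosed_subset (isClosed_tsupport _) hsub) fun x hx => ?_]
  · have hNc := γ.continuous_leftNormal
    have hpc := γ.continuous_point
    have hφc := hφ.1.continuous
    have hχc := hχ.continuous
    -- The pointwise defect from the full normal flux. It vanishes where `χ = 1` and is at most `2`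
    -- on the two end pieces of length `δ`, whence the error `4 * δ`.
    set h : ℝ → ℝ := fun t => (1 - χ (γ.point t)) * (1 + inner ℝ (γ.leftNormal t) (φ (γ.point t)))
      with hh
    have hhc : Continuous h := by fun_prop
    have hhi : ∀ a b, IntervalIntegrable h volume a b := fun a b => hhc.intervalIntegrable a b
    have habs : ∀ t, |inner ℝ (γ.leftNormal t) (φ (γ.point t))| ≤ 1 := fun t => by
      refine (abs_real_inner_le_norm _ _).trans ?_
      rw [norm_leftNormal, one_mul]
      exact hφ.2.2 _
    have h2 : ∀ t, h t ≤ 2 := fun t => by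
      have h1 := abs_le.1 (habs t)
      have h3 := hχ01 (γ.point t)
      simp only [hh]
      nlinarith
    have hdiff : γ.length - γ.flux γ.length φ
        - γ.flux γ.length (fun x => χ x • (γ.outerField x - φ x)) = ∫ t in 0..γ.length, h t := by
      have e : γ.length = ∫ t in 0..γ.length, (1 : ℝ) := by simp
      conv_lhs => enter [1, 1]; rw [e]
      rw [flux, flux, ← intervalIntegral.integral_sub (by simp)
        (Continuous.intervalIntegrable (by fun_prop) _ _),
        ← intervalIntegral.integral_sub (Continuous.intervalIntegrable (by fun_prop) _ _)
        (Continuous.intervalIntegrable ?_ _ _)]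
      · refine intervalIntegral.integral_congr fun t _ => ?_
        simp only [hh, outerField_point, inner_smul_right, inner_sub_right, inner_neg_right,
          real_inner_self_eq_norm_sq, norm_leftNormal]
        ring
      · exact (hNc.inner (hX.continuous.comp hpc)).neg
    have hsplit : ∫ t in 0..γ.length, h t = (∫ t in 0..δ, h t)
        + (∫ t in δ..(γ.length - δ), h t) + ∫ t in (γ.length - δ)..γ.length, h t := by
      rw [intervalIntegral.integral_add_adjacent_intervals (hhi _ _) (hhi _ _),
        intervalIntegral.integral_add_adjacent_intervals (hhi _ _) (hhi _ _)]
    have hb : ∀ a b, a ≤ b → ∫ t in a..b, h t ≤ 2 * (b - a) := fun a b hab => by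
      have := intervalIntegral.integral_mono_on hab (hhi a b)
        (intervalIntegrable_const (c := (2 : ℝ))) fun t _ => h2 t
      rw [intervalIntegral.integral_const, smul_eq_mul] at this
      linarith
    have hmid : ∫ t in δ..(γ.length - δ), h t = 0 := by
      rw [intervalIntegral.integral_congr (g := fun _ => 0)]
      · simp
      · intro t ht
        rw [uIcc_of_le (by linarith)] at ht
        simp [hh, hχ1 _ (mem_image_of_mem _ ht)]
    linarith [hb 0 δ hδ.le, hb (γ.length - δ) γ.length (by linarith)]
  · have : χ x = 0 := by
      by_contra h0
      exact (hχO (subset_tsupport _ h0)).2 hx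
    simp [this]
  · have : x ∉ tsupport fun x => χ x • (γ.outerField x - φ x) :=
      fun h => hx (hχO (hsub h)).1.1
    simp [planeDiv, fderiv_of_notMem_tsupport (𝕜 := ℝ) this]

end CircularArc

lemma norm_add_smul_sub_le_one {F : Type*} [NormedAddCommGroup F] [NormedSpace ℝ F] {a b : F}
    (ha : ‖a‖ ≤ 1) (hb : ‖b‖ ≤ 1) {c : ℝ} (hc : 0 ≤ c ∧ c ≤ 1) : ‖a + c • (b - a)‖ ≤ 1 := by
  have e : a + c • (b - a) = (1 - c) • a + c • b := by module
  rw [e]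
  refine (norm_add_le _ _).trans ?_
  rw [norm_smul, norm_smul, Real.norm_of_nonneg hc.1, Real.norm_of_nonneg (by linarith [hc.2])]
  nlinarith [hc.1, hc.2]

lemma exists_disjoint_open_supersets {ι : Type*} [Finite ι] {K : ι → Set Plane}
    (hK : ∀ i, IsCompact (K i)) (hd : ∀ i j, i ≠ j → Disjoint (K i) (K j)) :
    ∃ W : ι → Set Plane, (∀ i, IsOpen (W i)) ∧ (∀ i, K i ⊆ W i) ∧
      ∀ i j, i ≠ j → Disjoint (W i) (W j) := by
  have hp : Pairwise (Function.onFun Disjoint fun i => nhdsSet (K i)) := fun i j hij =>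
    separatedNhds_iff_disjoint.1
      (SeparatedNhds.of_isCompact_isCompact (hK i) (hK j) (hd i j hij))
  obtain ⟨S, hS, hSd⟩ := hp.exists_mem_filter_of_disjoint
  exact ⟨fun i => interior (S i), fun i => isOpen_interior,
    fun i => subset_interior_iff_mem_nhdsSet.2 (hS i),
    fun i j hij => (hSd hij).mono interior_subset interior_subset⟩

/-- Along its boundary arcs a set pays the full length instead of the flux of a test field. -/
theorem integral_add_sum_length_sub_flux_le {ι : Type*} [Fintype ι] {E : Set Plane}
    (hE : MeasurableSet E) (hP : perimeter E < ⊤) {γ : ι → CircularArc}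
    (hγ : ∀ i, (γ i).IsBoundaryArc E)
    (hd : ∀ i j, i ≠ j → Disjoint (γ i).openCarrier (γ j).openCarrier)
    {φ : Plane → Plane} (hφ : φ ∈ perimeterTestFields) :
    (∫ x in E, planeDiv φ x) + ∑ i, ((γ i).length - (γ i).flux (γ i).length φ)
      ≤ (perimeter E).toReal := by
  have key : ∀ δ : ℝ, 0 < δ → (∀ i, 2 * δ < (γ i).length) →
      (∫ x in E, planeDiv φ x) + ∑ i, ((γ i).length - (γ i).flux (γ i).length φ)
        ≤ (perimeter E).toReal + 4 * Fintype.card ι * δ := by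
    intro δ hδ hδL
    obtain ⟨W, hW, hKW, hWd⟩ := exists_disjoint_open_supersets
      (K := fun i => (γ i).point '' Icc δ ((γ i).length - δ))
      (fun i => isCompact_Icc.image (γ i).continuous_point)
      (fun i j hij => (hd i j hij).mono ((γ i).image_Icc_subset_openCarrier hδ)
        ((γ j).image_Icc_subset_openCarrier hδ))
    choose χ hχ hχc hχW hχ01 hflux using fun i =>
      CircularArc.exists_cutoff_flux hE (hγ i) hδ (hδL i) (hW i) (hKW i) hφ
    have hX : ∀ i, ContDiff ℝ ∞ fun x => χ i x • ((γ i).outerField x - φ x) :=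
      fun i => (hχ i).smul ((γ i).contDiff_outerField.sub hφ.1)
    -- The supports of the `χ i` are disjoint, so at each point at most one correction acts, and it
    -- forms a convex combination of two vectors of length at most one.
    have hψ : (fun x => φ x + ∑ i, χ i x • ((γ i).outerField x - φ x)) ∈ perimeterTestFields := by
      refine ⟨hφ.1.add (ContDiff.sum fun i _ => hX i), ?_, fun x => ?_⟩
      · apply HasCompactSupport.intro
          (hφ.2.1.isCompact.union (isCompact_iUnion fun i => (hχc i).isCompact))
        intro x hx
        simp only [mem_union, mem_iUnion, not_or, not_exists] at hx
        rw [image_eq_zero_of_notMem_tsupport hx.1, zero_add]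
        refine Finset.sum_eq_zero fun i _ => ?_
        rw [image_eq_zero_of_notMem_tsupport (hx.2 i), zero_smul]
      · by_cases h : ∃ i, χ i x ≠ 0
        · obtain ⟨i, hi⟩ := h
          beta_reduce
          rw [Finset.sum_eq_single i]
          · exact norm_add_smul_sub_le_one (hφ.2.2 x) ((γ i).norm_outerField_le x) (hχ01 i x)
          · intro j _ hji
            have : χ j x = 0 := by
              by_contra hj
              exact disjoint_left.1 (hWd j i hji) (hχW j hj) (hχW i hi)
            rw [this, zero_smul]
          · simp
        · push Not at h
          simpa [h] using hφ.2.2 x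
    have h1 := integral_le_perimeter hP hψ
    have hdiv : ∀ i, Integrable (planeDiv fun x => χ i x • ((γ i).outerField x - φ x))
        (volume.restrict E) := fun i =>
      ((continuous_planeDiv ((hX i).of_le (by simp))).integrable_of_hasCompactSupport
        (hasCompactSupport_planeDiv (hχc i).smul_right)).integrableOn
    simp_rw [planeDiv_add_sum Finset.univ (hφ.1.of_le (by simp : (1 : WithTop ℕ∞) ≤ ∞))
      (fun i => (hX i).of_le (by simp : (1 : WithTop ℕ∞) ≤ ∞))] at h1
    rw [integral_add, integral_finsetSum _ fun i _ => hdiv i] at h1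
    · have h2 := Finset.sum_le_sum fun i (_ : i ∈ Finset.univ) => hflux i
      rw [Finset.sum_sub_distrib, Finset.sum_const, Finset.card_univ, nsmul_eq_mul] at h2
      linarith
    · exact ((continuous_planeDiv (hφ.1.of_le (by simp))).integrable_of_hasCompactSupport
        (hasCompactSupport_planeDiv hφ.2.1)).integrableOn
    · exact integrable_finsetSum _ fun i _ => hdiv i
  have hpos : ∃ δ₀ : ℝ, 0 < δ₀ ∧ ∀ i, δ₀ ≤ (γ i).length := by
    rcases isEmpty_or_nonempty ι with h | h
    · exact ⟨1, one_pos, fun i => h.elim i⟩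
    · obtain ⟨i, hi⟩ := Finite.exists_min fun i => (γ i).length
      exact ⟨_, (γ i).length_pos, hi⟩
  obtain ⟨δ₀, hδ₀, hδ₀L⟩ := hpos
  refine le_of_forall_pos_le_add fun ε hε => ?_
  set n : ℝ := (Fintype.card ι : ℝ)
  have hn : 0 ≤ n := Nat.cast_nonneg _
  refine (key (min (δ₀ / 3) (ε / (4 * n + 1))) (by positivity) fun i => ?_).trans ?_
  · linarith [min_le_left (δ₀ / 3) (ε / (4 * n + 1)), hδ₀L i]
  · have h1 := min_le_right (δ₀ / 3) (ε / (4 * n + 1))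
    rw [le_div_iff₀ (by positivity)] at h1
    have h2 : 0 < min (δ₀ / 3) (ε / (4 * n + 1)) := by positivity
    nlinarith

/-! ### The isoperimetric inequality after replacing arcs over their chords -/

namespace CircularArc

/-- The length of the chord of an arc of curvature `κ` and length `L`. -/
def chordLength (κ L : ℝ) : ℝ := if κ = 0 then L else 2 / κ * Real.sin (κ * L / 2)

variable (γ : CircularArc)

lemma chord_eq_chordLength : γ.chord = chordLength γ.curvature γ.length := γ.chord_eq

/-- The arc of curvature `κ` and length `L` that leaves the starting point of `γ` symmetrically to
its chord. -/
def recurve (κ L : ℝ) (hL : 0 < L) (h : |κ| * L < 2 * Real.pi) : CircularArc :=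
  ⟨γ.start, γ.angle + γ.curvature * γ.length / 2 - κ * L / 2, κ, L, hL, h⟩

lemma recurve_point {κ L : ℝ} (hL : 0 < L) (h : |κ| * L < 2 * Real.pi)
    (hc : chordLength κ L = γ.chord) : (γ.recurve κ L hL h).point L = γ.point γ.length := by
  rw [point_eq, point_eq γ, ← chord_eq, ← hc]
  show γ.start + chordLength κ L • unitVec (γ.angle + γ.curvature * γ.length / 2 - κ * L / 2
    + κ * L / 2) = _
  rw [sub_add_cancel]

lemma flux_le (γ : CircularArc) {φ : Plane → Plane} (hφ : φ ∈ perimeterTestFields) :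
    γ.flux γ.length φ ≤ γ.length := by
  have hNc := γ.continuous_leftNormal
  have hpc := γ.continuous_point
  have hφc := hφ.1.continuous
  have h := intervalIntegral.integral_mono_on γ.length_pos.le
    (f := fun t => -inner ℝ (γ.leftNormal t) (φ (γ.point t))) (g := fun _ => (1 : ℝ))
    (μ := volume) (Continuous.intervalIntegrable (by fun_prop) _ _) intervalIntegrable_const
    fun t _ => by
      refine (neg_le_abs _).trans ((abs_real_inner_le_norm _ _).trans ?_)
      rw [norm_leftNormal, one_mul]
      exact hφ.2.2 _
  simpa [flux] using h

end CircularArc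

open CircularArc in
/-- The isoperimetric inequality for a set whose boundary arcs are replaced by arcs with the same
chords, where the new curve may overlap itself. -/
theorem isoperimetric_recurve {ι : Type*} [Fintype ι] {E : Set Plane}
    (hE : MeasurableSet E) (hEfin : volume E ≠ ⊤) (hP : perimeter E < ⊤) {γ : ι → CircularArc}
    (hγ : ∀ i, (γ i).IsBoundaryArc E)
    (hd : ∀ i j, i ≠ j → Disjoint (γ i).openCarrier (γ j).openCarrier) {κ L : ι → ℝ}
    (hL : ∀ i, 0 < L i) (hκL : ∀ i, |κ i| * L i < 2 * Real.pi)
    (hc : ∀ i, chordLength (κ i) (L i) = (γ i).chord) :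
    √(4 * Real.pi * |area E + ∑ i, (segmentArea (κ i) (L i)
        - segmentArea (γ i).curvature (γ i).length)|) + ∑ i, ((γ i).length - L i)
      ≤ (perimeter E).toReal := by
  set γ' : ι → CircularArc := fun i => (γ i).recurve (κ i) (L i) (hL i) (hκL i) with hγ'
  have hcap : ∀ γ : CircularArc, Integrable (γ.capFun γ.length) := fun γ =>
    γ.integrable_capFun γ.length_pos.le γ.not_closed.le
  have hcapi : ∀ γ : CircularArc, ∫ x, γ.capFun γ.length x = segmentArea γ.curvature γ.length :=
    fun γ => γ.integral_capFun γ.length_pos.le γ.not_closed.le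
  -- The generalized indicator of the modified region: each old cap is removed and the new one
  -- inserted, with signs and multiplicities, so overlaps do no harm.
  set u : Plane → ℝ := fun x => E.indicator (fun _ => (1 : ℝ)) x
    + ∑ i, ((γ' i).capFun (γ' i).length x - (γ i).capFun (γ i).length x) with hu
  have h1 : Integrable (E.indicator fun _ => (1 : ℝ)) :=
    (integrable_indicator_iff hE).2 (integrableOn_const hEfin)
  have h2 : ∀ i, Integrable fun x => (γ' i).capFun (γ' i).length x - (γ i).capFun (γ i).length x :=
    fun i => (hcap _).sub (hcap _)
  have hui : Integrable u := h1.add (integrable_finsetSum _ fun i _ => h2 i)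
  have hint : ∫ x, u x = area E + ∑ i, (segmentArea (κ i) (L i)
      - segmentArea (γ i).curvature (γ i).length) := by
    rw [integral_add h1 (integrable_finsetSum _ fun i _ => h2 i),
      integral_finsetSum _ fun i _ => h2 i, integral_indicator hE]
    congr 1
    · simp [area, Measure.real]
    · refine Finset.sum_congr rfl fun i _ => ?_
      rw [integral_sub (hcap _) (hcap _), hcapi, hcapi]
      rfl
  rw [← hint, ← le_sub_iff_add_le]
  refine isoperimetric_of_integer_valued hui (fun x => ?_) fun φ hφ => ?_
  · have hz : ∀ i, ∃ k : ℤ, (γ' i).capFun (γ' i).length x - (γ i).capFun (γ i).length x = k := by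
      intro i
      obtain ⟨a, ha⟩ := (γ' i).capFun_integer (γ' i).length x
      obtain ⟨b, hb⟩ := (γ i).capFun_integer (γ i).length x
      exact ⟨a - b, by rw [ha, hb]; push_cast; ring⟩
    choose k hk using hz
    by_cases hx : x ∈ E
    · exact ⟨1 + ∑ i, k i, by simp [hu, hx, hk, -Finset.sum_sub_distrib]⟩
    · exact ⟨∑ i, k i, by simp [hu, hx, hk, -Finset.sum_sub_distrib]⟩
  · have hφ1 : ContDiff ℝ 1 φ := hφ.1.of_le (by simp)
    have hdc := continuous_planeDiv hφ1
    have hds := hasCompactSupport_planeDiv hφ.2.1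
    obtain ⟨M, hM⟩ := hds.exists_bound_of_continuous hdc
    have hmul : ∀ f : Plane → ℝ, Integrable f → Integrable fun x => f x * planeDiv φ x :=
      fun f hf => hf.mul_bdd (c := M) hdc.aestronglyMeasurable (Filter.Eventually.of_forall hM)
    have hflux : ∀ i, ∫ x, ((γ' i).capFun (γ' i).length x - (γ i).capFun (γ i).length x)
        * planeDiv φ x = (γ' i).flux (γ' i).length φ - (γ i).flux (γ i).length φ := by
      intro i
      simp_rw [sub_mul]
      rw [integral_sub (hmul _ (hcap _)) (hmul _ (hcap _)),
        integral_capFun_mul _ (γ' i).length_pos.le (γ' i).not_closed.le,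
        integral_capFun_mul _ (γ i).length_pos.le (γ i).not_closed.le,
        flux_eq _ (γ' i).length_pos.le (γ' i).not_closed.le hφ1,
        flux_eq _ (γ i).length_pos.le (γ i).not_closed.le hφ1]
      have e : (γ' i).point (γ' i).length = (γ i).point (γ i).length :=
        (γ i).recurve_point (hL i) (hκL i) (hc i)
      have e' : (γ' i).start = (γ i).start := rfl
      rw [e, e']
      ring
    have hsum : ∫ x, u x * planeDiv φ x = (∫ x in E, planeDiv φ x)
        + ∑ i, ((γ' i).flux (γ' i).length φ - (γ i).flux (γ i).length φ) := by
      simp_rw [hu, add_mul, Finset.sum_mul]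
      rw [integral_add (hmul _ h1) (integrable_finsetSum _ fun i _ => hmul _ (h2 i)),
        integral_finsetSum _ fun i _ => hmul _ (h2 i), ← integral_indicator hE]
      congr 1
      · refine integral_congr_ae (Filter.Eventually.of_forall fun x => ?_)
        by_cases hx : x ∈ E <;> simp [hx]
      · exact Finset.sum_congr rfl fun i _ => hflux i
    rw [hsum]
    -- The flux through the old arcs is exchanged for their length, and the flux through the new
    -- arcs is at most theirs; hence the variation of `u` is at most the perimeter plus `Σ (L i -
    -- length)`.
    have hcut := integral_add_sum_length_sub_flux_le hE hP hγ hd hφ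
    have hle : ∑ i, (γ' i).flux (γ' i).length φ ≤ ∑ i, L i :=
      Finset.sum_le_sum fun i _ => (γ' i).flux_le hφ
    simp only [Finset.sum_sub_distrib] at hcut ⊢
    linarith

/-- The perimeter is at least the total length of the boundary arcs. -/
theorem sum_length_le_perimeter {ι : Type*} [Fintype ι] {E : Set Plane}
    (hE : MeasurableSet E) (hP : perimeter E < ⊤) {γ : ι → CircularArc}
    (hγ : ∀ i, (γ i).IsBoundaryArc E)
    (hd : ∀ i j, i ≠ j → Disjoint (γ i).openCarrier (γ j).openCarrier) :
    ∑ i, (γ i).length ≤ (perimeter E).toReal := by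
  have h := integral_add_sum_length_sub_flux_le hE hP hγ hd zero_mem_perimeterTestFields
  simpa [planeDiv_zero, CircularArc.flux] using h

/-! ### Real inequalities: expansion of the radius and detachment of large caps -/

/-- After scaling this is `1 + z/2 - z²/2 ≤ √(1 + z)`. The coefficient `1/2` in place of Taylor's
`1/8` makes it hold down to `z = -1`, with equality there. -/
lemma add_sub_cube_le_sqrt {R y : ℝ} (hR : 0 < R) (hy : 0 ≤ R ^ 2 + y) :
    R + y / (2 * R) - y ^ 2 / (2 * R ^ 3) ≤ √(R ^ 2 + y) := by
  obtain ⟨z, rfl⟩ : ∃ z, y = z * R ^ 2 := ⟨y / R ^ 2, by field_simp⟩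
  have hz : 0 ≤ 1 + z := by
    have : 0 ≤ R ^ 2 * (1 + z) := by linarith
    exact nonneg_of_mul_nonneg_right this (by positivity)
  have e1 : R + z * R ^ 2 / (2 * R) - (z * R ^ 2) ^ 2 / (2 * R ^ 3)
      = R * (1 + z / 2 - z ^ 2 / 2) := by
    field_simp
  have e2 : √(R ^ 2 + z * R ^ 2) = R * √(1 + z) := by
    rw [show R ^ 2 + z * R ^ 2 = R ^ 2 * (1 + z) by ring, Real.sqrt_mul (by positivity),
      Real.sqrt_sq hR.le]
  rw [e1, e2]
  refine mul_le_mul_of_nonneg_left ?_ hR.le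
  rcases le_total z 2 with h | h
  · apply Real.le_sqrt_of_sq_le
    nlinarith [mul_nonneg (sq_nonneg z) (mul_nonneg hz (sub_nonneg.2 (h.trans (by norm_num :
      (2 : ℝ) ≤ 3))))]
  · refine le_trans ?_ (Real.sqrt_nonneg _)
    nlinarith

/-- Splitting a disk of radius `q` off a disk of radius `R` increases the sum of the radii, unless
`q` is close to `R`; small `q` is excluded by `r₀`. The absolute value allows for `q > R`, when a
negative area remains. -/
lemma half_min_le_add_sqrt_sub {q R r₀ : ℝ} (hr : r₀ ≤ q) (h0 : 0 < r₀) (hR : 0 ≤ R) :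
    min |q - R| r₀ / 2 ≤ q + √|R ^ 2 - q ^ 2| - R := by
  rcases le_total R q with h | h
  · have h1 := min_le_left |q - R| r₀
    rw [abs_of_nonneg (sub_nonneg.2 h)] at h1 ⊢
    have := Real.sqrt_nonneg |R ^ 2 - q ^ 2|
    linarith
  · have e : |q - R| = R - q := by rw [abs_sub_comm, abs_of_nonneg (by linarith)]
    rw [e, abs_of_nonneg (by nlinarith : 0 ≤ R ^ 2 - q ^ 2)]
    have h1 := min_le_left (R - q) r₀
    have h2 := min_le_right (R - q) r₀
    have h3 : 0 ≤ min (R - q) r₀ := le_min (by linarith) h0.le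
    have : R - q + min (R - q) r₀ / 2 ≤ √(R ^ 2 - q ^ 2) := by
      apply Real.le_sqrt_of_sq_le
      nlinarith
    linarith

/-- Several disks have a larger sum of radii than one disk of the same total area. Each merger saves
at least `r₀/2`, because `√(r² + q²) ≤ r + q - r₀/2` for `r, q ≥ r₀`. -/
lemma sqrt_sum_sq_le {ι : Type*} {r : ι → ℝ} {r₀ : ℝ} (h0 : 0 < r₀) {J : Finset ι}
    (hJ : J.Nonempty) (hr : ∀ i ∈ J, r₀ ≤ r i) :
    r₀ ≤ √(∑ i ∈ J, r i ^ 2) ∧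
      √(∑ i ∈ J, r i ^ 2) + ((J.card : ℝ) - 1) * (r₀ / 2) ≤ ∑ i ∈ J, r i := by
  induction hJ using Finset.Nonempty.cons_induction with
  | singleton a =>
    have ha := hr a (by simp)
    simp [Real.sqrt_sq (h0.le.trans ha), ha]
  | cons a s ha hs ih =>
    obtain ⟨h1, h2⟩ := ih fun i hi => hr i (Finset.mem_cons_of_mem hi)
    have hra := hr a (Finset.mem_cons_self a s)
    rw [Finset.sum_cons, Finset.sum_cons, Finset.card_cons]
    set q := √(∑ i ∈ s, r i ^ 2) with hq
    have hq2 : ∑ i ∈ s, r i ^ 2 = q ^ 2 :=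
      (Real.sq_sqrt (Finset.sum_nonneg fun i _ => sq_nonneg _)).symm
    rw [hq2]
    constructor
    · apply Real.le_sqrt_of_sq_le
      nlinarith
    · have : √(r a ^ 2 + q ^ 2) ≤ r a + q - r₀ / 2 := by
        rw [Real.sqrt_le_left (by linarith)]
        nlinarith
      push_cast
      linarith

/-- Detaching large circular caps: the alternatives `hF1` (keep the caps) and `hF2` (remove them)
together account for the curvature deviation of the caps. -/
lemma le_of_detach {ι : Type*} {r ℓ : ι → ℝ} {r₀ c R R₁ R₂ G : ℝ} (h0 : 0 < r₀) (hR : 0 < R)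
    (hR₁ : 0 ≤ R₁) (h12 : R₁ ≤ R₂) (hcR : c ≤ R) (hc : c ≤ r₀ / 4) (hc' : c * (1 / r₀ + 1 / R) ≤ 1)
    {J : Finset ι} (hr : ∀ i ∈ J, r₀ ≤ r i) (hℓ : ∀ i ∈ J, 0 < ℓ i) (hℓc : ∀ i ∈ J, ℓ i ≤ c)
    (hF1 : 2 * Real.pi * R₂ ≤ G)
    (hF2 : 2 * Real.pi * √|R₂ ^ 2 - ∑ i ∈ J, r i ^ 2|
      + ∑ i ∈ J, (2 * Real.pi * r i - Real.pi * ℓ i) ≤ G) :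
    2 * Real.pi * R₁ + ∑ i ∈ J, (ℓ i ^ 3 * (1 / r i - 1 / R) ^ 2 / 24 - ℓ i ^ 5 / (r₀ * R) ^ 2)
      - R ^ 3 / (r₀ * R) ^ 2 * (R₁ - R) ^ 2 ≤ G := by
  have hπ := Real.pi_gt_three
  have hC8 : 0 ≤ R ^ 3 / (r₀ * R) ^ 2 * (R₁ - R) ^ 2 := by positivity
  have hδ : ∀ i ∈ J, ℓ i ^ 3 * (1 / r i - 1 / R) ^ 2 / 24 ≤ ℓ i := by
    intro i hi
    have h1 := hr i hi
    have h2 := hℓ i hi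
    have h3 := hℓc i hi
    have h4 : |1 / r i - 1 / R| ≤ 1 / r₀ + 1 / R := by
      have h5 : 1 / r i ≤ 1 / r₀ := one_div_le_one_div_of_le h0 h1
      have h6 : 0 < 1 / r i := one_div_pos.2 (h0.trans_le h1)
      have h7 : 0 < 1 / R := by positivity
      rw [abs_le]; constructor <;> linarith
    have h5 : ℓ i * |1 / r i - 1 / R| ≤ 1 := (mul_le_mul h3 h4 (abs_nonneg _) (h2.le.trans h3)).trans hc'
    have h6 : (ℓ i * |1 / r i - 1 / R|) ^ 2 ≤ 1 := pow_le_one₀ (by positivity) h5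
    rw [mul_pow, sq_abs] at h6
    nlinarith
  rcases J.eq_empty_or_nonempty with rfl | hne
  · simp only [Finset.sum_empty] at *
    nlinarith
  obtain ⟨hq0, hq⟩ := sqrt_sum_sq_le h0 hne hr
  set q := √(∑ i ∈ J, r i ^ 2) with hqdef
  have hq2 : ∑ i ∈ J, r i ^ 2 = q ^ 2 :=
    (Real.sq_sqrt (Finset.sum_nonneg fun i _ => sq_nonneg _)).symm
  have hm := half_min_le_add_sqrt_sub hq0 h0 (hR₁.trans h12)
  rw [hq2, Finset.sum_sub_distrib, ← Finset.mul_sum, ← Finset.mul_sum] at hF2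
  have hsum1 : ∑ i ∈ J, (ℓ i ^ 3 * (1 / r i - 1 / R) ^ 2 / 24 - ℓ i ^ 5 / (r₀ * R) ^ 2)
      ≤ ∑ i ∈ J, ℓ i := by
    refine Finset.sum_le_sum fun i hi => ?_
    have : 0 ≤ ℓ i ^ 5 / (r₀ * R) ^ 2 := by have := hℓ i hi; positivity
    linarith [hδ i hi]
  have hlow : 2 * Real.pi * R₂ + 2 * Real.pi * (∑ i ∈ J, r i - q + min |q - R₂| r₀ / 2)
      - Real.pi * ∑ i ∈ J, ℓ i ≤ G := by
    refine le_trans ?_ hF2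
    have := mul_le_mul_of_nonneg_left hm (by positivity : 0 ≤ 2 * Real.pi)
    linarith
  have hmin0 : 0 ≤ min |q - R₂| r₀ := le_min (abs_nonneg _) h0.le
  have hℓ0 : 0 ≤ ∑ i ∈ J, ℓ i := Finset.sum_nonneg fun i hi => (hℓ i hi).le
  -- If detaching gains enough radius to pay for the chords, `hF2` gives a surplus of at least `Σ
  -- ℓ`, which covers the deviations by `hδ`.
  by_cases hbig : ∑ i ∈ J, ℓ i ≤ (R₂ - R₁) + (∑ i ∈ J, r i - q + min |q - R₂| r₀ / 2)
  · have := mul_le_mul_of_nonneg_left hbig (by positivity : 0 ≤ 2 * Real.pi)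
    nlinarith
  · push Not at hbig
    -- Two or more caps would gain at least `(|J| - 1) r₀/2 ≥ |J| r₀/4 ≥ |J| c`, which is enough to
    -- pay for the chords.
    have hcard : J.card = 1 := by
      have h1 : 1 ≤ J.card := hne.card_pos
      by_contra h2
      have h3 : (2 : ℝ) ≤ J.card := by exact_mod_cast (by omega : 2 ≤ J.card)
      have h4 : ∑ i ∈ J, ℓ i ≤ J.card * c := by
        simpa using Finset.sum_le_card_nsmul J ℓ c hℓc
      have h5 : (J.card : ℝ) * c ≤ J.card * (r₀ / 4) := mul_le_mul_of_nonneg_left hc (Nat.cast_nonneg _)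
      nlinarith
    obtain ⟨a, rfl⟩ := Finset.card_eq_one.1 hcard
    have hr := hr a (Finset.mem_singleton_self a)
    have hℓ := hℓ a (Finset.mem_singleton_self a)
    have hℓc := hℓc a (Finset.mem_singleton_self a)
    have hqa : q = r a := by rw [hqdef, Finset.sum_singleton, Real.sqrt_sq (h0.le.trans hr)]
    rw [Finset.sum_singleton, Finset.sum_singleton] at hbig
    rw [Finset.sum_singleton]
    rw [hqa] at hbig
    -- The remaining cap has almost the radius `R₁`, so its deviation is of order `ℓ⁵ + (R₁ - R)²`
    -- and the alternative `hF1` suffices.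
    have hlt : |r a - R₁| < 2 * ℓ a := by
      have h1 : |r a - R₁| ≤ |r a - R₂| + (R₂ - R₁) := by
        have := abs_sub_le (r a) R₂ R₁
        rwa [abs_of_nonneg (sub_nonneg.2 h12)] at this
      rcases min_choice |r a - R₂| r₀ with h | h <;> rw [h] at hbig <;> linarith
    have hd : |r a - R| ≤ 2 * ℓ a + |R₁ - R| := (abs_sub_le _ R₁ _).trans (by linarith)
    have hd2 : (r a - R) ^ 2 ≤ 8 * ℓ a ^ 2 + 2 * (R₁ - R) ^ 2 := by
      rw [← sq_abs, ← sq_abs (R₁ - R)]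
      have := pow_le_pow_left₀ (abs_nonneg _) hd 2
      nlinarith [sq_nonneg (2 * ℓ a - |R₁ - R|)]
    have hra : 0 < r a := h0.trans_le hr
    have e : (1 / r a - 1 / R) ^ 2 ≤ (8 * ℓ a ^ 2 + 2 * (R₁ - R) ^ 2) / (r₀ * R) ^ 2 := by
      have : (1 / r a - 1 / R) ^ 2 = (r a - R) ^ 2 / (r a * R) ^ 2 := by
        field_simp
        ring
      rw [this]
      gcongr
    have hℓR : ℓ a ^ 3 ≤ R ^ 3 := pow_le_pow_left₀ hℓ.le (hℓc.trans hcR) 3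
    have hfin : ℓ a ^ 3 * (1 / r a - 1 / R) ^ 2 / 24
        ≤ ℓ a ^ 5 / (r₀ * R) ^ 2 + R ^ 3 / (r₀ * R) ^ 2 * (R₁ - R) ^ 2 := by
      have h1 := mul_le_mul_of_nonneg_left e (by positivity : 0 ≤ ℓ a ^ 3)
      have h2 : ℓ a ^ 3 * ((8 * ℓ a ^ 2 + 2 * (R₁ - R) ^ 2) / (r₀ * R) ^ 2)
          = (8 * ℓ a ^ 5 + ℓ a ^ 3 * (2 * (R₁ - R) ^ 2)) / (r₀ * R) ^ 2 := by ring
      have h3 : (8 * ℓ a ^ 5 + ℓ a ^ 3 * (2 * (R₁ - R) ^ 2)) / (r₀ * R) ^ 2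
          ≤ (24 * ℓ a ^ 5 + R ^ 3 * (24 * (R₁ - R) ^ 2)) / (r₀ * R) ^ 2 := by
        have h5 : ℓ a ^ 3 * (2 * (R₁ - R) ^ 2) ≤ R ^ 3 * (24 * (R₁ - R) ^ 2) := by
          gcongr
          norm_num
        have h6 : 0 ≤ ℓ a ^ 5 := by positivity
        gcongr
        norm_num
      have h4 : (24 * ℓ a ^ 5 + R ^ 3 * (24 * (R₁ - R) ^ 2)) / (r₀ * R) ^ 2
          = 24 * (ℓ a ^ 5 / (r₀ * R) ^ 2 + R ^ 3 / (r₀ * R) ^ 2 * (R₁ - R) ^ 2) := by ring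
      linarith
    have := mul_le_mul_of_nonneg_left h12 (by positivity : 0 ≤ 2 * Real.pi)
    linarith

lemma sq_sqrt_add_sub_le {R y : ℝ} (hR : 0 < R) (hy : 0 ≤ R ^ 2 + y) :
    (√(R ^ 2 + y) - R) ^ 2 ≤ y ^ 2 / R ^ 2 := by
  rw [le_div_iff₀ (by positivity)]
  have h := Real.sq_sqrt hy
  have hs := Real.sqrt_nonneg (R ^ 2 + y)
  set s := √(R ^ 2 + y)
  have e : y = (s - R) * (s + R) := by linarith [h, sq_sub_sq s R]
  rw [e, mul_pow]
  exact mul_le_mul_of_nonneg_left (pow_le_pow_left₀ hR.le (by linarith) 2) (sq_nonneg _)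

/-- Linearization of the isoperimetric bound in the area change `Y`. The term with `K` makes room
for the `(R₁ - R)²` lost in `le_of_detach`. -/
lemma two_pi_mul_add_sub_le {R Y K : ℝ} (hR : 0 < R) (hK : 0 ≤ K)
    (hY : 0 ≤ R ^ 2 + Y / Real.pi) :
    2 * Real.pi * R + Y * (1 / R) - (1 / R ^ 3 + K / R ^ 2) * Y ^ 2
      ≤ 2 * Real.pi * √(R ^ 2 + Y / Real.pi) - K * (√(R ^ 2 + Y / Real.pi) - R) ^ 2 := by
  have hπ : 1 ≤ Real.pi := by linarith [Real.pi_gt_three]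
  have h1 := mul_le_mul_of_nonneg_left (add_sub_cube_le_sqrt hR hY)
    (by positivity : 0 ≤ 2 * Real.pi)
  have h2 := mul_le_mul_of_nonneg_left (sq_sqrt_add_sub_le hR hY) hK
  have e1 : 2 * Real.pi * (R + Y / Real.pi / (2 * R) - (Y / Real.pi) ^ 2 / (2 * R ^ 3))
      = 2 * Real.pi * R + Y * (1 / R) - 1 / R ^ 3 * (Y ^ 2 / Real.pi) := by
    field_simp
  have h3 : (Y / Real.pi) ^ 2 ≤ Y ^ 2 := by
    rw [div_pow]
    exact div_le_self (sq_nonneg _) (one_le_pow₀ hπ)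
  have h4 : K * ((Y / Real.pi) ^ 2 / R ^ 2) ≤ K * (Y ^ 2 / R ^ 2) := by gcongr
  have h5 : 1 / R ^ 3 * (Y ^ 2 / Real.pi) ≤ 1 / R ^ 3 * Y ^ 2 :=
    mul_le_mul_of_nonneg_left (div_le_self (sq_nonneg _) hπ) (by positivity)
  have e2 : (1 / R ^ 3 + K / R ^ 2) * Y ^ 2 = 1 / R ^ 3 * Y ^ 2 + K * (Y ^ 2 / R ^ 2) := by ring
  rw [e1] at h1
  rw [e2]
  linarith

/-- The combination of all alternatives: the arcs in `I` are replaced by arcs of curvature `1 / R`,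
at an area change `Δ` and a length gain `g`, and the arcs in `J` are detached. -/
lemma le_of_alternatives {ι : Type*} {κ ℓ Δ g : ι → ℝ} {r₀ c R C₂ C₃ c₄ K N P : ℝ} (h0 : 0 < r₀)
    (hR : 0 < R) (hC₂ : 0 ≤ C₂) (hc₄ : 0 < c₄) (hc0 : 0 < c) (hcR : c ≤ R) (hc : c ≤ r₀ / 4)
    (hc' : c * (1 / r₀ + 1 / R) ≤ 1) (hc'' : c * (2 + 8 * C₂ * R ^ 3) ≤ R)
    (hK : K = 1 / R ^ 3 + R ^ 3 / (r₀ * R) ^ 2 / R ^ 2) (hN : N = K * (4 * Real.pi * R))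
    {I J : Finset ι} (hℓ : ∀ i, 0 < ℓ i) (hℓI : ∀ i ∈ I, ℓ i ≤ c) (hκI : ∀ i ∈ I, |κ i| * ℓ i ≤ 2)
    (hΔ : ∀ i ∈ I, (1 / R - κ i) * ℓ i ^ 3 / 12 - C₂ * ℓ i ^ 5 ≤ Δ i)
    (hg : ∀ i ∈ I, (κ i ^ 2 - (1 / R) ^ 2) * ℓ i ^ 3 / 24 + c₄ * κ i ^ 4 * ℓ i ^ 5
      - C₃ * ℓ i ^ 5 ≤ g i)
    (hS : ∑ i ∈ I, ℓ i ≤ 4 * Real.pi * R) (hJ : ∀ i ∈ J, r₀ ≤ 1 / κ i) (hℓJ : ∀ i ∈ J, ℓ i ≤ c)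
    (hF1 : 2 * Real.pi * √|R ^ 2 + (∑ i ∈ I, Δ i) / Real.pi| + ∑ i ∈ I, g i ≤ P)
    (hF2 : 2 * Real.pi * √|R ^ 2 + (∑ i ∈ I, Δ i) / Real.pi - ∑ i ∈ J, (1 / κ i) ^ 2|
      + ∑ i ∈ I, g i + ∑ i ∈ J, (2 * Real.pi * (1 / κ i) - Real.pi * ℓ i) ≤ P) :
    2 * Real.pi * R
      + ∑ i ∈ I, (ℓ i ^ 3 * (κ i - 1 / R) ^ 2 / 24
        - (C₃ + C₂ / R + N ^ 2 / (4 * c₄) + N * ((1 / R) ^ 2 + 2 * C₂ ^ 2 * R ^ 4)) * ℓ i ^ 5)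
      + ∑ i ∈ J, (ℓ i ^ 3 * (κ i - 1 / R) ^ 2 / 24 - ℓ i ^ 5 / (r₀ * R) ^ 2) ≤ P := by
  have hπ := Real.pi_gt_three
  have hK0 : 0 ≤ K := by rw [hK]; positivity
  have hN0 : 0 ≤ N := by rw [hN]; positivity
  set k := 1 / R with hk
  have hkR : k * R = 1 := by rw [hk]; field_simp
  have hk0 : 0 < k := by positivity
  -- Only lower bounds for the area changes are available. The expansion is carried out with these;
  -- the true radius is at least as large.
  set b : ι → ℝ := fun i => (k - κ i) * ℓ i ^ 3 / 12 - C₂ * ℓ i ^ 5 with hb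
  set Y := ∑ i ∈ I, b i with hY
  have hYΔ : Y ≤ ∑ i ∈ I, Δ i := Finset.sum_le_sum hΔ
  have hbabs : ∀ i ∈ I, -(R / 8) * ℓ i ≤ b i := by
    intro i hi
    have h1 := hℓ i
    have h2 := hℓI i hi
    have h3 : κ i * ℓ i ≤ 2 := (mul_le_mul_of_nonneg_right (le_abs_self _) h1.le).trans (hκI i hi)
    have h4 : ℓ i ^ 4 ≤ c * R ^ 3 := by
      have : ℓ i ^ 3 ≤ R ^ 3 := pow_le_pow_left₀ h1.le (h2.trans hcR) 3
      calc ℓ i ^ 4 = ℓ i * ℓ i ^ 3 := by ring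
        _ ≤ c * R ^ 3 := by gcongr
    have h5 : -(R / 8) ≤ (k * ℓ i - κ i * ℓ i) * ℓ i / 12 - C₂ * ℓ i ^ 4 := by
      have h6 : C₂ * ℓ i ^ 4 ≤ C₂ * (c * R ^ 3) := by gcongr
      have h7 : 0 ≤ k * ℓ i * ℓ i := by positivity
      have h8 : κ i * ℓ i * ℓ i ≤ 2 * c := by nlinarith
      linarith
    have e : b i = ((k * ℓ i - κ i * ℓ i) * ℓ i / 12 - C₂ * ℓ i ^ 4) * ℓ i := by
      simp only [hb]; ring
    rw [e]
    exact mul_le_mul_of_nonneg_right h5 h1.le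
  -- Each `b i` is at least `-(R/8) ℓ i` and the chords add up to at most `4πR`, so at least half of
  -- the area remains. The condition `hc''` on `c` serves this purpose.
  have hYlow : -(Real.pi * R ^ 2 / 2) ≤ Y := by
    have h1 := Finset.sum_le_sum hbabs
    rw [← Finset.mul_sum] at h1
    nlinarith
  have hYpos : 0 ≤ R ^ 2 + Y / Real.pi := by
    have h1 : -(R ^ 2 / 2) ≤ Y / Real.pi := by rw [le_div_iff₀ (by linarith)]; linarith
    nlinarith
  have hΔpos : R ^ 2 + Y / Real.pi ≤ R ^ 2 + (∑ i ∈ I, Δ i) / Real.pi := by gcongr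
  have hR₂ := Real.sq_sqrt (hYpos.trans hΔpos)
  have hdet := le_of_detach (r := fun i => 1 / κ i) (G := P - ∑ i ∈ I, g i) h0 hR
    (Real.sqrt_nonneg _) (Real.sqrt_le_sqrt hΔpos) hcR hc hc' hJ (fun i _ => hℓ i) hℓJ
    (by rw [abs_of_nonneg (hYpos.trans hΔpos)] at hF1; linarith) (by rw [hR₂]; linarith)
  simp only [one_div_one_div] at hdet
  have hR₁ := add_sub_cube_le_sqrt hR hYpos
  have hR₁' := sq_sqrt_add_sub_le hR hYpos
  have hmain := two_pi_mul_add_sub_le (K := R ^ 3 / (r₀ * R) ^ 2) hR (by positivity) hYpos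
  rw [← hK, ← hk] at hmain
  set D := k ^ 2 + 2 * C₂ ^ 2 * R ^ 4 with hD
  have hD0 : 0 ≤ D := by positivity
  have hb2 : ∀ i ∈ I, b i ^ 2 ≤ ℓ i * (ℓ i ^ 5 * (κ i ^ 2 + D)) := by
    intro i hi
    have h1 := hℓ i
    have h2 : ℓ i ^ 4 ≤ R ^ 4 := pow_le_pow_left₀ h1.le ((hℓI i hi).trans hcR) 4
    have e : b i ^ 2 = ℓ i ^ 6 * ((k - κ i) / 12 - C₂ * ℓ i ^ 2) ^ 2 := by simp only [hb]; ring
    rw [e, show ℓ i * (ℓ i ^ 5 * (κ i ^ 2 + D)) = ℓ i ^ 6 * (κ i ^ 2 + D) by ring]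
    refine mul_le_mul_of_nonneg_left ?_ (by positivity)
    have h3 : C₂ ^ 2 * ℓ i ^ 4 ≤ C₂ ^ 2 * R ^ 4 := by gcongr
    have h4 : ((k - κ i) / 12 - C₂ * ℓ i ^ 2) ^ 2 = (k ^ 2 + κ i ^ 2) / 36 - (k + κ i) ^ 2 / 72
        + 2 * (C₂ ^ 2 * ℓ i ^ 4) - ((k - κ i) / 12 + C₂ * ℓ i ^ 2) ^ 2 := by ring
    have h5 := sq_nonneg ((k - κ i) / 12 + C₂ * ℓ i ^ 2)
    have h6 := sq_nonneg (k + κ i)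
    have h7 := sq_nonneg k
    have h8 := sq_nonneg (κ i)
    linarith only [h3, h4, h5, h6, h7, h8, hD]
  -- Cauchy–Schwarz with the weights `ℓ i` turns the square of the sum into a sum of terms of order
  -- `ℓ⁵`, independently of the number of arcs.
  have hY2 : Y ^ 2 ≤ 4 * Real.pi * R * ∑ i ∈ I, ℓ i ^ 5 * (κ i ^ 2 + D) := by
    refine (Finset.sum_sq_le_sum_mul_sum_of_sq_le_mul I (fun i _ => (hℓ i).le) (fun i _ => ?_)
      hb2).trans (mul_le_mul_of_nonneg_right hS (Finset.sum_nonneg fun i _ => ?_)) <;>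
    · have := hℓ i
      positivity
  -- The cubic terms complete the square: `(κ² - k²)/24 + k(k - κ)/12 = (κ - k)²/24`.
  have hpt : ∀ i ∈ I, ℓ i ^ 3 * (κ i - k) ^ 2 / 24
      - (C₃ + C₂ / R + N ^ 2 / (4 * c₄) + N * D) * ℓ i ^ 5
      ≤ g i + b i * k - N * (ℓ i ^ 5 * (κ i ^ 2 + D)) := by
    intro i hi
    have h1 := hℓ i
    -- The curvature is not bounded below, so `κ²` is not bounded; the quartic term of the length
    -- gain absorbs it.
    have h2 : N * κ i ^ 2 ≤ c₄ * κ i ^ 4 + N ^ 2 / (4 * c₄) := by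
      have : c₄ * κ i ^ 4 + N ^ 2 / (4 * c₄) - N * κ i ^ 2 = c₄ * (κ i ^ 2 - N / (2 * c₄)) ^ 2 := by
        field_simp; ring
      have h4 := mul_nonneg hc₄.le (sq_nonneg (κ i ^ 2 - N / (2 * c₄)))
      linarith only [this, h4]
    have h3 := mul_le_mul_of_nonneg_right h2 (by positivity : 0 ≤ ℓ i ^ 5)
    have h4 := hg i hi
    have e : C₂ / R = C₂ * k := by rw [hk]; ring
    rw [e]
    simp only [hb]
    linarith only [h3, h4]
  have hsum := Finset.sum_le_sum hpt
  rw [Finset.sum_sub_distrib (f := fun i => g i + b i * k), Finset.sum_add_distrib,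
    ← Finset.sum_mul, ← Finset.mul_sum] at hsum
  have hKY := mul_le_mul_of_nonneg_left hY2 hK0
  rw [← mul_assoc, ← hN] at hKY
  linarith only [hsum, hKY, hdet, hmain, hY]

/-! ### Length and segment area in terms of the chord -/

lemma nonneg_of_hasDerivAt_nonneg {f f' : ℝ → ℝ} {b : ℝ} (h0 : f 0 = 0)
    (hf : ∀ x, HasDerivAt f (f' x) x) (hf' : ∀ x ∈ Ioo 0 b, 0 ≤ f' x) {x : ℝ} (hx : x ∈ Icc 0 b) :
    0 ≤ f x := by
  have hm : MonotoneOn f (Icc 0 b) := by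
    apply monotoneOn_of_deriv_nonneg (convex_Icc 0 b)
      (continuous_iff_continuousAt.2 fun x => (hf x).continuousAt).continuousOn
      fun x _ => (hf x).differentiableAt.differentiableWithinAt
    intro x hx
    rw [interior_Icc] at hx
    rw [(hf x).deriv]
    exact hf' x hx
  have := hm (left_mem_Icc.2 (hx.1.trans hx.2)) hx hx.1
  rwa [h0] at this

/-- With `t = cos x`, the derivative of the difference is `(1 - t)²(8 + 3t - 2t² - t³)/8`, and it is
at least `1` when `t ≤ 0`. The arcsine series has `3/40` in place of `1/40`; later only some
positive quintic coefficient matters. -/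
lemma sin_add_cube_le {x : ℝ} (hx : x ∈ Icc 0 Real.pi) :
    Real.sin x + Real.sin x ^ 3 / 6 + Real.sin x ^ 5 / 40 ≤ x := by
  have h := nonneg_of_hasDerivAt_nonneg
    (f := fun x => x - (Real.sin x + Real.sin x ^ 3 / 6 + Real.sin x ^ 5 / 40)) (b := Real.pi)
    (by simp) (fun x => (hasDerivAt_id x).sub (((Real.hasDerivAt_sin x).add
      (((Real.hasDerivAt_sin x).pow 3).div_const 6)).add
      (((Real.hasDerivAt_sin x).pow 5).div_const 40))) (fun x _ => ?_) hx
  · linarith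
  · have h1 := Real.sin_sq x
    have h2 := Real.cos_le_one x
    set t := Real.cos x
    set s := Real.sin x
    have e : s ^ 4 = (1 - t ^ 2) ^ 2 := by rw [← h1]; ring
    simp only [Nat.cast_ofNat, Nat.add_one_sub_one]
    rw [e, h1]
    rcases le_total t 0 with ht | ht
    · have : 0 ≤ 1 + (1 - t ^ 2) / 2 + (1 - t ^ 2) ^ 2 / 8 := by
        rw [← h1]; positivity
      nlinarith
    · have h3 : 0 ≤ 8 + 3 * t - 2 * t ^ 2 - t ^ 3 := by nlinarith [mul_nonneg ht ht]
      nlinarith [mul_nonneg (sq_nonneg (1 - t)) h3]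

/-- The derivative of the difference is `2 sin² x (1 - cos x)`. Validity up to `π` permits arcs of
nonpositive curvature with any opening angle. -/
lemma sin_cube_le {x : ℝ} (hx : x ∈ Icc 0 Real.pi) :
    2 / 3 * Real.sin x ^ 3 ≤ x - Real.sin x * Real.cos x := by
  have h := nonneg_of_hasDerivAt_nonneg
    (f := fun x => x - Real.sin x * Real.cos x - 2 / 3 * Real.sin x ^ 3) (b := Real.pi)
    (by simp) (fun x => ((hasDerivAt_id x).sub ((Real.hasDerivAt_sin x).mul
      (Real.hasDerivAt_cos x))).sub (((Real.hasDerivAt_sin x).pow 3).const_mul (2 / 3)))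
    (fun x _ => ?_) hx
  · linarith
  · have h1 := Real.sin_sq x
    have h2 := Real.cos_le_one x
    rw [show (3 - 1 : ℕ) = 2 from rfl, h1]
    have h3 : 0 ≤ 1 - Real.cos x ^ 2 := by rw [← h1]; positivity
    push_cast
    nlinarith

lemma one_half_le_cos {x : ℝ} (hx : x ∈ Ioo 0 (Real.pi / 3)) : 1 / 2 ≤ Real.cos x := by
  rw [← Real.cos_pi_div_three]
  exact Real.cos_le_cos_of_nonneg_of_le_pi hx.1.le (by linarith [Real.pi_pos]) hx.2.le

/-- Upper bounds by powers of the sine must fail near `π`, where the sine returns to zero. For `t =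
cos x ≥ 1/2` the derivative of the difference is `sin² x (1 - t)(5t(1 + t) - 2) ≥ 0`. -/
lemma le_sin_cube_add {x : ℝ} (hx : x ∈ Icc 0 (Real.pi / 3)) :
    x - Real.sin x * Real.cos x ≤ 2 / 3 * Real.sin x ^ 3 + Real.sin x ^ 5 := by
  have h := nonneg_of_hasDerivAt_nonneg
    (f := fun x => 2 / 3 * Real.sin x ^ 3 + Real.sin x ^ 5 - (x - Real.sin x * Real.cos x))
    (b := Real.pi / 3) (by simp) (fun x => ((((Real.hasDerivAt_sin x).pow 3).const_mul (2 / 3)).add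
      ((Real.hasDerivAt_sin x).pow 5)).sub ((hasDerivAt_id x).sub ((Real.hasDerivAt_sin x).mul
      (Real.hasDerivAt_cos x)))) (fun x hx => ?_) hx
  · linarith
  · have h1 := Real.sin_sq x
    have h2 := Real.cos_le_one x
    have h3 := one_half_le_cos hx
    set t := Real.cos x
    set s := Real.sin x
    have e : s ^ 4 = s ^ 2 * (1 - t ^ 2) := by rw [← h1]; ring
    rw [show (3 - 1 : ℕ) = 2 from rfl, show (5 - 1 : ℕ) = 4 from rfl, e]
    push_cast
    have h4 : 0 ≤ (1 - t) * (5 * (1 + t) * t - 2) := mul_nonneg (by linarith) (by nlinarith)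
    nlinarith [mul_nonneg (sq_nonneg s) h4]

lemma le_sin_add_cube_add {x : ℝ} (hx : x ∈ Icc 0 (Real.pi / 3)) :
    x ≤ Real.sin x + Real.sin x ^ 3 / 6 + Real.sin x ^ 5 := by
  have h := nonneg_of_hasDerivAt_nonneg
    (f := fun x => Real.sin x + Real.sin x ^ 3 / 6 + Real.sin x ^ 5 - x)
    (b := Real.pi / 3) (by simp) (fun x => (((Real.hasDerivAt_sin x).add
      (((Real.hasDerivAt_sin x).pow 3).div_const 6)).add
      ((Real.hasDerivAt_sin x).pow 5)).sub (hasDerivAt_id x)) (fun x hx => ?_) hx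
  · linarith
  · have h1 := Real.sin_sq x
    have h2 := Real.cos_le_one x
    have h3 := one_half_le_cos hx
    set t := Real.cos x
    set s := Real.sin x
    have e : s ^ 4 = (1 - t ^ 2) ^ 2 := by rw [← h1]; ring
    rw [show (3 - 1 : ℕ) = 2 from rfl, show (5 - 1 : ℕ) = 4 from rfl, e, h1]
    push_cast
    have h4 : 0 ≤ 5 * t * (1 + t) ^ 2 - (t + 2) / 2 := by nlinarith [sq_nonneg t]
    nlinarith [mul_nonneg (sq_nonneg (1 - t)) h4]

namespace CircularArc

variable {κ L : ℝ}

lemma sin_half_eq (hκ : κ ≠ 0) : Real.sin (κ * L / 2) = κ * chordLength κ L / 2 := by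
  rw [chordLength, if_neg hκ]
  field_simp

lemma chordLength_neg : chordLength (-κ) L = chordLength κ L := by
  unfold chordLength
  by_cases h : κ = 0
  · simp [h]
  · rw [if_neg h, if_neg (neg_ne_zero.2 h), neg_mul, neg_div, Real.sin_neg, div_neg, neg_mul_neg]

lemma chordLength_abs : chordLength |κ| L = chordLength κ L := by
  rcases abs_choice κ with h | h <;> rw [h]
  exact chordLength_neg

lemma segmentArea_neg : segmentArea (-κ) L = -segmentArea κ L := by
  rw [segmentArea, segmentArea, neg_mul, Real.sin_neg, neg_sq]
  ring

lemma segmentArea_eq (hκ : κ ≠ 0) : segmentArea κ L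
    = (κ * L / 2 - Real.sin (κ * L / 2) * Real.cos (κ * L / 2)) / κ ^ 2 := by
  have h := Real.sin_two_mul (κ * L / 2)
  rw [mul_div_cancel₀ _ two_ne_zero] at h
  rw [segmentArea, h]
  field_simp

lemma half_mem_Icc (hκ : 0 ≤ κ) (hL : 0 ≤ L) {b : ℝ} (h : κ * L ≤ 2 * b) :
    κ * L / 2 ∈ Icc 0 b := ⟨by positivity, by linarith⟩

lemma abs_mul_chordLength_le : |κ| * chordLength κ L ≤ 2 := by
  by_cases h : κ = 0
  · simp [h]
  · have h1 := sin_half_eq (L := L) (abs_ne_zero.2 h)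
    rw [chordLength_abs] at h1
    linarith [Real.sin_le_one (|κ| * L / 2)]

lemma chordLength_add_le (hL : 0 ≤ L) (h : |κ| * L ≤ 2 * Real.pi) :
    chordLength κ L + κ ^ 2 * chordLength κ L ^ 3 / 24 + κ ^ 4 * chordLength κ L ^ 5 / 640 ≤ L := by
  by_cases h0 : κ = 0
  · simp [h0, chordLength]
  · have hpos : 0 < |κ| := abs_pos.2 h0
    have h1 := sin_add_cube_le (half_mem_Icc hpos.le hL h)
    rw [sin_half_eq hpos.ne', chordLength_abs] at h1
    have e : κ ^ 4 = |κ| ^ 4 := (Even.pow_abs ⟨2, rfl⟩ κ).symm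
    rw [← sq_abs κ, e]
    set a := |κ|
    set ℓ := chordLength κ L
    have e2 : a * ℓ / 2 + (a * ℓ / 2) ^ 3 / 6 + (a * ℓ / 2) ^ 5 / 40
        = a / 2 * (ℓ + a ^ 2 * ℓ ^ 3 / 24 + a ^ 4 * ℓ ^ 5 / 640) := by ring
    rw [e2, mul_div_right_comm a L 2] at h1
    exact le_of_mul_le_mul_left h1 (by positivity)

lemma mul_chordLength_cube_le_segmentArea (hκ : 0 ≤ κ) (hL : 0 ≤ L) (h : κ * L ≤ 2 * Real.pi) :
    κ * chordLength κ L ^ 3 / 12 ≤ segmentArea κ L := by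
  rcases hκ.eq_or_lt with rfl | hpos
  · simp [segmentArea]
  · have h1 := sin_cube_le (half_mem_Icc hκ hL h)
    rw [segmentArea_eq hpos.ne', le_div_iff₀ (by positivity)]
    refine le_trans (le_of_eq ?_) h1
    rw [sin_half_eq hpos.ne']
    ring

lemma segmentArea_le (hκ : 0 ≤ κ) (hL : 0 ≤ L) (h : κ * L ≤ 2 * (Real.pi / 3)) :
    segmentArea κ L ≤ κ * chordLength κ L ^ 3 / 12 + κ ^ 3 * chordLength κ L ^ 5 / 32 := by
  rcases hκ.eq_or_lt with rfl | hpos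
  · simp [segmentArea]
  · have h1 := le_sin_cube_add (half_mem_Icc hκ hL h)
    rw [segmentArea_eq hpos.ne', div_le_iff₀ (by positivity)]
    refine h1.trans (le_of_eq ?_)
    rw [sin_half_eq hpos.ne']
    ring

lemma le_chordLength_add (hκ : 0 ≤ κ) (hL : 0 ≤ L) (h : κ * L ≤ 2 * (Real.pi / 3)) :
    L ≤ chordLength κ L + κ ^ 2 * chordLength κ L ^ 3 / 24 + κ ^ 4 * chordLength κ L ^ 5 / 16 := by
  rcases hκ.eq_or_lt with rfl | hpos
  · simp [chordLength]
  · have h1 := le_sin_add_cube_add (half_mem_Icc hκ hL h)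
    rw [sin_half_eq hpos.ne', mul_div_right_comm κ L 2] at h1
    refine le_of_mul_le_mul_left (h1.trans (le_of_eq ?_)) (half_pos hpos)
    ring

/-! ### Admissible replacements of a single arc -/

/-- A change of area `Δ` and a gain of length `g` that are possible when an arc of curvature `κ` and
length `L` is replaced by another arc with the same chord. -/
def IsReplacement (κ L Δ g : ℝ) : Prop :=
  ∃ κ' L', 0 < L' ∧ |κ'| * L' < 2 * Real.pi ∧ chordLength κ' L' = chordLength κ L ∧
    Δ = segmentArea κ' L' - segmentArea κ L ∧ g = L - L'

lemma isReplacement_zero (hL : 0 < L) (h : |κ| * L < 2 * Real.pi) : IsReplacement κ L 0 0 :=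
  ⟨κ, L, hL, h, rfl, by simp, by simp⟩

lemma exists_short_arc {k ℓ : ℝ} (hk : 0 < k) (hℓ : 0 < ℓ) (h : k * ℓ ≤ 1) :
    ∃ L, 0 < L ∧ k * L ≤ 2 * (Real.pi / 3) ∧ chordLength k L = ℓ := by
  have hpos : 0 < k * ℓ := by positivity
  have e : k * (2 / k * Real.arcsin (k * ℓ / 2)) = 2 * Real.arcsin (k * ℓ / 2) := by field_simp
  refine ⟨2 / k * Real.arcsin (k * ℓ / 2), ?_, ?_, ?_⟩
  · have := Real.arcsin_pos.2 (half_pos hpos)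
    positivity
  · rw [e]
    have : Real.arcsin (k * ℓ / 2) ≤ Real.pi / 3 := by
      rw [Real.arcsin_le_iff_le_sin' ⟨by linarith [Real.pi_pos], by linarith [Real.pi_pos]⟩,
        Real.sin_pi_div_three]
      have : (1 : ℝ) ≤ √3 := Real.one_le_sqrt.2 (by norm_num)
      linarith
    linarith
  · rw [chordLength, if_neg hk.ne', e, mul_div_cancel_left₀ _ two_ne_zero,
      Real.sin_arcsin (by linarith) (by linarith)]
    field_simp

/-- For an arc of at most a half circle, a short chord forces a small opening angle, because the
sine is monotone up to `π/2`. -/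
lemma mul_le_two_pi_div_three (hκ : 0 ≤ κ) (h : κ * L ≤ Real.pi)
    (h1 : κ * chordLength κ L ≤ 1) : κ * L ≤ 2 * (Real.pi / 3) := by
  rcases hκ.eq_or_lt with rfl | hpos
  · simp; positivity
  · have h2 := sin_half_eq (L := L) hpos.ne'
    by_contra! hlt
    have h3 : Real.sin (Real.pi / 3) < Real.sin (κ * L / 2) :=
      Real.sin_lt_sin_of_lt_of_le_pi_div_two (by linarith [Real.pi_pos]) (by linarith) (by linarith)
    rw [Real.sin_pi_div_three] at h3
    have : (1 : ℝ) ≤ √3 := Real.one_le_sqrt.2 (by norm_num)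
    linarith

/-- The replacement of an arc that is not a large cap by an arc of curvature `k`. -/
lemma exists_isReplacement_short {k κb : ℝ} (hk : 0 < k) (hL : 0 < L) (h : |κ| * L < 2 * Real.pi)
    (hκb : κ ≤ κb) (hκb0 : 0 < κb) (hs : κ ≤ 0 ∨ κ * L ≤ Real.pi) (hℓ : 0 < chordLength κ L)
    (h1 : k * chordLength κ L ≤ 1) (h2 : κb * chordLength κ L ≤ 1) :
    ∃ Δ g, IsReplacement κ L Δ g ∧
      (k - κ) * chordLength κ L ^ 3 / 12 - κb ^ 3 * chordLength κ L ^ 5 ≤ Δ ∧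
      (κ ^ 2 - k ^ 2) * chordLength κ L ^ 3 / 24 + 1 / 640 * κ ^ 4 * chordLength κ L ^ 5
        - k ^ 4 * chordLength κ L ^ 5 ≤ g := by
  obtain ⟨L', hL', hkL', hc⟩ := exists_short_arc hk hℓ h1
  have hπ := Real.pi_pos
  refine ⟨_, _, ⟨k, L', hL', by rw [abs_of_pos hk]; linarith, hc, rfl, rfl⟩, ?_, ?_⟩
  · have h3 := mul_chordLength_cube_le_segmentArea hk.le hL'.le (by linarith)
    rw [hc] at h3
    have h4 : segmentArea κ L
        ≤ κ * chordLength κ L ^ 3 / 12 + κb ^ 3 * chordLength κ L ^ 5 := by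
      have h0 : 0 ≤ κb ^ 3 * chordLength κ L ^ 5 := by positivity
      -- For nonpositive curvature the reflected arc turns the lower bound for the segment area into
      -- an upper bound, whatever the opening angle. For positive curvature the opening angle must
      -- be small.
      rcases le_total κ 0 with hn | hp
      · have h5 := mul_chordLength_cube_le_segmentArea (κ := -κ) (by linarith) hL.le
          (by rw [← abs_of_nonpos hn]; exact h.le)
        rw [segmentArea_neg, chordLength_neg] at h5
        linarith
      · have hπ2 : κ * L ≤ Real.pi := hs.elim (fun h' => by nlinarith) id
        have h5 := segmentArea_le hp hL.le (mul_le_two_pi_div_three hp hπ2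
          ((mul_le_mul_of_nonneg_right hκb hℓ.le).trans h2))
        have h6 : κ ^ 3 * chordLength κ L ^ 5 ≤ κb ^ 3 * chordLength κ L ^ 5 := by gcongr
        linarith
    linarith
  · have h3 := chordLength_add_le hL.le h.le
    have h4 := le_chordLength_add hk.le hL'.le hkL'
    rw [hc] at h4
    have h5 : 0 ≤ k ^ 4 * chordLength κ L ^ 5 := by positivity
    linarith

/-- The replacement of a large circular cap by the complementary arc. -/
lemma exists_isReplacement_compl (hκ : 0 < κ) (h : Real.pi < κ * L) (h2 : κ * L < 2 * Real.pi) :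
    ∃ g, IsReplacement κ L (-(Real.pi * (1 / κ) ^ 2)) g ∧
      2 * Real.pi * (1 / κ) - Real.pi * chordLength κ L ≤ g := by
  have hπ := Real.pi_pos
  have hm : κ * (2 * Real.pi / κ - L) = 2 * Real.pi - κ * L := by field_simp
  have hc : chordLength κ (2 * Real.pi / κ - L) = chordLength κ L := by
    rw [chordLength, chordLength, if_neg hκ.ne', if_neg hκ.ne', hm, sub_div,
      mul_div_cancel_left₀ _ two_ne_zero, Real.sin_pi_sub]
  -- The complementary arc of the same circle, run from the same start, turns the other way. The
  -- exchange removes the full disk of area `π/κ²`.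
  refine ⟨_, ⟨-κ, 2 * Real.pi / κ - L, ?_, ?_, ?_, ?_, rfl⟩, ?_⟩
  · rw [sub_pos, lt_div_iff₀ hκ]; linarith
  · rw [abs_neg, abs_of_pos hκ, hm]; linarith
  · rw [chordLength_neg, hc]
  · rw [segmentArea_neg, segmentArea, segmentArea, hm, Real.sin_two_pi_sub]
    field_simp
    ring
  · have h3 := Real.mul_le_sin (x := κ * (2 * Real.pi / κ - L) / 2) (by rw [hm]; linarith)
      (by rw [hm]; linarith)
    rw [sin_half_eq hκ.ne', hc] at h3
    have h4 : 2 / Real.pi * (κ * (2 * Real.pi / κ - L) / 2)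
        = κ / 2 * (2 / Real.pi * (2 * Real.pi / κ - L)) := by ring
    rw [h4, mul_div_right_comm κ (chordLength κ L) 2] at h3
    have h5 := le_of_mul_le_mul_left h3 (half_pos hκ)
    rw [div_mul_eq_mul_div, div_le_iff₀ hπ] at h5
    have h6 : 2 * Real.pi * (1 / κ) = 2 * Real.pi / κ := by ring
    rw [h6]
    linarith

end CircularArc

/-! ### Assembly: short and long total chord length -/

open CircularArc

lemma le_perimeter_of_isReplacement {ι : Type*} [Fintype ι] {E : Set Plane}
    (hE : MeasurableSet E) (hEfin : volume E ≠ ⊤) (hP : perimeter E < ⊤) {γ : ι → CircularArc}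
    (hγ : ∀ i, (γ i).IsBoundaryArc E)
    (hd : ∀ i j, i ≠ j → Disjoint (γ i).openCarrier (γ j).openCarrier) {R : ℝ}
    (hR : area E = Real.pi * R ^ 2) {Δ g : ι → ℝ}
    (h : ∀ i, IsReplacement (γ i).curvature (γ i).length (Δ i) (g i)) :
    2 * Real.pi * √|R ^ 2 + (∑ i, Δ i) / Real.pi| + ∑ i, g i ≤ (perimeter E).toReal := by
  choose κ L hL hκL hc hΔ hg using h
  have hiso := isoperimetric_recurve hE hEfin hP hγ hd hL hκL
    fun i => (hc i).trans (γ i).chord_eq_chordLength.symm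
  simp only [← hΔ, ← hg] at hiso
  have hπ := Real.pi_pos
  have e : 4 * Real.pi * |area E + ∑ i, Δ i|
      = (2 * Real.pi) ^ 2 * |R ^ 2 + (∑ i, Δ i) / Real.pi| := by
    have : area E + ∑ i, Δ i = Real.pi * (R ^ 2 + (∑ i, Δ i) / Real.pi) := by
      rw [hR]; field_simp
    rw [this, abs_mul, abs_of_pos hπ]
    ring
  rwa [e, Real.sqrt_mul (by positivity), Real.sqrt_sq (by positivity)] at hiso

/-- Expanding the square, the mixed term is at most `kℓ²/6` because `κℓ ≥ -2`. The right side is at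
most the arc length minus `ℓ/2`, which leaves half of every chord to pay for `2πR`. -/
lemma cube_mul_sub_sq_le {κ k ℓ : ℝ} (hk : 0 < k) (hℓ : 0 < ℓ) (h : |κ| * ℓ ≤ 2) :
    ℓ ^ 3 * (κ - k) ^ 2 / 24 - k ^ 4 * ℓ ^ 5 ≤ ℓ / 2 + κ ^ 2 * ℓ ^ 3 / 24 := by
  have h1 : -2 ≤ κ * ℓ := by
    have := (neg_abs_le (κ * ℓ))
    rw [abs_mul, abs_of_pos hℓ] at this
    linarith
  have hx : 0 < k * ℓ := by positivity
  have key : (k * ℓ) / 6 + (k * ℓ) ^ 2 / 24 ≤ 1 / 2 + (k * ℓ) ^ 4 := by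
    generalize k * ℓ = x at hx
    nlinarith [sq_nonneg (x ^ 2 - 1 / 2), sq_nonneg (x - 1)]
  have h2 := mul_le_mul_of_nonneg_right key hℓ.le
  have h3 := mul_le_mul_of_nonneg_right h1 (by positivity : 0 ≤ k * ℓ ^ 2 / 12)
  linarith only [h2, h3]

/-- A chord longer than `c` forces `|κ| ≤ 2/c`, and `ℓ³ ≤ ℓ⁵/c²`. -/
lemma cube_mul_sub_sq_le_of_lt {κ k ℓ c : ℝ} (hk : 0 < k) (hc : 0 < c) (hcℓ : c < ℓ)
    (h : |κ| * ℓ ≤ 2) : ℓ ^ 3 * (κ - k) ^ 2 / 24 ≤ (2 / c + k) ^ 2 / c ^ 2 * ℓ ^ 5 := by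
  have hℓ : 0 < ℓ := hc.trans hcℓ
  have h1 : |κ| ≤ 2 / c := by
    rw [le_div_iff₀ hc]
    exact (mul_le_mul_of_nonneg_left hcℓ.le (abs_nonneg _)).trans h
  have h2 : (κ - k) ^ 2 ≤ (2 / c + k) ^ 2 := by
    rw [← sq_abs]
    refine pow_le_pow_left₀ (abs_nonneg _) ((abs_sub _ _).trans ?_) 2
    rw [abs_of_pos hk]
    linarith
  have h3 : 1 ≤ ℓ ^ 2 / c ^ 2 := by
    rw [le_div_iff₀ (by positivity), one_mul]
    exact pow_le_pow_left₀ hc.le hcℓ.le 2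
  calc ℓ ^ 3 * (κ - k) ^ 2 / 24 ≤ ℓ ^ 3 * (κ - k) ^ 2 := div_le_self (by positivity) (by norm_num)
    _ ≤ ℓ ^ 3 * (2 / c + k) ^ 2 := by gcongr
    _ ≤ ℓ ^ 3 * (2 / c + k) ^ 2 * (ℓ ^ 2 / c ^ 2) := le_mul_of_one_le_right (by positivity) h3
    _ = (2 / c + k) ^ 2 / c ^ 2 * ℓ ^ 5 := by ring

/-- The inequality for short total chord length, with the arcs split into those with short chords
that are not large caps, large caps with short chords, and arcs with long chords. -/
lemma le_perimeter_of_sum_chord_le {ι : Type*} [Fintype ι] {E : Set Plane}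
    (hE : MeasurableSet E) (hEfin : volume E ≠ ⊤) (hP : perimeter E < ⊤) {γ : ι → CircularArc}
    (hγ : ∀ i, (γ i).IsBoundaryArc E)
    (hd : ∀ i j, i ≠ j → Disjoint (γ i).openCarrier (γ j).openCarrier) {R κb c C K N : ℝ}
    (hR : 0 < R) (hA : area E = Real.pi * R ^ 2) (hκb : 0 < κb) (hκ : ∀ i, (γ i).curvature ≤ κb)
    (hS : ∑ i, (γ i).chord ≤ 4 * Real.pi * R) (hc0 : 0 < c) (hcR : c ≤ R) (hc : c ≤ 1 / κb / 4)
    (hc' : c * (1 / (1 / κb) + 1 / R) ≤ 1) (hc'' : c * (2 + 8 * κb ^ 3 * R ^ 3) ≤ R)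
    (hK : K = 1 / R ^ 3 + R ^ 3 / (1 / κb * R) ^ 2 / R ^ 2) (hN : N = K * (4 * Real.pi * R))
    (hCI : (1 / R) ^ 4 + κb ^ 3 / R + N ^ 2 / (4 * (1 / 640))
      + N * ((1 / R) ^ 2 + 2 * (κb ^ 3) ^ 2 * R ^ 4) ≤ C)
    (hCJ : 1 / (1 / κb * R) ^ 2 ≤ C) (hCH : (2 / c + 1 / R) ^ 2 / c ^ 2 ≤ C) :
    2 * Real.pi * R + ∑ i, ((γ i).chord ^ 3 * ((γ i).curvature - 1 / R) ^ 2 / 24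
      - C * (γ i).chord ^ 5) ≤ (perimeter E).toReal := by
  classical
  have hπ := Real.pi_pos
  have hk : 0 < 1 / R := by positivity
  have hℓ := fun i => (γ i).chord_pos
  have hκℓ : ∀ i, |(γ i).curvature| * (γ i).chord ≤ 2 := fun i => by
    rw [chord_eq_chordLength]; exact abs_mul_chordLength_le
  -- `I` collects the arcs to be recurved to curvature `1/R`, `J` the large caps. Arcs of
  -- nonpositive curvature belong to `I` even beyond a half circle.
  set I := Finset.univ.filter fun i => (γ i).chord ≤ c ∧
    ((γ i).curvature ≤ 0 ∨ (γ i).curvature * (γ i).length ≤ Real.pi) with hI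
  set J := Finset.univ.filter fun i => (γ i).chord ≤ c ∧
    ¬((γ i).curvature ≤ 0 ∨ (γ i).curvature * (γ i).length ≤ Real.pi) with hJ
  have hIm : ∀ i, i ∈ I ↔ _ := fun i => by rw [hI, Finset.mem_filter_univ]
  have hJm : ∀ i, i ∈ J ↔ _ := fun i => by rw [hJ, Finset.mem_filter_univ]
  have hIJ : ∀ i, i ∈ I → i ∉ J := fun i h h' => ((hJm i).1 h').2 ((hIm i).1 h).2
  have hshort : ∀ i, ∃ Δ g, i ∈ I → IsReplacement (γ i).curvature (γ i).length Δ g ∧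
      (1 / R - (γ i).curvature) * (γ i).chord ^ 3 / 12 - κb ^ 3 * (γ i).chord ^ 5 ≤ Δ ∧
      ((γ i).curvature ^ 2 - (1 / R) ^ 2) * (γ i).chord ^ 3 / 24
        + 1 / 640 * (γ i).curvature ^ 4 * (γ i).chord ^ 5 - (1 / R) ^ 4 * (γ i).chord ^ 5 ≤ g := by
    intro i
    by_cases hi : i ∈ I
    · obtain ⟨hic, his⟩ := (hIm i).1 hi
      have h1 : 1 / R * (γ i).chord ≤ 1 := by
        rw [one_div_mul_eq_div, div_le_one hR]; exact hic.trans hcR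
      have h2 : κb * (γ i).chord ≤ 1 := by
        have := mul_le_mul_of_nonneg_left (hic.trans hc) hκb.le
        have e : κb * (1 / κb / 4) = 1 / 4 := by field_simp
        linarith
      have hpos := hℓ i
      rw [chord_eq_chordLength] at h1 h2 hpos ⊢
      obtain ⟨Δ, g, h⟩ := exists_isReplacement_short hk (γ i).length_pos (γ i).not_closed (hκ i) hκb
        his hpos h1 h2
      exact ⟨Δ, g, fun _ => h⟩
    · exact ⟨0, 0, fun h => absurd h hi⟩
  choose Δ g hΔg using hshort
  have hlong : ∀ i, ∃ g, i ∈ J → IsReplacement (γ i).curvature (γ i).length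
      (-(Real.pi * (1 / (γ i).curvature) ^ 2)) g ∧
      2 * Real.pi * (1 / (γ i).curvature) - Real.pi * (γ i).chord ≤ g := by
    intro i
    by_cases hi : i ∈ J
    · have his := ((hJm i).1 hi).2
      push Not at his
      have hlt := (γ i).not_closed
      rw [abs_of_pos his.1] at hlt
      obtain ⟨g, h⟩ := exists_isReplacement_compl his.1 his.2 hlt
      rw [← chord_eq_chordLength] at h
      exact ⟨g, fun _ => h⟩
    · exact ⟨0, fun h => absurd h hi⟩
  choose g' hg' using hlong
  have hstay := fun i => isReplacement_zero (γ i).length_pos (γ i).not_closed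
  -- Two competitors: both recurve the arcs in `I`; the first keeps the caps in `J`, the second
  -- detaches all of them. The other arcs are replaced by themselves.
  have hF1 := le_perimeter_of_isReplacement hE hEfin hP hγ hd hA
    (Δ := fun i => if i ∈ I then Δ i else 0) (g := fun i => if i ∈ I then g i else 0) (fun i => by
      by_cases hi : i ∈ I
      · simpa [hi] using (hΔg i hi).1
      · simpa [hi] using hstay i)
  have hF2 := le_perimeter_of_isReplacement hE hEfin hP hγ hd hA
    (Δ := fun i => (if i ∈ I then Δ i else 0)
      + if i ∈ J then -(Real.pi * (1 / (γ i).curvature) ^ 2) else 0)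
    (g := fun i => (if i ∈ I then g i else 0) + if i ∈ J then g' i else 0) (fun i => by
      by_cases hi : i ∈ I
      · simpa only [hi, hIJ i hi, if_true, if_false, add_zero] using (hΔg i hi).1
      · by_cases hj : i ∈ J
        · simpa only [hi, hj, if_true, if_false, zero_add] using (hg' i hj).1
        · simpa only [hi, hj, if_false, add_zero] using hstay i)
  simp only [Finset.sum_add_distrib, Finset.sum_ite_mem, Finset.univ_inter] at hF1 hF2
  rw [Finset.sum_neg_distrib, ← Finset.mul_sum, add_div, neg_div, mul_div_cancel_left₀ _ hπ.ne',
    ← sub_eq_add_neg, ← add_sub_assoc] at hF2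
  have hgJ : ∑ i ∈ J, (2 * Real.pi * (1 / (γ i).curvature) - Real.pi * (γ i).chord)
      ≤ ∑ i ∈ J, g' i := Finset.sum_le_sum fun i hi => (hg' i hi).2
  have hmain := le_of_alternatives (κ := fun i => (γ i).curvature) (ℓ := fun i => (γ i).chord)
    (r₀ := 1 / κb) (C₂ := κb ^ 3) (C₃ := (1 / R) ^ 4) (c₄ := 1 / 640) (Δ := Δ) (g := g) (I := I)
    (J := J) (by positivity) hR (by positivity) (by norm_num) hc0 hcR hc hc' hc'' hK hN hℓ
    (fun i hi => ((hIm i).1 hi).1) (fun i _ => hκℓ i) (fun i hi => (hΔg i hi).2.1)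
    (fun i hi => (hΔg i hi).2.2)
    ((Finset.sum_le_univ_sum_of_nonneg fun i => (hℓ i).le).trans hS)
    (fun i hi => one_div_le_one_div_of_le (by
      have := ((hJm i).1 hi).2
      push Not at this
      exact this.1) (hκ i))
    (fun i hi => ((hJm i).1 hi).1) hF1 (by linarith)
  have hsplit := Finset.sum_filter_add_sum_filter_not Finset.univ (fun i => (γ i).chord ≤ c)
    fun i => (γ i).chord ^ 3 * ((γ i).curvature - 1 / R) ^ 2 / 24 - C * (γ i).chord ^ 5
  rw [← Finset.sum_filter_add_sum_filter_not (Finset.univ.filter fun i => (γ i).chord ≤ c)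
    (fun i => (γ i).curvature ≤ 0 ∨ (γ i).curvature * (γ i).length ≤ Real.pi),
    Finset.filter_filter, Finset.filter_filter, ← hI, ← hJ] at hsplit
  have hsI := Finset.sum_le_sum fun i (_ : i ∈ I) => sub_le_sub_left
    (mul_le_mul_of_nonneg_right hCI (pow_nonneg (hℓ i).le 5))
    ((γ i).chord ^ 3 * ((γ i).curvature - 1 / R) ^ 2 / 24)
  have hsJ := Finset.sum_le_sum fun i (_ : i ∈ J) => sub_le_sub_left
    (mul_le_mul_of_nonneg_right hCJ (pow_nonneg (hℓ i).le 5))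
    ((γ i).chord ^ 3 * ((γ i).curvature - 1 / R) ^ 2 / 24)
  simp only [one_div_mul_eq_div (_ ^ 2)] at hsJ
  have hsH : ∑ i with ¬(γ i).chord ≤ c, ((γ i).chord ^ 3 * ((γ i).curvature - 1 / R) ^ 2 / 24
      - C * (γ i).chord ^ 5) ≤ 0 := by
    refine Finset.sum_nonpos fun i hi => ?_
    rw [Finset.mem_filter_univ, not_le] at hi
    have h1 := cube_mul_sub_sq_le_of_lt hk hc0 hi (hκℓ i)
    have h2 := mul_le_mul_of_nonneg_right hCH (pow_nonneg (hℓ i).le 5)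
    linarith
  linarith only [hsplit, hsI, hsJ, hsH, hmain]

/-- The inequality for long total chord length. -/
lemma le_perimeter_of_le_sum_chord {ι : Type*} [Fintype ι] {E : Set Plane}
    (hE : MeasurableSet E) (hP : perimeter E < ⊤) {γ : ι → CircularArc}
    (hγ : ∀ i, (γ i).IsBoundaryArc E)
    (hd : ∀ i j, i ≠ j → Disjoint (γ i).openCarrier (γ j).openCarrier) {R C : ℝ} (hR : 0 < R)
    (hS : 4 * Real.pi * R ≤ ∑ i, (γ i).chord) (hC : (1 / R) ^ 4 ≤ C) :
    2 * Real.pi * R + ∑ i, ((γ i).chord ^ 3 * ((γ i).curvature - 1 / R) ^ 2 / 24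
      - C * (γ i).chord ^ 5) ≤ (perimeter E).toReal := by
  have h : ∀ i, (γ i).chord ^ 3 * ((γ i).curvature - 1 / R) ^ 2 / 24 - C * (γ i).chord ^ 5
      ≤ (γ i).length - (γ i).chord / 2 := by
    intro i
    have h0 := (γ i).chord_pos
    have h1 : |(γ i).curvature| * (γ i).chord ≤ 2 := by
      rw [chord_eq_chordLength]; exact abs_mul_chordLength_le
    have h2 := cube_mul_sub_sq_le (one_div_pos.2 hR) h0 h1
    have h3 := chordLength_add_le (γ i).length_pos.le (γ i).not_closed.le
    rw [← chord_eq_chordLength] at h3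
    have h4 := mul_le_mul_of_nonneg_right hC (pow_nonneg h0.le 5)
    have h5 : 0 ≤ (γ i).curvature ^ 4 * (γ i).chord ^ 5 / 640 := by positivity
    linarith
  have hsum := Finset.sum_le_sum fun i (_ : i ∈ Finset.univ) => h i
  rw [Finset.sum_sub_distrib (f := fun i => (γ i).length), ← Finset.sum_div] at hsum
  linarith [sum_length_le_perimeter hE hP hγ hd]

end

theorem theorem3p4 (κbar : ℝ) (hκbar : 0 < κbar) (A : ℝ) (hA : 0 < A) :
    ∃ C : ℝ, 0 ≤ C ∧
      ∀ E : Set Plane, IsOpen E → volume E = ENNReal.ofReal A → perimeter E < ⊤ →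
      ∀ (m : ℕ) (γ : Fin m → CircularArc),
        (∀ i, (γ i).IsBoundaryArc E) →
        (∀ i j, i ≠ j → Disjoint (γ i).openCarrier (γ j).openCarrier) →
        (∀ i, (γ i).curvature ≤ κbar) →
        √(4 * Real.pi * area E)
            + 1 / 24 * ∑ i, (γ i).chord ^ 3 * ((γ i).curvature - idealCurvature E) ^ 2
            - C * ∑ i, (γ i).chord ^ 5
          ≤ (perimeter E).toReal := by
  have hπ := Real.pi_pos
  set R := √(A / Real.pi) with hRdef
  have hR : 0 < R := Real.sqrt_pos.2 (by positivity)
  have hAR : A = Real.pi * R ^ 2 := by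
    rw [hRdef, Real.sq_sqrt (by positivity)]; field_simp
  -- The chord threshold. The first two bounds make recurving possible, the second also excludes
  -- several caps in `le_of_detach`, the third bounds the deviation of a large cap by its chord, and
  -- the last keeps the modified area positive.
  obtain ⟨c, hc0, hcR, hc, hc', hc''⟩ : ∃ c, 0 < c ∧ c ≤ R ∧ c ≤ 1 / κbar / 4 ∧
      c * (1 / (1 / κbar) + 1 / R) ≤ 1 ∧ c * (2 + 8 * κbar ^ 3 * R ^ 3) ≤ R := by
    refine ⟨min (min R (1 / κbar / 4)) (min (1 / (1 / (1 / κbar) + 1 / R))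
      (R / (2 + 8 * κbar ^ 3 * R ^ 3))), by positivity,
      (min_le_left _ _).trans (min_le_left _ _), (min_le_left _ _).trans (min_le_right _ _), ?_, ?_⟩
    · rw [← le_div_iff₀ (by positivity)]
      exact (min_le_right _ _).trans (min_le_left _ _)
    · rw [← le_div_iff₀ (by positivity)]
      exact (min_le_right _ _).trans (min_le_right _ _)
  obtain ⟨K, hK⟩ : ∃ K, K = 1 / R ^ 3 + R ^ 3 / (1 / κbar * R) ^ 2 / R ^ 2 := ⟨_, rfl⟩
  obtain ⟨N, hN⟩ : ∃ N, N = K * (4 * Real.pi * R) := ⟨_, rfl⟩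
  have hN0 : 0 ≤ N := by rw [hN, hK]; positivity
  -- One requirement each for the recurved arcs, the large caps, the long chords, and the case of
  -- long total chord length.
  obtain ⟨C, hCI, hCJ, hCH, hCA⟩ : ∃ C, (1 / R) ^ 4 + κbar ^ 3 / R + N ^ 2 / (4 * (1 / 640))
      + N * ((1 / R) ^ 2 + 2 * (κbar ^ 3) ^ 2 * R ^ 4) ≤ C ∧ 1 / (1 / κbar * R) ^ 2 ≤ C ∧
      (2 / c + 1 / R) ^ 2 / c ^ 2 ≤ C ∧ (1 / R) ^ 4 ≤ C :=
    ⟨max (max _ _) (max _ _), (le_max_left _ _).trans (le_max_left _ _),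
      (le_max_right _ _).trans (le_max_left _ _), (le_max_left _ _).trans (le_max_right _ _),
      (le_max_right _ _).trans (le_max_right _ _)⟩
  refine ⟨C, le_trans (by positivity) hCA, fun E hE hvol hP m γ hγ hd hκ => ?_⟩
  have harea : area E = Real.pi * R ^ 2 := by
    rw [area, hvol, ENNReal.toReal_ofReal hA.le, hAR]
  have hEfin : volume E ≠ ⊤ := by rw [hvol]; exact ENNReal.ofReal_ne_top
  have hcurv : idealCurvature E = 1 / R := by
    rw [idealCurvature, harea, mul_div_cancel_left₀ _ hπ.ne', Real.sqrt_sq hR.le]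
  have hsqrt : √(4 * Real.pi * area E) = 2 * Real.pi * R := by
    rw [harea, show 4 * Real.pi * (Real.pi * R ^ 2) = (2 * Real.pi * R) ^ 2 by ring,
      Real.sqrt_sq (by positivity)]
  have hsum : ∀ f h : Fin m → ℝ, ∑ i, (f i / 24 - C * h i) = 1 / 24 * ∑ i, f i - C * ∑ i, h i := by
    intro f h
    rw [Finset.sum_sub_distrib, ← Finset.sum_div, ← Finset.mul_sum]
    ring
  rw [hsqrt, hcurv, add_sub_assoc, ← hsum]
  rcases le_total (∑ i, (γ i).chord) (4 * Real.pi * R) with hS | hS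
  · exact le_perimeter_of_sum_chord_le hE.measurableSet hEfin hP hγ hd hR harea hκbar hκ hS hc0 hcR
      hc hc' hc'' hK hN hCI hCJ hCH
  · exact le_perimeter_of_le_sum_chord hE.measurableSet hP hγ hd hR hS hCA
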